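/- There is a computable function $f:\mathbb N^3\to\mathbb N$ and a single algorithm $\mathbb A$ (a program of a random access machine with uniform cost measure and with addition and truncated subtraction as its arithmetic) such that the following holds for all $s,k,c\in\mathbb N$. Let $\varphi$ be a first-order formula with at most $s$ distinct variable names (names may be requantified) over the language of $c$-colored graphs, that is, built from $x=y$, $E(x,y)$ and $C_1(x),\dots,C_c(x)$ by the boolean connectives $\neg,\wedge,\vee,\to,\leftrightarrow$ and the quantifiers $\exists x$, $\forall x$. Let $T$ be a finite tree, each of whose vertices has exactly one of $c$ colors, and which has depth at most $k$, that is, it has a vertex $r$ such that every vertex is at distance at most $k$ from $r$. Given $\varphi$, as a string of symbols in prefix notation, and $T$, by its vertex colors and its adjacency lists (with vertices numbered and neighbors listed in any order, and with no root marked), $\mathbb A$ halts and decides whether $T\models\varphi$ in time $\mathcal O\bigl(f(s,k,c)\cdot(|T|+|\varphi|)\bigr)$, where $|T|$ is the number of vertices of $T$, $|\varphi|$ is the number of symbols of $\varphi$, and the constant in the $\mathcal O$ is absolute. The numbers $s,k,c$ are not part of the input. Here $T\models\varphi$ means that $\varphi$ is true in $T$ under every assignment of vertices to its variables; for a sentence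 this is just truth in $T$. -/

import Mathlib

/-! ## First-order logic of colored graphs, with named (reusable) variables -/

/-- First-order formulas over the language of `c`-colored graphs: equality, adjacency, the `c`
color predicates, the boolean connectives and the two quantifiers. Variables are names (natural
numbers) and may be quantified again, so that the number of variables of a formula is meaningful;
this is why the de Bruijn-style formulas `FirstOrder.Language.BoundedFormula` are not used. -/
inductive FOFormula (c : ℕ) : Type
  | eq (x y : ℕ)
  | adj (x y : ℕ)
  | color (i : Fin c) (x : ℕ)
  | not (φ : FOFormula c)
  | and (φ ψ : FOFormula c)
  | or (φ ψ : FOFormula c)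
  | imp (φ ψ : FOFormula c)
  | iff (φ ψ : FOFormula c)
  | ex (x : ℕ) (φ : FOFormula c)
  | all (x : ℕ) (φ : FOFormula c)

namespace FOFormula

variable {c : ℕ}

/-- The set of all variable names that occur in a formula, free, bound or as the name of a
quantifier. Its cardinality is the number of variables of the formula. -/
def vars : FOFormula c → Finset ℕ
  | eq x y => {x, y}
  | adj x y => {x, y}
  | color _ x => {x}
  | not φ => φ.vars
  | and φ ψ => φ.vars ∪ ψ.vars
  | or φ ψ => φ.vars ∪ ψ.vars
  | imp φ ψ => φ.vars ∪ ψ.vars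
  | iff φ ψ => φ.vars ∪ ψ.vars
  | ex x φ => insert x φ.vars
  | all x φ => insert x φ.vars

/-- Truth of a formula in the graph `G` with vertex coloring `col`, under the assignment `v`. -/
def Sat {V : Type} (G : SimpleGraph V) (col : V → Fin c) : FOFormula c → (ℕ → V) → Prop
  | eq x y, v => v x = v y
  | adj x y, v => G.Adj (v x) (v y)
  | color i x, v => col (v x) = i
  | not φ, v => ¬ φ.Sat G col v
  | and φ ψ, v => φ.Sat G col v ∧ ψ.Sat G col v
  | or φ ψ, v => φ.Sat G col v ∨ ψ.Sat G col v
  | imp φ ψ, v => φ.Sat G col v → ψ.Sat G col v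
  | iff φ ψ, v => (φ.Sat G col v ↔ ψ.Sat G col v)
  | ex x φ, v => ∃ a : V, φ.Sat G col (Function.update v x a)
  | all x φ, v => ∀ a : V, φ.Sat G col (Function.update v x a)

/-- The colored graph is a model of `φ`: `φ` is true under every assignment. For a sentence in a
nonempty graph this is just truth; free variables are read as universally quantified. -/
def Models {V : Type} (G : SimpleGraph V) (col : V → Fin c) (φ : FOFormula c) : Prop :=
  ∀ v : ℕ → V, φ.Sat G col v

/-- The formula as a string of symbols (one machine word per symbol), in prefix notation. -/
def encode : FOFormula c → List ℕ
  | eq x y => [0, x, y]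
  | adj x y => [1, x, y]
  | color i x => [2, (i : ℕ), x]
  | not φ => 3 :: φ.encode
  | and φ ψ => 4 :: (φ.encode ++ ψ.encode)
  | or φ ψ => 5 :: (φ.encode ++ ψ.encode)
  | imp φ ψ => 6 :: (φ.encode ++ ψ.encode)
  | iff φ ψ => 7 :: (φ.encode ++ ψ.encode)
  | ex x φ => 8 :: x :: φ.encode
  | all x φ => 9 :: x :: φ.encode

/-- The length `|φ|` of a formula: its number of symbols. -/
def length (φ : FOFormula c) : ℕ := φ.encode.length

end FOFormula

/-! ## Colored trees as input -/

/-- `G` has depth at most `k`: for a suitable choice of the root, every vertex is at distance at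
most `k` from the root. (Used for trees only, which are connected.) -/
def HasDepthAtMost {V : Type} (G : SimpleGraph V) (k : ℕ) : Prop :=
  ∃ r : V, ∀ v : V, G.dist r v ≤ k

/-- `nb` is an adjacency-list representation of `G`: the list of `v` enumerates the neighbors of
`v`, each once, in an arbitrary order. -/
def IsAdjacencyList {n : ℕ} (G : SimpleGraph (Fin n)) (nb : Fin n → List (Fin n)) : Prop :=
  ∀ v : Fin n, (nb v).Nodup ∧ ∀ w : Fin n, w ∈ nb v ↔ G.Adj v w

/-- A colored graph on the vertices `0, …, n - 1`, given by adjacency lists, as a string of words: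
the number of vertices, the colors of the vertices, and then, for every vertex, the length of its
adjacency list followed by that list. No root is marked. -/
def encodeColoredGraph {n c : ℕ} (col : Fin n → Fin c) (nb : Fin n → List (Fin n)) : List ℕ :=
  n :: (List.ofFn (fun v => (col v : ℕ)) ++
    (List.finRange n).flatMap (fun v => (nb v).length :: (nb v).map (fun w => (w : ℕ))))

/-! ## Random access machines with uniform cost -/

namespace RAM

/-- Expressions of a random access machine: constants, registers, memory access (`idx a e` is the
content of cell number `e` of the array `a`), addition, truncated subtraction and comparison. The
names of registers and arrays are constants of the program; only cells are addressed indirectly. -/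
inductive Expr : Type
  | const (m : ℕ)
  | reg (x : ℕ)
  | idx (a : ℕ) (e : Expr)
  | add (e₁ e₂ : Expr)
  | sub (e₁ e₂ : Expr)
  | eq (e₁ e₂ : Expr)
  | lt (e₁ e₂ : Expr)

/-- Programs. A program mentions only finitely many registers and finitely many arrays. -/
inductive Prog : Type
  | skip
  | assign (x : ℕ) (e : Expr)
  | store (a : ℕ) (i e : Expr)
  | seq (p q : Prog)
  | ite (e : Expr) (p q : Prog)
  | loop (e : Expr) (p : Prog)

/-- The memory: registers, and arrays of infinitely many cells. All of them hold natural numbers. -/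
structure State : Type where
  reg : ℕ → ℕ
  mem : ℕ → ℕ → ℕ

/-- The value of an expression; comparisons return `1` for true and `0` for false. -/
def Expr.eval (σ : State) : Expr → ℕ
  | const m => m
  | reg x => σ.reg x
  | idx a e => σ.mem a (e.eval σ)
  | add e₁ e₂ => e₁.eval σ + e₂.eval σ
  | sub e₁ e₂ => e₁.eval σ - e₂.eval σ
  | eq e₁ e₂ => if e₁.eval σ = e₂.eval σ then 1 else 0
  | lt e₁ e₂ => if e₁.eval σ < e₂.eval σ then 1 else 0

/-- The cost of evaluating an expression: one step for each operation, constant and access. -/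
def Expr.cost : Expr → ℕ
  | const _ => 1
  | reg _ => 1
  | idx _ e => e.cost + 1
  | add e₁ e₂ => e₁.cost + e₂.cost + 1
  | sub e₁ e₂ => e₁.cost + e₂.cost + 1
  | eq e₁ e₂ => e₁.cost + e₂.cost + 1
  | lt e₁ e₂ => e₁.cost + e₂.cost + 1

/-- Write `m` into register `x`. -/
def State.setReg (σ : State) (x m : ℕ) : State :=
  { σ with reg := Function.update σ.reg x m }

/-- Write `m` into cell `i` of the array `a`. -/
def State.setMem (σ : State) (a i m : ℕ) : State :=
  { σ with mem := Function.update σ.mem a (Function.update (σ.mem a) i m) }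

/-- `Exec p σ t τ`: started in the memory `σ`, the program `p` halts after exactly `t` steps and
leaves the memory `τ`. `ite e p q` runs `p` if `e` is nonzero and `q` otherwise; `loop e p` repeats
`p` as long as `e` is nonzero. Each executed command costs one step, plus the cost of the
expressions that it evaluates. -/
inductive Exec : Prog → State → ℕ → State → Prop
  | skip (σ : State) : Exec .skip σ 1 σ
  | assign (σ : State) (x : ℕ) (e : Expr) :
      Exec (.assign x e) σ (e.cost + 1) (σ.setReg x (e.eval σ))
  | store (σ : State) (a : ℕ) (i e : Expr) :
      Exec (.store a i e) σ (i.cost + e.cost + 1) (σ.setMem a (i.eval σ) (e.eval σ))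
  | seq {p q : Prog} {σ τ ρ : State} {t u : ℕ} (hp : Exec p σ t τ) (hq : Exec q τ u ρ) :
      Exec (.seq p q) σ (t + u) ρ
  | ite_true {e : Expr} {p q : Prog} {σ τ : State} {t : ℕ} (he : e.eval σ ≠ 0)
      (hp : Exec p σ t τ) : Exec (.ite e p q) σ (e.cost + 1 + t) τ
  | ite_false {e : Expr} {p q : Prog} {σ τ : State} {t : ℕ} (he : e.eval σ = 0)
      (hq : Exec q σ t τ) : Exec (.ite e p q) σ (e.cost + 1 + t) τ
  | loop_done {e : Expr} {p : Prog} {σ : State} (he : e.eval σ = 0) :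
      Exec (.loop e p) σ (e.cost + 1) σ
  | loop_step {e : Expr} {p : Prog} {σ τ ρ : State} {t u : ℕ} (he : e.eval σ ≠ 0)
      (hp : Exec p σ t τ) (hl : Exec (.loop e p) τ u ρ) :
      Exec (.loop e p) σ (e.cost + 1 + t + u) ρ

/-- The machine is deterministic: running time and result are determined by program and input. -/
theorem Exec.deterministic {p : Prog} {σ τ τ' : State} {t t' : ℕ}
    (h : Exec p σ t τ) (h' : Exec p σ t' τ') : t = t' ∧ τ = τ' := by
  induction h generalizing t' τ' with
  | skip => cases h'; exact ⟨rfl, rfl⟩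
  | assign => cases h'; exact ⟨rfl, rfl⟩
  | store => cases h'; exact ⟨rfl, rfl⟩
  | seq _ _ ihp ihq =>
    cases h' with
    | seq hp' hq' =>
      obtain ⟨rfl, rfl⟩ := ihp hp'
      obtain ⟨rfl, rfl⟩ := ihq hq'
      exact ⟨rfl, rfl⟩
  | ite_true he _ ih =>
    cases h' with
    | ite_true _ hp' => obtain ⟨rfl, rfl⟩ := ih hp'; exact ⟨rfl, rfl⟩
    | ite_false he' _ => exact absurd he' he
  | ite_false he _ ih =>
    cases h' with
    | ite_true he' _ => exact absurd he he'
    | ite_false _ hq' => obtain ⟨rfl, rfl⟩ := ih hq'; exact ⟨rfl, rfl⟩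
  | loop_done he =>
    cases h' with
    | loop_done _ => exact ⟨rfl, rfl⟩
    | loop_step he' _ _ => exact absurd he he'
  | loop_step he _ _ ihp ihl =>
    cases h' with
    | loop_done he' => exact absurd he' he
    | loop_step _ hp' hl' =>
      obtain ⟨rfl, rfl⟩ := ihp hp'
      obtain ⟨rfl, rfl⟩ := ihl hl'
      exact ⟨rfl, rfl⟩

/-- The initial memory on the two input strings `u` and `w`: they stand in the arrays `0` and `1`,
their lengths in the registers `0` and `1`, and everything else is `0`. -/
def initial (u w : List ℕ) : State where
  reg x := if x = 0 then u.length else if x = 1 then w.length else 0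
  mem a i := if a = 0 then u.getD i 0 else if a = 1 then w.getD i 0 else 0

/-- On input `u`, `w`, the program `p` halts within `b` steps and answers (in register `0`) `1` if
the proposition `A` holds, and `0` if it does not. -/
def DecidesWithin (p : Prog) (u w : List ℕ) (A : Prop) (b : ℕ) : Prop :=
  ∃ (t : ℕ) (τ : State), Exec p (initial u w) t τ ∧ t ≤ b ∧
    (A → τ.reg 0 = 1) ∧ (¬ A → τ.reg 0 = 0)

end RAM

/-! ## Back and forth in rooted trees -/

namespace FOFormula

variable {c : ℕ} {V : Type}

/-! A formula with at most s variables can only count up to s in a tree. Root the tree and give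
every vertex a code, from the deepest level upwards: the code records the color and, for each code
g, the number of children with code g, truncated at s. Two tuples of at most s vertices satisfy the
same formulas if their ancestors coincide in the same pattern and carry the same codes (`PathRel`).
This is a pebble game. With fewer than s pebbles placed, any further vertex p has a partner: as far
as the path from the root to p runs along paths to pebbles the partner path is forced, and from
there on it descends through children of the right codes that lead to no pebble. Such children exist
because corresponding vertices have equal truncated counts and fewer than s pebbles can be in the
way (`exists_pathExt`).

The set A in which partners are sought need not be the whole tree. It suffices that it contains the
root, is closed under parents and retains, of the children with a given code of each of its
vertices, all or at least s (`CountClosed`). Hence validity in the tree equals validity in A with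
quantifiers relativized to A (`models_iff_satOn`).

Codes are made numbers by taking a base b larger than s and all colors: digit 0 is the color and
digit g + 1 the truncated number of children with code g. A vertex is kept if fewer than s siblings
with its code g have been kept before, and then b ^ (g + 1) is added to the code of its parent
(`CodeInv.keep`, `CodeInv.skip`). Equal codes thus have equal digits (`CodeInv.digits_eq`), codes
are bounded by a tower in the depth (`CodeInv.code_lt`), and the vertices all of whose ancestors are
kept form a set A whose size is bounded in terms of s, k and c (`CodeInv.countClosed`,
`CodeInv.card_reducedTree_le`).

In a set A of bounded size N there are at most N ^ s assignments to the variables. The formula is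
evaluated bottom-up, with a full truth table for each subformula, so that each symbol costs a time
depending only on the parameters. Reading the input and computing the codes is linear in the tree
for fixed parameters. The machine finds everything it needs in the input: the number of variables by
numbering their names, the base by inspecting the colors, and a bound on the height by breadth-first
search from vertex 0, which at most doubles the depth (`HasDepthAtMost.dist_le`).

Programs are verified in a small calculus of total correctness with time bounds (`Runs`), in which
unchanged memory is read off from the program text (`Exec.frame`). -/

/-- Truth of a formula with all quantifiers relativized to the set `A`. -/
def SatOn (G : SimpleGraph V) (col : V → Fin c) (A : Set V) : FOFormula c → (ℕ → V) → Prop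
  | eq x y, v => v x = v y
  | adj x y, v => G.Adj (v x) (v y)
  | color i x, v => col (v x) = i
  | not φ, v => ¬ φ.SatOn G col A v
  | and φ ψ, v => φ.SatOn G col A v ∧ ψ.SatOn G col A v
  | or φ ψ, v => φ.SatOn G col A v ∨ ψ.SatOn G col A v
  | imp φ ψ, v => φ.SatOn G col A v → ψ.SatOn G col A v
  | iff φ ψ, v => (φ.SatOn G col A v ↔ ψ.SatOn G col A v)
  | ex x φ, v => ∃ a ∈ A, φ.SatOn G col A (Function.update v x a)
  | all x φ, v => ∀ a ∈ A, φ.SatOn G col A (Function.update v x a)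

theorem satOn_univ (G : SimpleGraph V) (col : V → Fin c) (φ : FOFormula c) (v : ℕ → V) :
    φ.SatOn G col Set.univ v ↔ φ.Sat G col v := by
  induction φ generalizing v <;> simp_all [SatOn, Sat]

end FOFormula

/-- `par` is the parent map of a tree with root `r`, in which `dp` is the distance to the root. -/
structure IsParentMap {V : Type} (r : V) (dp : V → ℕ) (par : V → V) : Prop where
  par_root : par r = r
  dp_root : dp r = 0
  dp_par : ∀ v, v ≠ r → dp (par v) + 1 = dp v

namespace IsParentMap

variable {V : Type} {r : V} {dp : V → ℕ} {par : V → V}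

theorem iterate_root (h : IsParentMap r dp par) (i : ℕ) : par^[i] r = r :=
  Function.iterate_fixed h.par_root i

theorem par_eq_self_iff (h : IsParentMap r dp par) (v : V) : par v = v ↔ v = r := by
  refine ⟨fun hv => ?_, fun hv => hv ▸ h.par_root⟩
  by_contra hne
  have := h.dp_par v hne
  rw [hv] at this
  omega

theorem dp_par_le (h : IsParentMap r dp par) (v : V) : dp (par v) ≤ dp v := by
  by_cases hv : v = r
  · rw [hv, h.par_root]
  · have := h.dp_par v hv
    omega

theorem dp_iterate_le (h : IsParentMap r dp par) (i : ℕ) (v : V) : dp (par^[i] v) ≤ dp v := by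
  induction i with
  | zero => simp
  | succ i ih => rw [Function.iterate_succ_apply']; exact (h.dp_par_le _).trans ih

theorem iterate_par_ne (h : IsParentMap r dp par) {v : V} (hv : v ≠ r) (i : ℕ) :
    par^[i] (par v) ≠ v := by
  intro he
  have h1 := h.dp_iterate_le i (par v)
  have h2 := h.dp_par v hv
  rw [he] at h1
  omega

end IsParentMap

section BackAndForth

open Classical in
/-- The non-root vertices in `A` with parent `p` and code `g`. -/
noncomputable def childrenIn {V : Type} [Fintype V] (r : V) (par : V → V) (code : V → ℕ)
    (A : Set V) (p : V) (g : ℕ) : Finset V :=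
  Finset.univ.filter fun u => u ∈ A ∧ u ≠ r ∧ par u = p ∧ code u = g

theorem mem_childrenIn {V : Type} [Fintype V] {r : V} {par : V → V} {code : V → ℕ}
    {A : Set V} {p : V} {g : ℕ} {u : V} :
    u ∈ childrenIn r par code A p g ↔ u ∈ A ∧ u ≠ r ∧ par u = p ∧ code u = g := by
  simp [childrenIn]

/-- `A` contains the root, is closed under parents, and contains from the children of each of its
vertices with a given code all or at least `s`. -/
structure CountClosed {V : Type} [Fintype V] (r : V) (par : V → V) (code : V → ℕ) (s : ℕ)
    (A : Set V) : Prop where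
  root_mem : r ∈ A
  par_mem : ∀ v ∈ A, par v ∈ A
  min_card : ∀ q ∈ A, ∀ g, min (childrenIn r par code Set.univ q g).card s ≤
    (childrenIn r par code A q g).card

/-- The code of a vertex determines the numbers, counted up to `s`, of its children with a given
code. -/
def CodeCounts {V : Type} [Fintype V] (r : V) (par : V → V) (code : V → ℕ) (s : ℕ) : Prop :=
  ∀ p q, code p = code q → ∀ g, min (childrenIn r par code Set.univ p g).card s =
    min (childrenIn r par code Set.univ q g).card s

/-- The ancestors of the vertices `a x` and `b x`, for `x ∈ X`, coincide in the same way and have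
the same codes. -/
structure PathRel {V : Type} (par : V → V) (code : V → ℕ) (X : Finset ℕ) (a b : ℕ → V) : Prop where
  eq_iff : ∀ x ∈ X, ∀ y ∈ X, ∀ i j,
    par^[i] (a x) = par^[j] (a y) ↔ par^[i] (b x) = par^[j] (b y)
  code_eq : ∀ x ∈ X, ∀ i, code (par^[i] (a x)) = code (par^[i] (b x))

/-- The vertices `p` and `q` may be appended to the tuples `a` and `b`. -/
structure PathExt {V : Type} (par : V → V) (code : V → ℕ) (X : Finset ℕ) (a b : ℕ → V)
    (p q : V) : Prop where
  eq_iff : ∀ x ∈ X, ∀ i j, par^[i] p = par^[j] (a x) ↔ par^[i] q = par^[j] (b x)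
  self_iff : ∀ i j, par^[i] p = par^[j] p ↔ par^[i] q = par^[j] q
  code_eq : ∀ i, code (par^[i] p) = code (par^[i] q)

variable {V : Type} {r : V} {dp : V → ℕ} {par : V → V} {code : V → ℕ} {X Y : Finset ℕ}
  {a b : ℕ → V} {p q : V} {s : ℕ} {A : Set V}

namespace PathRel

theorem refl (a : ℕ → V) : PathRel par code X a a :=
  ⟨fun _ _ _ _ _ _ => Iff.rfl, fun _ _ _ => rfl⟩

theorem symm (h : PathRel par code X a b) : PathRel par code X b a :=
  ⟨fun x hx y hy i j => (h.eq_iff x hx y hy i j).symm, fun x hx i => (h.code_eq x hx i).symm⟩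

theorem mono (h : PathRel par code X a b) (hY : Y ⊆ X) : PathRel par code Y a b :=
  ⟨fun x hx y hy => h.eq_iff x (hY hx) y (hY hy), fun x hx => h.code_eq x (hY hx)⟩

theorem congr_right (h : PathRel par code X a b) {b' : ℕ → V} (hb : ∀ x ∈ X, b x = b' x) :
    PathRel par code X a b' :=
  ⟨fun x hx y hy i j => by rw [← hb x hx, ← hb y hy]; exact h.eq_iff x hx y hy i j,
    fun x hx i => by rw [← hb x hx]; exact h.code_eq x hx i⟩

theorem update (h : PathRel par code X a b) {z : ℕ} (hz : z ∉ X)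
    (he : PathExt par code X a b p q) :
    PathRel par code (insert z X) (Function.update a z p) (Function.update b z q) := by
  have hne : ∀ x ∈ X, x ≠ z := fun x hx hxz => hz (hxz ▸ hx)
  constructor
  · intro x hx y hy i j
    rcases Finset.mem_insert.1 hx with hxz | hx <;> rcases Finset.mem_insert.1 hy with hyz | hy
    · simpa [hxz, hyz] using he.self_iff i j
    · simpa [hxz, hne y hy] using he.eq_iff y hy i j
    · simpa [hyz, hne x hx, eq_comm] using he.eq_iff x hx j i
    · simpa [hne x hx, hne y hy] using h.eq_iff x hx y hy i j
  · intro x hx i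
    rcases Finset.mem_insert.1 hx with rfl | hx
    · simpa using he.code_eq i
    · simpa [hne x hx] using h.code_eq x hx i

end PathRel

theorem iterate_mem_of_par_mem (h : ∀ v ∈ A, par v ∈ A) {v : V} (hv : v ∈ A) (i : ℕ) :
    par^[i] v ∈ A := by
  induction i with
  | zero => exact hv
  | succ i ih => rw [Function.iterate_succ_apply']; exact h _ ih

variable [Fintype V]

/-- Induction on the depth of `p`. The root is its own partner, and if `p` is `par^[m] (a x)`, its
partner is `par^[m] (b x)`. Otherwise `par p` has a partner `q₀` with the same code, and a child of
`q₀` in `A` with the code of `p` is needed that is no ancestor of any `b x`. If all these children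
were such ancestors, there would be fewer than `s` of them, and also fewer than there are children
of `par p` with the code of `p`; this contradicts the equality of the truncated counts. -/
theorem exists_pathExt (hpar : IsParentMap r dp par) (hA : CountClosed r par code s A)
    (hcode : CodeCounts r par code s) (hX : X.card < s)
    (h : PathRel par code X a b) (hb : ∀ x ∈ X, b x ∈ A) (p : V) :
    ∃ q ∈ A, PathExt par code X a b p q := by
  classical
  obtain ⟨d, hd⟩ : ∃ d, dp p = d := ⟨_, rfl⟩
  induction d using Nat.strong_induction_on generalizing p with
  | _ d ih =>
  by_cases hp : p = r
  · subst hp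
    refine ⟨p, hA.root_mem, fun x hx i j => ?_, fun _ _ => Iff.rfl, fun _ => rfl⟩
    -- The root is the only fixed point of `par`, so that `par^[j] (a x)` is the root if and only if
    -- it equals `par^[j + 1] (a x)`, which is a case of the relation between `a` and `b`.
    rw [hpar.iterate_root, eq_comm, ← hpar.par_eq_self_iff, eq_comm (a := p),
      ← hpar.par_eq_self_iff, ← Function.iterate_succ_apply' par, ← Function.iterate_succ_apply' par]
    exact h.eq_iff x hx x hx _ _
  by_cases hanc : ∃ x ∈ X, ∃ i, par^[i] (a x) = p
  · obtain ⟨x, hx, m, rfl⟩ := hanc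
    refine ⟨par^[m] (b x), iterate_mem_of_par_mem hA.par_mem (hb x hx) m, ?_, ?_, ?_⟩
    · intro y hy i j
      simp only [← Function.iterate_add_apply]
      exact h.eq_iff x hx y hy _ _
    · intro i j
      simp only [← Function.iterate_add_apply]
      exact h.eq_iff x hx x hx _ _
    · intro i
      simp only [← Function.iterate_add_apply]
      exact h.code_eq x hx _
  push Not at hanc
  have hlt := hpar.dp_par p hp
  obtain ⟨q₀, hq₀, he⟩ := ih (dp (par p)) (by omega) (par p) rfl
  have hmin := hcode (par p) q₀ (he.code_eq 0) (code p)
  obtain ⟨q, hq, hqn⟩ : ∃ q ∈ childrenIn r par code A q₀ (code p),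
      ∀ x ∈ X, ∀ i, par^[i] (b x) ≠ q := by
    by_contra! hall
    choose! xf hxf jf hjf using hall
    -- Siblings have equal depth, so a chain of parents meets at most one of them; thus `xf` is
    -- injective on these children.
    have hle : (childrenIn r par code A q₀ (code p)).card ≤ X.card := by
      refine Finset.card_le_card_of_injOn xf (fun u hu => hxf u hu) ?_
      intro u hu u' hu' hx
      have hu1 := mem_childrenIn.1 (Finset.mem_coe.1 hu)
      have hu1' := mem_childrenIn.1 (Finset.mem_coe.1 hu')
      have e1 := hjf u hu
      have e2 := hjf u' hu'
      rw [← hx] at e2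
      have hd1 := hpar.dp_par u hu1.2.1
      have hd2 := hpar.dp_par u' hu1'.2.1
      rw [hu1.2.2.1] at hd1
      rw [hu1'.2.2.1] at hd2
      rcases Nat.lt_trichotomy (jf u) (jf u') with hlt | heq | hlt
      · exfalso
        obtain ⟨m, hm⟩ := Nat.exists_eq_add_of_lt hlt
        have : par^[m] (par u) = u' := by
          rw [hm, show jf u + m + 1 = (m + 1) + jf u by omega, Function.iterate_add_apply, e1,
            Function.iterate_succ_apply] at e2
          exact e2
        have h3 := hpar.dp_iterate_le m (par u)
        rw [this, hu1.2.2.1] at h3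
        omega
      · rw [← e1, ← e2, heq]
      · exfalso
        obtain ⟨m, hm⟩ := Nat.exists_eq_add_of_lt hlt
        have : par^[m] (par u') = u := by
          rw [hm, show jf u' + m + 1 = (m + 1) + jf u' by omega, Function.iterate_add_apply, e2,
            Function.iterate_succ_apply] at e1
          exact e1
        have h3 := hpar.dp_iterate_le m (par u')
        rw [this, hu1'.2.2.1] at h3
        omega
    have hA' := hA.min_card q₀ hq₀ (code p)
    have hmem : p ∈ childrenIn r par code Set.univ (par p) (code p) :=
      mem_childrenIn.2 ⟨trivial, hp, rfl, rfl⟩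
    -- The occupied children of `q₀` are mirrored by ancestors of the `a x`. These are children of
    -- `par p` with the code of `p`, and none of them is `p`, whence the strict inequality.
    have hlt2 : (childrenIn r par code A q₀ (code p)).card <
        (childrenIn r par code Set.univ (par p) (code p)).card := by
      have : (childrenIn r par code A q₀ (code p)).card ≤
          ((childrenIn r par code Set.univ (par p) (code p)).erase p).card := by
        refine Finset.card_le_card_of_injOn (fun u => par^[jf u] (a (xf u))) ?_ ?_
        · intro u hu
          have hu1 := mem_childrenIn.1 (Finset.mem_coe.1 hu)
          have e1 := hjf u hu
          refine Finset.mem_coe.2 (Finset.mem_erase.2 ⟨hanc _ (hxf u hu) _,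
            mem_childrenIn.2 ⟨trivial, ?_, ?_, ?_⟩⟩)
          · rw [Ne, ← hpar.par_eq_self_iff, ← Function.iterate_succ_apply' par,
              h.eq_iff _ (hxf u hu) _ (hxf u hu), Function.iterate_succ_apply', e1,
              hpar.par_eq_self_iff]
            exact hu1.2.1
          · have := (he.eq_iff (xf u) (hxf u hu) 0 (jf u + 1)).2 (by
              rw [Function.iterate_succ_apply', e1, hu1.2.2.1]; rfl)
            rw [Function.iterate_succ_apply'] at this
            exact this.symm
          · rw [h.code_eq _ (hxf u hu), e1, hu1.2.2.2]
        · intro u hu u' hu' hx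
          have := (h.eq_iff _ (hxf u hu) _ (hxf u' hu') _ _).1 hx
          rwa [hjf u hu, hjf u' hu'] at this
      rw [Finset.card_erase_of_mem hmem] at this
      have := Finset.card_pos.2 ⟨p, hmem⟩
      omega
    rcases le_total s (childrenIn r par code Set.univ q₀ (code p)).card with h1 | h1
    · rw [min_eq_right h1] at hA'
      omega
    · rw [min_eq_left h1] at hA' hmin
      rcases min_le_iff.1 hmin.le with h2 | h2 <;> omega
  obtain ⟨hqA, hqr, hqp, hqc⟩ := mem_childrenIn.1 hq
  refine ⟨q, hqA, ?_, ?_, ?_⟩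
  · rintro x hx (_ | i) j
    · exact iff_of_false (fun h => hanc x hx j h.symm) fun h => hqn x hx j h.symm
    · rw [Function.iterate_succ_apply, Function.iterate_succ_apply, hqp]
      exact he.eq_iff x hx i j
  · rintro (_ | i) (_ | j)
    · simp
    · simp only [Function.iterate_succ_apply]
      exact iff_of_false (fun h => hpar.iterate_par_ne hp j h.symm)
        fun h => hpar.iterate_par_ne hqr j h.symm
    · simp only [Function.iterate_succ_apply]
      exact iff_of_false (hpar.iterate_par_ne hp i) (hpar.iterate_par_ne hqr i)
    · simp only [Function.iterate_succ_apply, hqp]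
      exact he.self_iff i j
  · rintro (_ | i)
    · exact hqc.symm
    · simp only [Function.iterate_succ_apply, hqp]
      exact he.code_eq i

variable {c : ℕ} {G : SimpleGraph V} {col : V → Fin c}

/-- Induction on the formula. The relation at exponents 0 and 1 compares vertices and parents, which
settles equality and adjacency, and codes determine colors. At a quantifier over `x` the pebble `x`
is lifted, which leaves fewer than `s` on the board, and `exists_pathExt` places it again. As `X`
stays fixed, requantified names need no care. -/
theorem PathRel.satOn_iff {B : Set V} (hpar : IsParentMap r dp par)
    (hG : ∀ u v, G.Adj u v ↔ u ≠ v ∧ (par u = v ∨ par v = u))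
    (hcol : ∀ p q, code p = code q → col p = col q)
    (hcode : CodeCounts r par code s) (hA : CountClosed r par code s A)
    (hB : CountClosed r par code s B) (φ : FOFormula c) (hφ : φ.vars ⊆ X) (hX : X.card ≤ s)
    (h : PathRel par code X a b) (ha : ∀ x ∈ X, a x ∈ A) (hb : ∀ x ∈ X, b x ∈ B) :
    φ.SatOn G col A a ↔ φ.SatOn G col B b := by
  have hext : ∀ {A : Set V}, CountClosed r par code s A → ∀ {a b : ℕ → V} {x : ℕ}, x ∈ X →
      PathRel par code X a b → (∀ y ∈ X, b y ∈ A) → ∀ p, ∃ q ∈ A,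
      PathRel par code X (Function.update a x p) (Function.update b x q) := by
    intro A hA a b x hx h hb p
    obtain ⟨q, hq, he⟩ := exists_pathExt hpar hA hcode (X := X.erase x)
      (by rw [Finset.card_erase_of_mem hx]; have := Finset.card_pos.2 ⟨x, hx⟩; omega)
      (h.mono (Finset.erase_subset x X)) (fun y hy => hb y (Finset.mem_of_mem_erase hy)) p
    refine ⟨q, hq, ?_⟩
    have := (h.mono (Finset.erase_subset x X)).update (Finset.notMem_erase x X) he
    rwa [Finset.insert_erase hx] at this
  have hupd : ∀ {A : Set V} {a : ℕ → V} {x : ℕ} {p : V}, (∀ y ∈ X, a y ∈ A) → p ∈ A →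
      ∀ y ∈ X, Function.update a x p y ∈ A := by
    intro A a x p ha hp y hy
    by_cases hyx : y = x
    · subst hyx; simpa using hp
    · simpa [hyx] using ha y hy
  induction φ generalizing a b with
  | eq x y =>
    exact h.eq_iff x (hφ (by simp [FOFormula.vars])) y (hφ (by simp [FOFormula.vars])) 0 0
  | adj x y =>
    have hx : x ∈ X := hφ (by simp [FOFormula.vars])
    have hy : y ∈ X := hφ (by simp [FOFormula.vars])
    have h0 := h.eq_iff x hx y hy 0 0
    have h1 := h.eq_iff x hx y hy 1 0
    have h2 := h.eq_iff y hy x hx 1 0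
    simp only [Function.iterate_zero, id, Function.iterate_one] at h0 h1 h2
    simp only [FOFormula.SatOn, hG, ne_eq, h0, h1, h2]
  | color i x =>
    have hx : x ∈ X := hφ (by simp [FOFormula.vars])
    exact iff_of_eq (congrArg (· = i) (hcol _ _ (h.code_eq x hx 0)))
  | not φ ih => exact not_congr (ih hφ h ha hb)
  | and φ ψ ih ih' =>
    exact and_congr (ih (Finset.union_subset_left hφ) h ha hb)
      (ih' (Finset.union_subset_right hφ) h ha hb)
  | or φ ψ ih ih' =>
    exact or_congr (ih (Finset.union_subset_left hφ) h ha hb)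
      (ih' (Finset.union_subset_right hφ) h ha hb)
  | imp φ ψ ih ih' =>
    exact imp_congr (ih (Finset.union_subset_left hφ) h ha hb)
      (ih' (Finset.union_subset_right hφ) h ha hb)
  | iff φ ψ ih ih' =>
    exact iff_congr (ih (Finset.union_subset_left hφ) h ha hb)
      (ih' (Finset.union_subset_right hφ) h ha hb)
  | ex x φ ih =>
    have hx : x ∈ X := hφ (Finset.mem_insert_self _ _)
    have hφ' : φ.vars ⊆ X := (Finset.subset_insert _ _).trans hφ
    constructor
    · rintro ⟨p, hp, hs⟩
      obtain ⟨q, hq, hr⟩ := hext hB hx h hb p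
      exact ⟨q, hq, (ih hφ' hr (hupd ha hp) (hupd hb hq)).1 hs⟩
    · rintro ⟨q, hq, hs⟩
      obtain ⟨p, hp, hr⟩ := hext hA hx h.symm ha q
      exact ⟨p, hp, (ih hφ' hr.symm (hupd ha hp) (hupd hb hq)).2 hs⟩
  | all x φ ih =>
    have hx : x ∈ X := hφ (Finset.mem_insert_self _ _)
    have hφ' : φ.vars ⊆ X := (Finset.subset_insert _ _).trans hφ
    constructor
    · intro hs q hq
      obtain ⟨p, hp, hr⟩ := hext hA hx h.symm ha q
      exact (ih hφ' hr.symm (hupd ha hp) (hupd hb hq)).1 (hs p hp)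
    · intro hs p hp
      obtain ⟨q, hq, hr⟩ := hext hB hx h hb p
      exact (ih hφ' hr (hupd ha hp) (hupd hb hq)).2 (hs q hq)

theorem countClosed_univ : CountClosed r par code s (Set.univ : Set V) :=
  ⟨trivial, fun _ _ => trivial, fun _ _ _ => min_le_left _ _⟩

/-- The pebbles are placed one by one with `exists_pathExt`. This moves an arbitrary assignment into
`A` without changing the truth of formulas in the variables `X`. -/
theorem exists_pathRel (hpar : IsParentMap r dp par) (hA : CountClosed r par code s A)
    (hcode : CodeCounts r par code s) (X : Finset ℕ) (hX : X.card ≤ s) (a : ℕ → V) :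
    ∃ b : ℕ → V, (∀ x, b x ∈ A) ∧ PathRel par code X a b := by
  induction X using Finset.induction_on with
  | empty => exact ⟨fun _ => r, fun _ => hA.root_mem, by simp, by simp⟩
  | insert x X hx ih =>
    rw [Finset.card_insert_of_notMem hx] at hX
    obtain ⟨b, hb, h⟩ := ih (by omega)
    obtain ⟨q, hq, he⟩ := exists_pathExt hpar hA hcode (by omega) h (fun x _ => hb x) (a x)
    refine ⟨Function.update b x q, fun y => ?_, ?_⟩
    · by_cases hy : y = x
      · subst hy; simpa using hq
      · simpa [hy] using hb y
    · have := h.update hx he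
      rwa [Function.update_eq_self] at this

/-- A formula with at most `s` variables is valid in the tree if and only if it holds, with
quantifiers relativized to `A`, under a family of assignments into `A` that is exhaustive on its
variables. -/
theorem models_iff_satOn (hpar : IsParentMap r dp par)
    (hG : ∀ u v, G.Adj u v ↔ u ≠ v ∧ (par u = v ∨ par v = u))
    (hcol : ∀ p q, code p = code q → col p = col q)
    (hcode : CodeCounts r par code s) (hA : CountClosed r par code s A) (φ : FOFormula c)
    (hφ : φ.vars.card ≤ s) (S : Set (ℕ → V)) (hS : ∀ v ∈ S, ∀ x, v x ∈ A)
    (hS' : ∀ v : ℕ → V, (∀ x, v x ∈ A) → ∃ w ∈ S, ∀ x ∈ φ.vars, v x = w x) :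
    φ.Models G col ↔ ∀ v ∈ S, φ.SatOn G col A v := by
  constructor
  · intro h v hv
    -- An assignment into `A` is related to itself; only the range of the quantifiers changes, from
    -- the whole tree to `A`.
    refine ((PathRel.refl v).satOn_iff hpar hG hcol hcode countClosed_univ hA φ subset_rfl hφ
      (fun _ _ => trivial) fun x _ => hS v hv x).1 ?_
    exact (φ.satOn_univ G col v).2 (h v)
  · intro h v
    obtain ⟨b, hb, hr⟩ := exists_pathRel hpar hA hcode φ.vars hφ v
    obtain ⟨w, hw, hbw⟩ := hS' b hb
    refine (φ.satOn_univ G col v).1 (((hr.congr_right hbw).satOn_iff hpar hG hcol hcode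
      countClosed_univ hA φ subset_rfl hφ (fun _ _ => trivial) fun x _ => hS w hw x).2 (h w hw))

end BackAndForth

/-! ## Total correctness of programs with time bounds -/

namespace RAM

/-- Started in `σ`, the program halts within `t` steps in a memory that satisfies `Q`. -/
def Runs (p : Prog) (σ : State) (t : ℕ) (Q : State → Prop) : Prop :=
  ∃ u τ, Exec p σ u τ ∧ u ≤ t ∧ Q τ

/-- The registers that a program may write. -/
def Prog.regs : Prog → List ℕ
  | skip => []
  | assign x _ => [x]
  | store _ _ _ => []
  | seq p q => p.regs ++ q.regs
  | ite _ p q => p.regs ++ q.regs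
  | loop _ p => p.regs

/-- The arrays that a program may write. -/
def Prog.arrs : Prog → List ℕ
  | skip => []
  | assign _ _ => []
  | store a _ _ => [a]
  | seq p q => p.arrs ++ q.arrs
  | ite _ p q => p.arrs ++ q.arrs
  | loop _ p => p.arrs

/-- The memories differ at most in the registers and arrays that the program may write. -/
structure Frame (p : Prog) (σ τ : State) : Prop where
  reg : ∀ x, x ∉ p.regs → τ.reg x = σ.reg x
  mem : ∀ a, a ∉ p.arrs → τ.mem a = σ.mem a

@[simp] theorem State.setReg_reg (σ : State) (x m y : ℕ) :
    (σ.setReg x m).reg y = if y = x then m else σ.reg y := by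
  simp [State.setReg, Function.update_apply]

@[simp] theorem State.setReg_mem (σ : State) (x m : ℕ) : (σ.setReg x m).mem = σ.mem := rfl

@[simp] theorem State.setMem_reg (σ : State) (a i m : ℕ) : (σ.setMem a i m).reg = σ.reg := rfl

@[simp] theorem State.setMem_mem (σ : State) (a i m b : ℕ) :
    (σ.setMem a i m).mem b = if b = a then Function.update (σ.mem a) i m else σ.mem b := by
  simp [State.setMem, Function.update_apply]

/-- Register and array names are constants of the program, so what it may overwrite is a finite list
that can be read off from its text. Invariance of everything else is then mostly a matter of
`decide`. -/
theorem Exec.frame {p : Prog} {σ τ : State} {t : ℕ} (h : Exec p σ t τ) : Frame p σ τ := by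
  induction h with
  | skip => exact ⟨fun _ _ => rfl, fun _ _ => rfl⟩
  | assign σ x e => exact ⟨fun y hy => by simp_all [Prog.regs], fun _ _ => rfl⟩
  | store σ a i e => exact ⟨fun _ _ => rfl, fun b hb => by simp_all [Prog.arrs]⟩
  | seq _ _ h1 h2 =>
    constructor
    · intro x hx
      simp only [Prog.regs, List.mem_append, not_or] at hx
      rw [h2.reg x hx.2, h1.reg x hx.1]
    · intro x hx
      simp only [Prog.arrs, List.mem_append, not_or] at hx
      rw [h2.mem x hx.2, h1.mem x hx.1]
  | ite_true _ _ h =>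
    constructor
    · intro x hx
      simp only [Prog.regs, List.mem_append, not_or] at hx
      exact h.reg x hx.1
    · intro x hx
      simp only [Prog.arrs, List.mem_append, not_or] at hx
      exact h.mem x hx.1
  | ite_false _ _ h =>
    constructor
    · intro x hx
      simp only [Prog.regs, List.mem_append, not_or] at hx
      exact h.reg x hx.2
    · intro x hx
      simp only [Prog.arrs, List.mem_append, not_or] at hx
      exact h.mem x hx.2
  | loop_done => exact ⟨fun _ _ => rfl, fun _ _ => rfl⟩
  | loop_step _ _ _ h1 h2 =>
    exact ⟨fun x hx => (h2.reg x hx).trans (h1.reg x hx),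
      fun x hx => (h2.mem x hx).trans (h1.mem x hx)⟩

/-- The effect of a program without loops. -/
def Prog.run : Prog → State → State
  | skip, σ => σ
  | assign x e, σ => σ.setReg x (e.eval σ)
  | store a i e, σ => σ.setMem a (i.eval σ) (e.eval σ)
  | seq p q, σ => q.run (p.run σ)
  | ite e p q, σ => if e.eval σ = 0 then q.run σ else p.run σ
  | loop _ _, σ => σ

/-- The program has no loops. -/
def Prog.straight : Prog → Bool
  | seq p q => p.straight && q.straight
  | ite _ p q => p.straight && q.straight
  | loop _ _ => false
  | _ => true

/-- A bound on the running time of a program without loops. -/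
def Prog.size : Prog → ℕ
  | skip => 1
  | assign _ e => e.cost + 1
  | store _ i e => i.cost + e.cost + 1
  | seq p q => p.size + q.size
  | ite e p q => e.cost + 1 + max p.size q.size
  | loop _ _ => 0

/-- This reduces code without loops to symbolic execution: the final memory is found by
simplification, and the time bound by evaluating `size`. -/
theorem Prog.exec_run (p : Prog) (hp : p.straight = true) (σ : State) :
    ∃ u ≤ p.size, Exec p σ u (p.run σ) := by
  induction p generalizing σ with
  | skip => exact ⟨_, le_rfl, .skip σ⟩
  | assign x e => exact ⟨_, le_rfl, .assign σ x e⟩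
  | store a i e => exact ⟨_, le_rfl, .store σ a i e⟩
  | seq p q ihp ihq =>
    simp only [Prog.straight, Bool.and_eq_true] at hp
    obtain ⟨u, hu, h⟩ := ihp hp.1 σ
    obtain ⟨v, hv, h'⟩ := ihq hp.2 (p.run σ)
    exact ⟨u + v, Nat.add_le_add hu hv, h.seq h'⟩
  | ite e p q ihp ihq =>
    simp only [Prog.straight, Bool.and_eq_true] at hp
    by_cases he : e.eval σ = 0
    · obtain ⟨v, hv, h'⟩ := ihq hp.2 σ
      refine ⟨_, ?_, by simpa [Prog.run, he] using Exec.ite_false (p := p) he h'⟩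
      simp only [Prog.size]
      omega
    · obtain ⟨v, hv, h'⟩ := ihp hp.1 σ
      refine ⟨_, ?_, by simpa [Prog.run, he] using Exec.ite_true (q := q) he h'⟩
      simp only [Prog.size]
      omega
  | loop e p => simp [Prog.straight] at hp

namespace Runs

variable {p q : Prog} {σ : State} {t u : ℕ} {Q R : State → Prop}

theorem mono (h : Runs p σ t Q) (ht : t ≤ u) (hQ : ∀ τ, Frame p σ τ → Q τ → R τ) :
    Runs p σ u R := by
  obtain ⟨v, τ, he, hv, hq⟩ := h
  exact ⟨v, τ, he, hv.trans ht, hQ τ he.frame hq⟩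

theorem time_mono (h : Runs p σ t Q) (ht : t ≤ u) : Runs p σ u Q := h.mono ht fun _ _ h => h

theorem straight (hp : p.straight = true) (ht : p.size ≤ t) (hQ : Q (p.run σ)) :
    Runs p σ t Q := by
  obtain ⟨u, hu, h⟩ := p.exec_run hp σ
  exact ⟨u, _, h, hu.trans ht, hQ⟩

theorem seq (hp : Runs p σ t Q) (hq : ∀ τ, Frame p σ τ → Q τ → Runs q τ u R) :
    Runs (.seq p q) σ (t + u) R := by
  obtain ⟨v, τ, he, hv, h⟩ := hp
  obtain ⟨w, ρ, he', hw, h'⟩ := hq τ he.frame h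
  exact ⟨_, ρ, he.seq he', Nat.add_le_add hv hw, h'⟩

theorem ite {e : Expr} (hp : e.eval σ ≠ 0 → Runs p σ t Q) (hq : e.eval σ = 0 → Runs q σ t Q) :
    Runs (.ite e p q) σ (e.cost + 1 + t) Q := by
  by_cases he : e.eval σ = 0
  · obtain ⟨w, ρ, h, hw, h'⟩ := hq he
    exact ⟨_, ρ, .ite_false he h, by omega, h'⟩
  · obtain ⟨w, ρ, h, hw, h'⟩ := hp he
    exact ⟨_, ρ, .ite_true he h, by omega, h'⟩

/-- A loop with invariant `I`, of at most `m` rounds. -/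
theorem loop {e : Expr} (I : ℕ → State → Prop) (m : ℕ) (h0 : I 0 σ)
    (hs : ∀ j τ, Frame p σ τ → I j τ → e.eval τ ≠ 0 → j < m ∧ Runs p τ t (I (j + 1))) :
    Runs (.loop e p) σ (m * (e.cost + 1 + t) + (e.cost + 1))
      fun τ => ∃ j ≤ m, I j τ ∧ e.eval τ = 0 := by
  -- Here `k` is the number of rounds that may still follow after `j` rounds.
  suffices H : ∀ k j τ, j + k = m → Frame p σ τ → I j τ →
      Runs (.loop e p) τ (k * (e.cost + 1 + t) + (e.cost + 1))
      fun τ => ∃ j ≤ m, I j τ ∧ e.eval τ = 0 from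
    H m 0 σ (Nat.zero_add m) ⟨fun _ _ => rfl, fun _ _ => rfl⟩ h0
  intro k
  induction k with
  | zero =>
    intro j τ hj hf hI
    have he : e.eval τ = 0 := by
      by_contra he
      have := (hs j τ hf hI he).1
      omega
    exact ⟨_, τ, .loop_done he, by omega, j, by omega, hI, he⟩
  | succ k ih =>
    intro j τ hj hf hI
    by_cases he : e.eval τ = 0
    · exact ⟨_, τ, .loop_done he, by omega, j, by omega, hI, he⟩
    · obtain ⟨_, v, ρ, hx, hv, hI'⟩ := hs j τ hf hI he
      have hf' := hx.frame
      obtain ⟨w, π, hx', hw, h'⟩ := ih (j + 1) ρ (by omega)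
        ⟨fun x hx => (hf'.reg x hx).trans (hf.reg x hx),
          fun x hx => (hf'.mem x hx).trans (hf.mem x hx)⟩ hI'
      refine ⟨_, π, .loop_step he hx hx', ?_, h'⟩
      rw [Nat.succ_mul]
      omega

end Runs

/-- Run `p` for all values of register `i` from `0` up to, excluding, the content of register
`N`. -/
def forLt (i N : ℕ) (p : Prog) : Prog :=
  .seq (.assign i (.const 0)) (.loop (.lt (.reg i) (.reg N))
    (.seq p (.assign i (.add (.reg i) (.const 1)))))

/-- A round costs 4 for the test and 4 for the increment besides the body; the initial assignment
and the last test make up the 6. The invariant is required after the increment, hence the `setReg`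
in its place. -/
theorem Runs.forLt {i N : ℕ} {p : Prog} {σ : State} {t m : ℕ} (I : ℕ → State → Prop)
    (hm : σ.reg N = m) (hN : N ∉ (RAM.forLt i N p).regs) (hi : i ∉ p.regs)
    (h0 : I 0 (σ.setReg i 0))
    (hs : ∀ j < m, ∀ τ, Frame (RAM.forLt i N p) σ τ → τ.reg i = j → I j τ →
      Runs p τ t fun ρ => I (j + 1) (ρ.setReg i (j + 1))) :
    Runs (RAM.forLt i N p) σ (m * (t + 8) + 6) (I m) := by
  have hN' : N ≠ i ∧ N ∉ p.regs := by
    simp only [RAM.forLt, Prog.regs, List.mem_append, List.mem_singleton, not_or] at hN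
    exact ⟨hN.1, hN.2.1⟩
  refine time_mono (t := 2 + (m * (3 + 1 + (t + 4)) + (3 + 1))) (seq (t := 2)
    (Q := fun τ => τ = σ.setReg i 0) (straight rfl le_rfl rfl) ?_) (by
      rw [show 3 + 1 + (t + 4) = t + 8 by ring]; omega)
  rintro _ - rfl
  refine (loop (fun j τ => τ.reg i = j ∧ j ≤ m ∧ I j τ) m ⟨by simp, Nat.zero_le _, h0⟩
    (t := t + 4) ?_).mono le_rfl ?_
  · rintro j τ hf ⟨hij, -, hI⟩ he
    have hNm : τ.reg N = m := by
      rw [hf.reg N (by simp [Prog.regs, hN']), State.setReg_reg, if_neg hN'.1, hm]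
    have hj : j < m := by
      by_contra hj
      simp [Expr.eval, hij, hNm, hj] at he
    refine ⟨hj, ?_⟩
    refine seq (u := 4) (hs j hj τ ⟨fun x hx => ?_, fun a ha => ?_⟩ hij hI) ?_
    · have hx' : x ≠ i ∧ x ∉ p.regs := by
        simp only [RAM.forLt, Prog.regs, List.mem_append, List.mem_singleton, not_or] at hx
        exact ⟨hx.1, hx.2.1⟩
      rw [hf.reg x (by simp [Prog.regs, hx']), State.setReg_reg, if_neg hx'.1]
    · rw [hf.mem a (by simpa [RAM.forLt, Prog.arrs] using ha)]
      rfl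
    · intro ρ hf' hI'
      refine straight rfl le_rfl ?_
      have : ρ.reg i = j := by rw [hf'.reg i hi, hij]
      simp only [Prog.run, Expr.eval, this]
      exact ⟨by simp, hj, hI'⟩
  · rintro τ hf ⟨j, -, ⟨hij, hj, hI⟩, he⟩
    have hNm : τ.reg N = m := by
      rw [hf.reg N (by simp [Prog.regs, hN']), State.setReg_reg, if_neg hN'.1, hm]
    have : j = m := by
      by_contra hne
      have : j < m := by omega
      simp [Expr.eval, hij, hNm, this] at he
    exact this ▸ hI

end RAM

/-! ## Reading the graph -/

namespace RAM

infixr:60 " ;; " => Prog.seq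

/-- One step of reading adjacency lists, with the number of lists begun, the number of entries of
the current list still to come and the list of directed edges read so far. -/
def dartStep (st : ℕ × ℕ × List (ℕ × ℕ)) (a : ℕ) : ℕ × ℕ × List (ℕ × ℕ) :=
  if st.2.1 = 0 then (st.1 + 1, a, st.2.2)
  else (st.1, st.2.1 - 1, st.2.2 ++ [(st.1 - 1, a)])

theorem foldl_dartStep_list (v : ℕ) (l : List ℕ) (ds : List (ℕ × ℕ)) :
    l.foldl dartStep (v, l.length, ds) = (v, 0, ds ++ l.map fun w => (v - 1, w)) := by
  induction l generalizing ds with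
  | nil => simp
  | cons a l ih => simp [dartStep, ih]

/-- The first component counts the lists begun and so is one ahead of the vertex whose list is being
read. This is why edges are recorded with source `v - 1` while the lists are indexed from `v`. -/
theorem foldl_dartStep (v : ℕ) (ls : List (List ℕ)) (ds : List (ℕ × ℕ)) :
    (ls.flatMap fun l => l.length :: l).foldl dartStep (v, 0, ds) =
      (v + ls.length, 0, ds ++ (ls.zipIdx v).flatMap fun q => q.1.map fun w => (q.2, w)) := by
  induction ls generalizing v ds with
  | nil => simp
  | cons l ls ih =>
    rw [List.flatMap_cons, List.foldl_append, List.foldl_cons,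
      show dartStep (v, 0, ds) l.length = (v + 1, l.length, ds) by simp [dartStep],
      foldl_dartStep_list, ih]
    simp [List.zipIdx_cons]
    omega

/-- The body of the loop that reads the adjacency lists. Registers: `2` number of vertices, `4`
position, `5` entries to come, `6` lists begun, `7` number of directed edges. Arrays `2` and `3`:
sources and targets of the directed edges. -/
def parseStep : Prog :=
  .ite (.reg 5)
    (.store 2 (.reg 7) (.sub (.reg 6) (.const 1)) ;;
      .store 3 (.reg 7) (.idx 0 (.add (.reg 4) (.add (.reg 2) (.const 1)))) ;;
      .assign 7 (.add (.reg 7) (.const 1)) ;;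
      .assign 5 (.sub (.reg 5) (.const 1)))
    (.assign 5 (.idx 0 (.add (.reg 4) (.add (.reg 2) (.const 1)))) ;;
      .assign 6 (.add (.reg 6) (.const 1)))

/-- Read the graph. -/
def parseGraph : Prog :=
  .assign 2 (.idx 0 (.const 0)) ;;
  .assign 3 (.sub (.reg 0) (.add (.reg 2) (.const 1))) ;;
  forLt 4 3 parseStep

/-- The memory contains the list of directed edges `ds` with the state of its reader. -/
structure HoldsDarts (st : ℕ × ℕ × List (ℕ × ℕ)) (σ : State) : Prop where
  lists : σ.reg 6 = st.1
  rest : σ.reg 5 = st.2.1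
  size : σ.reg 7 = st.2.2.length
  darts : ∀ e < st.2.2.length, st.2.2[e]? = some (σ.mem 2 e, σ.mem 3 e)

theorem parseGraph_runs {σ : State} {n : ℕ} {l L : List ℕ} (hl : l.length = n)
    (h0 : σ.reg 0 = (n :: (l ++ L)).length) (hm : ∀ i, σ.mem 0 i = (n :: (l ++ L)).getD i 0)
    (h5 : σ.reg 5 = 0) (h6 : σ.reg 6 = 0) (h7 : σ.reg 7 = 0) :
    Runs parseGraph σ (L.length * 50 + 20) fun τ =>
      τ.reg 2 = n ∧ HoldsDarts (L.foldl dartStep (0, 0, [])) τ := by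
  refine (Runs.seq (t := 3) (Q := fun τ => τ = σ.setReg 2 n)
    (.straight rfl le_rfl (by simp [Prog.run, Expr.eval, hm])) (u := 7 + (L.length * 50 + 6))
    ?_).time_mono (by omega)
  rintro _ - rfl
  refine (Runs.seq (t := 7) (Q := fun τ => τ = (σ.setReg 2 n).setReg 3 L.length)
    (.straight rfl (by decide) ?_) ?_)
  · simp only [Prog.run, Expr.eval, State.setReg_reg, h0]
    congr 1
    simp [hl]
  rintro _ - rfl
  refine (Runs.forLt (t := 42) (fun j τ => HoldsDarts ((L.take j).foldl dartStep (0, 0, [])) τ)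
    (m := L.length) (by simp) (by decide) (by decide) ?_ ?_).mono (by omega) ?_
  · constructor <;> simp [h5, h6, h7]
  · intro j hj τ hf h4 hI
    have h2 : τ.reg 2 = n := by rw [hf.reg 2 (by decide)]; simp
    have hm0 : τ.mem 0 (j + (n + 1)) = L[j] := by
      rw [hf.mem 0 (by decide)]
      simp only [State.setReg_mem, hm, ← add_assoc, List.getD_cons_succ]
      rw [List.getD_append_right _ _ _ _ (by omega)]
      simp [hl, hj]
    have htake : (L.take (j + 1)).foldl dartStep (0, 0, []) =
        dartStep ((L.take j).foldl dartStep (0, 0, [])) L[j] := by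
      rw [← List.take_concat_get' L j hj, List.foldl_append]
      rfl
    rw [htake]
    generalize (L.take j).foldl dartStep (0, 0, []) = st at hI
    obtain ⟨v, rem, ds⟩ := st
    obtain ⟨i6, i5, i7, ie⟩ := hI
    simp only at i6 i5 i7 ie
    refine .straight rfl (by decide) ?_
    by_cases hr : rem = 0
    · subst hr
      constructor <;> simp [parseStep, Prog.run, Expr.eval, i5, i6, i7, h2, h4, hm0, dartStep]
      exact ie
    · constructor <;> simp [parseStep, Prog.run, Expr.eval, i5, i6, i7, h2, h4, hm0, dartStep, hr]
      intro e he
      rcases Nat.lt_or_eq_of_le he with he | rfl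
      · rw [List.getElem?_append_left he, ie e he]
        simp [he.ne]
      · simp
  · intro τ hf hI
    refine ⟨by rw [hf.reg 2 (by decide)]; simp, ?_⟩
    simpa using hI

/-- The memory contains the directed edges of the graph `G` on `0, …, n - 1`. -/
structure HoldsGraph {n : ℕ} (G : SimpleGraph (Fin n)) (σ : State) : Prop where
  size : σ.reg 2 = n
  le : σ.reg 7 ≤ 2 * n
  adj : ∀ e < σ.reg 7, ∃ v w : Fin n, G.Adj v w ∧ σ.mem 2 e = v ∧ σ.mem 3 e = w
  exists_dart : ∀ v w : Fin n, G.Adj v w → ∃ e < σ.reg 7, σ.mem 2 e = v ∧ σ.mem 3 e = w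

/-- The lengths of the lists are the degrees, so their sum is twice the number n - 1 of edges. This
makes the length of the input linear in the number of vertices. -/
theorem length_adjacencyList_sum {n : ℕ} {G : SimpleGraph (Fin n)} {nb : Fin n → List (Fin n)}
    (hG : G.IsTree) (hnb : IsAdjacencyList G nb) :
    ((List.finRange n).map fun v => (nb v).length).sum ≤ 2 * n := by
  classical
  have h1 : ((List.finRange n).map fun v => (nb v).length).sum = ∑ v, G.degree v := by
    rw [← Fin.sum_univ_def]
    refine Finset.sum_congr rfl fun v _ => ?_
    rw [← List.toFinset_card_of_nodup (hnb v).1, ← SimpleGraph.card_neighborFinset_eq_degree]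
    congr 1
    ext w
    simp [(hnb v).2]
  have h2 := hG.card_edgeFinset
  rw [Fintype.card_fin] at h2
  rw [h1, G.sum_degrees_eq_twice_card_edges]
  omega

theorem parseGraph_runs_of_isTree {σ : State} {n c : ℕ} {G : SimpleGraph (Fin n)}
    {col : Fin n → Fin c} {nb : Fin n → List (Fin n)} (hG : G.IsTree)
    (hnb : IsAdjacencyList G nb) {w : List ℕ} (hσ : σ = initial (encodeColoredGraph col nb) w) :
    Runs parseGraph σ (n * 200 + 20) (HoldsGraph G) := by
  subst hσ
  set ls : List (List ℕ) := (List.finRange n).map fun v => (nb v).map fun w : Fin n => (w : ℕ) with hls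
  have hL : ((List.finRange n).flatMap fun v => (nb v).length :: (nb v).map fun w : Fin n => (w : ℕ)) =
      ls.flatMap fun l => l.length :: l := by
    simp [hls, List.flatMap_map]
  have henc : encodeColoredGraph col nb = n :: ((List.ofFn fun v => (col v : ℕ)) ++
      ls.flatMap fun l => l.length :: l) := by
    rw [← hL, encodeColoredGraph]
    -- In the encoding the list of neighbors is coerced to numbers through the list monad and then
    -- mapped by the identity; this is brought into the form of a map.
    simp only [List.map_id']
    simp only [List.map_eq_flatMap, List.bind_eq_flatMap, List.pure_def]
  have hlen : (ls.flatMap fun l => l.length :: l).length =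
      n + ((List.finRange n).map fun v => (nb v).length).sum := by
    rw [← hL, List.length_flatMap]
    simp only [List.length_cons, List.length_map, List.sum_map_add]
    simp [add_comm]
  have hle := length_adjacencyList_sum hG hnb
  refine (parseGraph_runs (n := n) (l := List.ofFn fun v => (col v : ℕ))
    (L := ls.flatMap fun l => l.length :: l) (by simp) ?_ ?_ rfl rfl rfl).mono ?_ ?_
  · simp [initial, henc]
  · intro i
    simp [initial, henc]
  · rw [hlen]
    omega
  · rintro τ - ⟨h2, -, -, h7, hd⟩
    rw [foldl_dartStep] at h7 hd
    set ds := (ls.zipIdx 0).flatMap fun q => q.1.map fun w => (q.2, w) with hds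
    simp only [List.nil_append] at h7 hd
    have hmem : ∀ a b, (a, b) ∈ ds ↔ ∃ v w : Fin n, G.Adj v w ∧ a = v ∧ b = w := by
      intro a b
      simp only [hds, List.mem_flatMap, List.mem_map, Prod.exists, List.mem_zipIdx_iff_getElem?,
        hls, Prod.mk.injEq]
      constructor
      · rintro ⟨l, i, hl, x, hx, rfl, rfl⟩
        simp only [List.getElem?_map, Option.map_eq_some_iff] at hl
        obtain ⟨v, hv, rfl⟩ := hl
        obtain ⟨w, hw, rfl⟩ := List.mem_map.1 hx
        refine ⟨v, w, ((hnb v).2 w).1 hw, ?_, rfl⟩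
        obtain ⟨hi, hv⟩ := List.getElem?_eq_some_iff.1 hv
        simp at hv
        rw [← hv]
      · rintro ⟨v, w, h, rfl, rfl⟩
        refine ⟨(nb v).map fun w : Fin n => (w : ℕ), v, ?_, w, ?_, rfl, rfl⟩
        · simp
        · exact List.mem_map.2 ⟨w, ((hnb v).2 w).2 h, rfl⟩
    refine ⟨h2, ?_, ?_, ?_⟩
    · rw [h7, hds, List.length_flatMap]
      simp only [List.length_map]
      have : (ls.zipIdx 0).map (fun q => q.1.length) = ls.map List.length := by
        rw [← List.zipIdx_map_fst 0 ls, List.map_map]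
        simp [Function.comp_def]
      rw [this, hls, List.map_map]
      simpa [Function.comp_def] using hle
    · intro e he
      rw [h7] at he
      obtain ⟨v, w, h, e1, e2⟩ := (hmem _ _).1 (List.mem_of_getElem? (hd e he))
      exact ⟨v, w, h, e1, e2⟩
    · intro v w h
      obtain ⟨e, he, hv⟩ := List.getElem_of_mem ((hmem v w).2 ⟨v, w, h, rfl, rfl⟩)
      refine ⟨e, h7 ▸ he, ?_⟩
      have := hd e he
      rw [List.getElem?_eq_getElem he, hv] at this
      simpa [eq_comm] using this

end RAM

/-! ## Breadth-first search -/

theorem SimpleGraph.Connected.exists_adj_dist_eq {V : Type} {G : SimpleGraph V}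
    (hG : G.Connected) {r v : V} {d : ℕ} (h : G.dist r v = d + 1) :
    ∃ u, G.Adj v u ∧ G.dist r u = d := by
  obtain ⟨p, hp⟩ := hG.exists_walk_length_eq_dist v r
  rw [SimpleGraph.dist_comm, h] at hp
  cases p with
  | nil => simp at hp
  | cons ha p =>
    rename_i u
    refine ⟨u, ha, ?_⟩
    have h1 := SimpleGraph.dist_le p
    rw [SimpleGraph.Walk.length_cons] at hp
    have h2 := hG.dist_triangle (u := r) (v := u) (w := v)
    rw [SimpleGraph.dist_eq_one_iff_adj.2 ha.symm] at h2
    rw [SimpleGraph.dist_comm] at h1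
    omega

theorem SimpleGraph.Connected.dist_le_succ_of_adj {V : Type} {G : SimpleGraph V}
    (hG : G.Connected) (r : V) {u v : V} (h : G.Adj u v) : G.dist r v ≤ G.dist r u + 1 := by
  have h2 := hG.dist_triangle (u := r) (v := u) (w := v)
  rwa [SimpleGraph.dist_eq_one_iff_adj.2 h] at h2

namespace RAM

/-- Follow the directed edge in register `10`. Array `4` holds the distances to the root plus `1`,
and `0` where the distance is not yet known; array `5` holds the parents. Register `8` holds the
number of rounds. -/
def bfsEdge : Prog :=
  .ite (.eq (.idx 4 (.idx 2 (.reg 10))) (.add (.reg 8) (.const 1)))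
    (.ite (.idx 4 (.idx 3 (.reg 10))) .skip
      (.store 4 (.idx 3 (.reg 10)) (.add (.reg 8) (.const 2)) ;;
        .store 5 (.idx 3 (.reg 10)) (.idx 2 (.reg 10))))
    .skip

/-- Set register `9` to `1` if all vertices have been reached, and to `0` otherwise. -/
def bfsCheck : Prog :=
  .assign 9 (.const 1) ;;
  forLt 11 2 (.ite (.idx 4 (.reg 11)) .skip (.assign 9 (.const 0)))

/-- Compute distances from vertex `0` and parents. -/
def bfs : Prog :=
  .store 4 (.const 0) (.const 1) ;;
  .loop (.eq (.reg 9) (.const 0))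
    (forLt 10 7 bfsEdge ;; bfsCheck ;; .assign 8 (.add (.reg 8) (.const 1)))

variable {n : ℕ} {G : SimpleGraph (Fin n)} {r : Fin n} {σ : State}

/-- The search has completed `d` rounds and followed the first `k` directed edges in the next. -/
structure BfsInv (G : SimpleGraph (Fin n)) (r : Fin n) (d k : ℕ) (τ : State) : Prop where
  near : ∀ v, G.dist r v ≤ d → τ.mem 4 v = G.dist r v + 1
  far : ∀ v, d < G.dist r v → τ.mem 4 v = 0 ∨ τ.mem 4 v = d + 2 ∧ G.dist r v = d + 1
  reached : ∀ e < k, ∀ u v : Fin n, τ.mem 2 e = u → τ.mem 3 e = v → G.dist r u = d → τ.mem 4 v ≠ 0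
  parent : ∀ v, v ≠ r → τ.mem 4 v ≠ 0 →
    ∃ u : Fin n, τ.mem 5 v = u ∧ G.Adj v u ∧ G.dist r u + 1 = G.dist r v
  root : τ.mem 5 r = r
  start : k = 0 → ∀ v, d < G.dist r v → τ.mem 4 v = 0

theorem BfsInv.of_eq {d k : ℕ} {τ ρ : State} (h : BfsInv G r d k τ) (h2 : ρ.mem 2 = τ.mem 2)
    (h3 : ρ.mem 3 = τ.mem 3) (h4 : ρ.mem 4 = τ.mem 4) (h5 : ρ.mem 5 = τ.mem 5) :
    BfsInv G r d k ρ := by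
  obtain ⟨a, b, c, d, e, f⟩ := h
  constructor <;> simpa only [h2, h3, h4, h5]

theorem HoldsGraph.of_eq {τ : State} (h : HoldsGraph G σ) (h2 : τ.mem 2 = σ.mem 2)
    (h3 : τ.mem 3 = σ.mem 3) (hr2 : τ.reg 2 = σ.reg 2) (hr7 : τ.reg 7 = σ.reg 7) :
    HoldsGraph G τ := by
  obtain ⟨a, b, c, d⟩ := h
  constructor <;> simpa only [h2, h3, hr2, hr7]

/-- Vertices found in the current round carry the mark `d + 2`, so the mark `d + 1` singles out the
sources at distance exactly `d`. An unmarked target of such an edge has distance `d + 1`: not more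
because of the edge, and not less because nearer vertices are marked. -/
theorem bfsEdge_runs (hG : G.Connected) (hg : HoldsGraph G σ) {d k : ℕ} (hk : k < σ.reg 7)
    (h : BfsInv G r d k σ) (hd : σ.reg 8 = d) (hr : σ.reg 10 = k) :
    Runs bfsEdge σ 30 (BfsInv G r d (k + 1)) := by
  refine .straight rfl (by decide) ?_
  obtain ⟨u, w, ha, hu, hw⟩ := hg.adj k hk
  have hlast : ∀ v : Fin n, ∀ u' : Fin n, σ.mem 2 k = u' → σ.mem 3 k = v → u' = u ∧ v = w := by
    intro v u' h1 h2
    rw [hu] at h1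
    rw [hw] at h2
    exact ⟨Fin.ext h1.symm, Fin.ext h2.symm⟩
  have hdu : σ.mem 4 u = d + 1 ↔ G.dist r u = d := by
    rcases Nat.lt_or_ge d (G.dist r u) with h1 | h1
    · rcases h.far u h1 with h2 | h2 <;> omega
    · rw [h.near u h1]; omega
  by_cases hdu' : G.dist r u = d
  swap
  · simp only [bfsEdge, Prog.run, Expr.eval, hr, hu, hd, hdu, hdu', if_false, if_true]
    refine ⟨h.near, h.far, ?_, h.parent, h.root, by simp⟩
    intro e he u' v h1 h2 h3
    rcases Nat.lt_succ_iff_lt_or_eq.1 he with he | rfl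
    · exact h.reached e he u' v h1 h2 h3
    · exact absurd ((hlast v u' h1 h2).1 ▸ h3) hdu'
  by_cases hw0 : σ.mem 4 w = 0
  swap
  · simp only [bfsEdge, Prog.run, Expr.eval, hr, hu, hd, hdu, hdu', if_false, if_true, hw, hw0,
      one_ne_zero]
    refine ⟨h.near, h.far, ?_, h.parent, h.root, by simp⟩
    intro e he u' v h1 h2 h3
    rcases Nat.lt_succ_iff_lt_or_eq.1 he with he | rfl
    · exact h.reached e he u' v h1 h2 h3
    · rw [(hlast v u' h1 h2).2]
      exact hw0
  have hdw : G.dist r w = d + 1 := by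
    have h1 := hG.dist_le_succ_of_adj r ha
    by_contra h2
    have := h.near w (by omega)
    omega
  have hwr : w ≠ r := by
    rintro rfl
    simp at hdw
  simp only [bfsEdge, Prog.run, Expr.eval, hr, hu, hd, hdu, hdu', if_false, if_true, hw, hw0,
      one_ne_zero]
  constructor
  · intro v hv
    have : (v : ℕ) ≠ w := fun he => by rw [Fin.ext he] at hv; omega
    simp [this, h.near v hv]
  · intro v hv
    by_cases hvw : v = w
    · subst hvw
      simp [hdw]
    · have : (v : ℕ) ≠ w := fun he => hvw (Fin.ext he)
      simpa [this] using h.far v hv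
  · intro e he u' v h1 h2 h3
    simp only [State.setMem_mem, Nat.reduceEqDiff, if_false] at h1 h2
    by_cases hvw : v = w
    · subst hvw
      simp
    · have hvw' : (v : ℕ) ≠ w := fun he => hvw (Fin.ext he)
      rcases Nat.lt_succ_iff_lt_or_eq.1 he with he | rfl
      · simpa [hvw'] using h.reached e he u' v h1 h2 h3
      · exact absurd (hlast v u' h1 h2).2 hvw
  · intro v hv hv0
    by_cases hvw : v = w
    · subst hvw
      exact ⟨u, by simp [hw, hu, hr], ha.symm, by omega⟩
    · have hvw' : (v : ℕ) ≠ w := fun he => hvw (Fin.ext he)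
      obtain ⟨u', h1, h2⟩ := h.parent v hv (by simpa [hvw'] using hv0)
      exact ⟨u', by simpa [hw, hr, hvw'] using h1, h2⟩
  · have : (r : ℕ) ≠ w := fun he => hwr (Fin.ext he).symm
    simpa [hw, hr, this] using h.root
  · simp

theorem bfsCheck_runs (h2 : σ.reg 2 = n) :
    Runs bfsCheck σ (n * 20 + 20) fun τ =>
      (τ.reg 9 = 0 ↔ ∃ v : Fin n, σ.mem 4 v = 0) := by
  refine (Runs.seq (t := 2) (Q := fun τ => τ = σ.setReg 9 1) (u := n * (8 + 8) + 6)
    (.straight rfl le_rfl (by simp [Prog.run, Expr.eval])) ?_).time_mono (by omega)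
  rintro _ - rfl
  refine (Runs.forLt (t := 8) (m := n)
    (fun j τ => τ.reg 9 = 0 ↔ ∃ v < j, σ.mem 4 v = 0) (by simpa using h2)
    (by decide) (by decide) (by simp) ?_).mono le_rfl ?_
  · intro j hj τ hf hr hI
    have hm : τ.mem 4 = σ.mem 4 := hf.mem 4 (by decide)
    refine .straight rfl (by decide) ?_
    simp only [Prog.run, Expr.eval, hr, hm]
    by_cases h0 : σ.mem 4 j = 0
    · simpa [h0] using ⟨j, by omega, h0⟩
    · simp only [h0, if_false, State.setReg_reg, Nat.reduceEqDiff, hI]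
      constructor
      · rintro ⟨v, hv, hv0⟩
        exact ⟨v, by omega, hv0⟩
      · rintro ⟨v, hv, hv0⟩
        refine ⟨v, ?_, hv0⟩
        rcases Nat.lt_succ_iff_lt_or_eq.1 hv with hv | rfl
        · exact hv
        · exact absurd hv0 h0
  · rintro τ - hI
    rw [hI]
    exact ⟨fun ⟨v, hv, h⟩ => ⟨⟨v, hv⟩, h⟩, fun ⟨v, h⟩ => ⟨v, v.2, h⟩⟩

/-- A vertex at distance `d + 1` has a neighbor at distance `d`. The edge from there has been
followed, so the vertex is marked, and `far` leaves only the mark `d + 2`. -/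
theorem BfsInv.next (hG : G.Connected) (hg : HoldsGraph G σ) {d : ℕ}
    (h : BfsInv G r d (σ.reg 7) σ) : BfsInv G r (d + 1) 0 σ := by
  have hsucc : ∀ v, G.dist r v = d + 1 → σ.mem 4 v = d + 2 := by
    intro v hv
    obtain ⟨u, hu, hdu⟩ := hG.exists_adj_dist_eq hv
    obtain ⟨e, he, h1, h2⟩ := hg.exists_dart u v hu.symm
    have := h.reached e he u v h1 h2 hdu
    rcases h.far v (by omega) with h3 | h3
    · exact absurd h3 this
    · exact h3.1
  refine ⟨fun v hv => ?_, fun v hv => ?_, by simp, h.parent, h.root, fun _ v hv => ?_⟩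
  · rcases Nat.lt_or_ge d (G.dist r v) with h1 | h1
    · rw [hsucc v (by omega)]
      omega
    · exact h.near v h1
  · rcases h.far v (by omega) with h3 | h3
    · exact .inl h3
    · omega
  · rcases h.far v (by omega) with h3 | h3
    · exact h3
    · omega

/-- No queue is needed: every round follows all of the at most 2n directed edges, and the number of
rounds is bounded through the depth, which may enter the time as a factor. -/
theorem bfs_runs (hG : G.Connected) (hg : HoldsGraph G σ) (hr : (r : ℕ) = 0) {D : ℕ}
    (hD : ∀ v, G.dist r v ≤ D) (h4 : ∀ i, σ.mem 4 i = 0) (h5 : ∀ i, σ.mem 5 i = 0)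
    (h8 : σ.reg 8 = 0) (h9 : σ.reg 9 = 0) :
    Runs bfs σ ((D + 2) * (200 * (n + 1))) fun τ =>
      τ.reg 8 ≤ D + 1 ∧ (∀ v, G.dist r v ≤ τ.reg 8) ∧ BfsInv G r (τ.reg 8) 0 τ := by
  refine (Runs.seq (t := 3) (u := (D + 1) * (4 + (n * 96 + 40)) + 4)
    (Q := fun τ => τ = σ.setMem 4 0 1)
    (.straight rfl le_rfl (by simp [Prog.run, Expr.eval])) ?_).time_mono (by
      nlinarith [Nat.zero_le (D * n)])
  rintro _ - rfl
  -- Register 9 is 0 at the start although nothing has been checked, so the first round is run even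
  -- if all vertices are marked. This is the case `j = 0`, and the bound `D + 1` on the number of
  -- rounds allows for it.
  refine (Runs.loop (t := n * 96 + 40) (fun j τ => τ.reg 8 = j ∧ BfsInv G r j 0 τ ∧
    (τ.reg 9 = 0 → j = 0 ∨ ∃ v : Fin n, τ.mem 4 v = 0) ∧
    (τ.reg 9 ≠ 0 → ∀ v : Fin n, τ.mem 4 v ≠ 0)) (D + 1) ?_ ?_).mono le_rfl ?_
  · refine ⟨h8, ⟨fun v hv => ?_, fun v hv => ?_, by simp, ?_, ?_, fun _ v hv => ?_⟩, by simp,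
      by simp [h9]⟩
    · have : v = r := by
        have := (hG.dist_eq_zero_iff (u := r) (v := v)).1 (by omega)
        exact this.symm
      simp [this, hr]
    · have : v ≠ r := by
        rintro rfl
        simp at hv
      have : (v : ℕ) ≠ 0 := fun h => this (Fin.ext (h.trans hr.symm))
      simp [this, h4]
    · intro v hv hv0
      have : (v : ℕ) ≠ 0 := fun h => hv (Fin.ext (h.trans hr.symm))
      simp [this, h4] at hv0
    · simp [h5, hr]
    · have : v ≠ r := by
        rintro rfl
        simp at hv
      have : (v : ℕ) ≠ 0 := fun h => this (Fin.ext (h.trans hr.symm))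
      simp [this, h4]
  · rintro j τ hf ⟨hj, hI, h0, h1⟩ he
    have he : τ.reg 9 = 0 := by
      by_contra h
      simp [Expr.eval, h] at he
    have hg' : HoldsGraph G τ := by
      refine hg.of_eq ?_ ?_ ?_ ?_
      · rw [hf.mem 2 (by decide)]; simp
      · rw [hf.mem 3 (by decide)]; simp
      · rw [hf.reg 2 (by decide)]; simp
      · rw [hf.reg 7 (by decide)]; simp
    refine ⟨?_, ?_⟩
    · rcases h0 he with rfl | ⟨v, hv⟩
      · omega
      · by_contra hlt
        have := hI.near v ((hD v).trans (by omega))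
        omega
    · refine (Runs.seq (t := 2 * n * (30 + 8) + 6) (u := n * 20 + 20 + 4) (Q := BfsInv G r j (τ.reg 7))
        (((Runs.forLt (t := 30) (m := τ.reg 7) (BfsInv G r j) rfl (by decide) (by decide)
        (hI.of_eq rfl rfl rfl rfl) ?_).mono ?_ fun ρ hf h => h)) ?_).time_mono (by omega)
      · intro k hk ρ hf' hr' hI'
        refine (bfsEdge_runs hG (hg'.of_eq ?_ ?_ ?_ ?_) ?_ hI' ?_ hr').mono le_rfl ?_
        · exact hf'.mem 2 (by decide)
        · exact hf'.mem 3 (by decide)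
        · exact hf'.reg 2 (by decide)
        · exact hf'.reg 7 (by decide)
        · rwa [hf'.reg 7 (by decide)]
        · rw [hf'.reg 8 (by decide), hj]
        · exact fun π hf h => h.of_eq rfl rfl rfl rfl
      · have := hg'.le
        gcongr
      intro ρ hf' hI'
      have hg'' : HoldsGraph G ρ := hg'.of_eq (hf'.mem 2 (by decide)) (hf'.mem 3 (by decide))
        (hf'.reg 2 (by decide)) (hf'.reg 7 (by decide))
      have hI'' : BfsInv G r (j + 1) 0 ρ := by
        rw [← hf'.reg 7 (by decide)] at hI'
        exact hI'.next hG hg''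
      refine Runs.seq (t := n * 20 + 20) (u := 4) (bfsCheck_runs hg''.size) ?_
      intro π hf'' h9
      refine .straight rfl (by decide) ?_
      have h8' : π.reg 8 = j := by rw [hf''.reg 8 (by decide), hf'.reg 8 (by decide), hj]
      have hm : ∀ a, π.mem a = ρ.mem a := fun a => hf''.mem a (by decide +revert)
      simp only [Prog.run, Expr.eval, h8']
      refine ⟨by simp, hI''.of_eq (hm 2) (hm 3) (hm 4) (hm 5), ?_, ?_⟩
      · intro h
        exact .inr (by simpa [hm] using h9.1 (by simpa using h))
      · intro h v hv
        exact h (by simpa using h9.2 ⟨v, by simpa [hm] using hv⟩)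
  · rintro τ hf ⟨j, hj, ⟨h8, hI, h0, h1⟩, he⟩
    have he : τ.reg 9 ≠ 0 := by
      intro h
      simp [Expr.eval, h] at he
    rw [h8]
    refine ⟨hj, ?_, hI⟩
    intro v
    by_contra hlt
    exact h1 he v (hI.start rfl v (by omega))

end RAM

/-! ## Reading the formula -/

/-- The operators in the prefix notation of a formula. -/
inductive Tok (c : ℕ) : Type
  | eq (x y : ℕ)
  | adj (x y : ℕ)
  | color (i : Fin c) (x : ℕ)
  | not
  | and
  | or
  | imp
  | iff
  | ex (x : ℕ)
  | all (x : ℕ)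

namespace Tok

variable {c : ℕ}

/-- The symbols of an operator. -/
def encode : Tok c → List ℕ
  | eq x y => [0, x, y]
  | adj x y => [1, x, y]
  | color i x => [2, (i : ℕ), x]
  | not => [3]
  | and => [4]
  | or => [5]
  | imp => [6]
  | iff => [7]
  | ex x => [8, x]
  | all x => [9, x]

/-- The variables of an operator. -/
def vars : Tok c → Finset ℕ
  | eq x y => {x, y}
  | adj x y => {x, y}
  | color _ x => {x}
  | ex x => {x}
  | all x => {x}
  | _ => ∅

/-- The variables of a list of operators. -/
def varsOf : List (Tok c) → Finset ℕ
  | [] => ∅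
  | t :: ts => t.vars ∪ varsOf ts

theorem varsOf_append (l l' : List (Tok c)) : varsOf (l ++ l') = varsOf l ∪ varsOf l' := by
  induction l with
  | nil => simp [varsOf]
  | cons t l ih => simp [varsOf, ih]

theorem vars_subset_varsOf {l : List (Tok c)} {t : Tok c} (ht : t ∈ l) : t.vars ⊆ varsOf l := by
  induction l with
  | nil => simp at ht
  | cons u l ih =>
    rcases List.mem_cons.1 ht with rfl | ht
    · exact Finset.subset_union_left
    · exact (ih ht).trans Finset.subset_union_right

theorem length_encode_pos (t : Tok c) : 0 < t.encode.length := by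
  cases t <;> simp [encode]

theorem length_le_length_flatMap (l : List (Tok c)) : l.length ≤ (l.flatMap encode).length := by
  induction l with
  | nil => simp
  | cons t l ih =>
    have := t.length_encode_pos
    rw [List.flatMap_cons, List.length_append, List.length_cons]
    omega

end Tok

namespace FOFormula

variable {c : ℕ}

/-- The formula as a list of operators, in prefix notation. -/
def toks : FOFormula c → List (Tok c)
  | eq x y => [.eq x y]
  | adj x y => [.adj x y]
  | color i x => [.color i x]
  | not φ => .not :: φ.toks
  | and φ ψ => .and :: (φ.toks ++ ψ.toks)
  | or φ ψ => .or :: (φ.toks ++ ψ.toks)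
  | imp φ ψ => .imp :: (φ.toks ++ ψ.toks)
  | iff φ ψ => .iff :: (φ.toks ++ ψ.toks)
  | ex x φ => .ex x :: φ.toks
  | all x φ => .all x :: φ.toks

theorem encode_eq_flatMap (φ : FOFormula c) : φ.encode = φ.toks.flatMap Tok.encode := by
  induction φ <;> simp_all [encode, toks, Tok.encode]

theorem vars_eq_varsOf (φ : FOFormula c) : φ.vars = Tok.varsOf φ.toks := by
  induction φ <;> simp_all [vars, toks, Tok.varsOf, Tok.vars, Tok.varsOf_append]

end FOFormula

namespace RAM

/-- Give a number to the variable name in register `15`, unless it has one. Array `6` holds the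
numbers, starting from `1`, and register `14` counts the variables. -/
def intern : Prog :=
  .ite (.idx 6 (.reg 15)) .skip
    (.assign 14 (.add (.reg 14) (.const 1)) ;; .store 6 (.reg 15) (.reg 14))

/-- Read an operator. Register `12` holds the position in the formula, register `13` the number of
operators and array `7` their positions. -/
def parseTok : Prog :=
  .store 7 (.reg 13) (.reg 12) ;;
  .assign 16 (.idx 1 (.reg 12)) ;;
  .ite (.lt (.reg 16) (.const 3))
    (.ite (.lt (.reg 16) (.const 2))
      (.assign 15 (.idx 1 (.add (.reg 12) (.const 1))) ;; intern) .skip ;;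
      .assign 15 (.idx 1 (.add (.reg 12) (.const 2))) ;; intern ;;
      .assign 12 (.add (.reg 12) (.const 3)))
    (.ite (.lt (.reg 16) (.const 8)) (.assign 12 (.add (.reg 12) (.const 1)))
      (.assign 15 (.idx 1 (.add (.reg 12) (.const 1))) ;; intern ;;
        .assign 12 (.add (.reg 12) (.const 2)))) ;;
  .assign 13 (.add (.reg 13) (.const 1))

/-- Read the formula. -/
def parseFormula : Prog := .loop (.lt (.reg 12) (.reg 1)) parseTok

/-- The variables in `X` have been numbered. -/
structure Interned (X : Finset ℕ) (σ : State) : Prop where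
  card : σ.reg 14 = X.card
  eq_zero : ∀ y, σ.mem 6 y = 0 ↔ y ∉ X
  le : ∀ y, σ.mem 6 y ≤ X.card
  inj : ∀ x ∈ X, ∀ y ∈ X, σ.mem 6 x = σ.mem 6 y → x = y

variable {X : Finset ℕ} {σ : State}

theorem Interned.of_eq (h : Interned X σ) {τ : State} (h14 : τ.reg 14 = σ.reg 14)
    (h6 : τ.mem 6 = σ.mem 6) : Interned X τ := by
  obtain ⟨a, b, c, d⟩ := h
  constructor <;> simpa only [h14, h6]

theorem Prog.frame_run (p : Prog) (hp : p.straight = true) (σ : State) : Frame p σ (p.run σ) := by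
  obtain ⟨_, _, h⟩ := p.exec_run hp σ
  exact h.frame

@[simp] theorem intern_run_reg {y : ℕ} (hy : y ≠ 14) : (intern.run σ).reg y = σ.reg y :=
  (intern.frame_run rfl σ).reg y (by simpa [intern, Prog.regs] using hy)

@[simp] theorem intern_run_mem {a : ℕ} (ha : a ≠ 6) : (intern.run σ).mem a = σ.mem a :=
  (intern.frame_run rfl σ).mem a (by simpa [intern, Prog.arrs] using ha)

/-- A new name receives the number `X.card + 1`, which exceeds all numbers given so far; hence the
numbering stays injective. The number 0 is reserved for names not yet seen. -/
theorem Interned.intern (h : Interned X σ) : Interned (insert (σ.reg 15) X) (intern.run σ) := by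
  by_cases hX : σ.reg 15 ∈ X
  · rw [Finset.insert_eq_of_mem hX]
    have := (h.eq_zero (σ.reg 15)).not.2 (not_not.2 hX)
    simpa [RAM.intern, Prog.run, Expr.eval, this] using h
  · have h0 := (h.eq_zero (σ.reg 15)).2 hX
    constructor
    · simp [RAM.intern, Prog.run, Expr.eval, h0, h.card, hX]
    · intro y
      by_cases hy : y = σ.reg 15
      · simp [RAM.intern, Prog.run, Expr.eval, h0, hy]
      · simp [RAM.intern, Prog.run, Expr.eval, h0, hy, h.eq_zero]
    · intro y
      have := h.le y
      by_cases hy : y = σ.reg 15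
      · simp [RAM.intern, Prog.run, Expr.eval, h0, hy, h.card, hX]
      · simp [RAM.intern, Prog.run, Expr.eval, h0, hy, hX]
        omega
    · intro x hx y hy
      have hle := h.le
      have hcard := h.card
      have hinj := h.inj
      simp only [RAM.intern, Prog.run, Expr.eval, h0, if_true, State.setMem_mem, State.setReg_mem,
        Function.update_apply, State.setReg_reg]
      have hlx := hle x
      have hly := hle y
      by_cases hx' : x = σ.reg 15 <;> by_cases hy' : y = σ.reg 15
      · simp [hx', hy']
      · simp [hx', hy', hcard]
        omega
      · simp [hx', hy', hcard]
        omega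
      · simpa [hx', hy'] using hinj x (by simpa [hx'] using hx) y (by simpa [hy'] using hy)

@[simp] theorem interned_setReg {x m : ℕ} (hx : x ≠ 14) :
    Interned X (σ.setReg x m) ↔ Interned X σ :=
  ⟨fun h => h.of_eq (by simp [hx.symm]) rfl, fun h => h.of_eq (by simp [hx.symm]) rfl⟩

@[simp] theorem interned_setMem {a i m : ℕ} (ha : a ≠ 6) :
    Interned X (σ.setMem a i m) ↔ Interned X σ :=
  ⟨fun h => h.of_eq rfl (by simp [ha.symm]), fun h => h.of_eq rfl (by simp [ha.symm])⟩

theorem Interned.read (h : Interned X σ) (y : ℕ) :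
    Interned (insert y X) (RAM.intern.run (σ.setReg 15 y)) := by
  simpa using ((interned_setReg (by decide)).2 h : Interned X (σ.setReg 15 y)).intern

theorem parseTok_run {c : ℕ} (t : Tok c) {p : ℕ} (h : Interned X σ)
    (hp : σ.reg 12 = p) (ht : ∀ k < t.encode.length, σ.mem 1 (p + k) = t.encode.getD k 0) :
    (parseTok.run σ).reg 12 = p + t.encode.length ∧
      (parseTok.run σ).reg 13 = σ.reg 13 + 1 ∧
      (parseTok.run σ).mem 7 = Function.update (σ.mem 7) (σ.reg 13) p ∧
      Interned (X ∪ t.vars) (parseTok.run σ) := by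
  have ht0 := ht 0 t.length_encode_pos
  subst hp
  have h' : Interned X ((σ.setMem 7 (σ.reg 13) (σ.reg 12)).setReg 16 (t.encode.getD 0 0)) := by
    simpa using h
  have two : ∀ x y : ℕ, X ∪ {x, y} = insert y (insert x X) := fun x y => by
    ext
    simp
    tauto
  have one : ∀ x : ℕ, X ∪ {x} = insert x X := fun x => by
    ext
    simp
  cases t with
  | eq x y =>
    have ht1 := ht 1 (by simp [Tok.encode])
    have ht2 := ht 2 (by simp [Tok.encode])
    simp [Tok.encode] at ht0 ht1 ht2
    simpa [parseTok, Prog.run, Expr.eval, ht0, ht1, ht2, Tok.encode, Tok.vars, two] using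
      (h'.read x).read y
  | adj x y =>
    have ht1 := ht 1 (by simp [Tok.encode])
    have ht2 := ht 2 (by simp [Tok.encode])
    simp [Tok.encode] at ht0 ht1 ht2
    simpa [parseTok, Prog.run, Expr.eval, ht0, ht1, ht2, Tok.encode, Tok.vars, two] using
      (h'.read x).read y
  | color i x =>
    have ht2 := ht 2 (by simp [Tok.encode])
    simp [Tok.encode] at ht0 ht2
    simpa [parseTok, Prog.run, Expr.eval, ht0, ht2, Tok.encode, Tok.vars, one] using h'.read x
  | ex x =>
    have ht1 := ht 1 (by simp [Tok.encode])
    simp [Tok.encode] at ht0 ht1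
    simpa [parseTok, Prog.run, Expr.eval, ht0, ht1, Tok.encode, Tok.vars, one] using h'.read x
  | all x =>
    have ht1 := ht 1 (by simp [Tok.encode])
    simp [Tok.encode] at ht0 ht1
    simpa [parseTok, Prog.run, Expr.eval, ht0, ht1, Tok.encode, Tok.vars, one] using h'.read x
  | _ =>
    simp [Tok.encode] at ht0
    simpa [parseTok, Prog.run, Expr.eval, ht0, Tok.encode, Tok.vars] using h

/-- The memory holds the operators of `φ`, their positions and the numbers of the variables. -/
structure HoldsFormula {c : ℕ} (φ : FOFormula c) (σ : State) : Prop where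
  size : σ.reg 13 = φ.toks.length
  tok : ∀ (i : ℕ) (h : i < φ.toks.length), ∀ k < φ.toks[i].encode.length,
    σ.mem 1 (σ.mem 7 i + k) = φ.toks[i].encode.getD k 0
  interned : Interned φ.vars σ

/-- Round `j` starts at the total length of the first `j` operators. Since every operator has at
least one symbol, the number of rounds is at most the length of the formula, and the end of the
string is not reached before the last operator has been read. -/
theorem parseFormula_runs {c : ℕ} (φ : FOFormula c) (h1 : σ.reg 1 = φ.encode.length)
    (hm : ∀ i, σ.mem 1 i = φ.encode.getD i 0) (h12 : σ.reg 12 = 0) (h13 : σ.reg 13 = 0)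
    (h14 : σ.reg 14 = 0) (h6 : ∀ i, σ.mem 6 i = 0) :
    Runs parseFormula σ (φ.length * 100 + 10) (HoldsFormula φ) := by
  set ts := φ.toks with hts
  have henc : φ.encode = ts.flatMap Tok.encode := φ.encode_eq_flatMap
  have hpos : ∀ (j : ℕ) (hj : j < ts.length), ∀ k < ts[j].encode.length,
      σ.mem 1 (((ts.take j).flatMap Tok.encode).length + k) = ts[j].encode.getD k 0 := by
    intro j hj k hk
    have : ts.flatMap Tok.encode = (ts.take j).flatMap Tok.encode ++
        (ts[j].encode ++ (ts.drop (j + 1)).flatMap Tok.encode) := by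
      conv_lhs => rw [← List.take_append_drop j ts, List.drop_eq_getElem_cons hj]
      rw [List.flatMap_append, List.flatMap_cons]
    rw [hm, henc, this, List.getD_append_right _ _ _ _ (by omega), Nat.add_sub_cancel_left,
      List.getD_append _ _ _ _ hk]
  refine (Runs.loop (t := 80) (fun j τ => j ≤ ts.length ∧ τ.reg 13 = j ∧
    τ.reg 12 = ((ts.take j).flatMap Tok.encode).length ∧
    (∀ i < j, τ.mem 7 i = ((ts.take i).flatMap Tok.encode).length) ∧
    Interned (Tok.varsOf (ts.take j)) τ) ts.length ?_ ?_).mono ?_ ?_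
  · refine ⟨Nat.zero_le _, h13, by simpa using h12, by simp, ?_⟩
    constructor <;> simp [h14, h6, Tok.varsOf]
  · rintro j τ hf ⟨hj, h13, h12, h7, hI⟩ he
    have hr1 : τ.reg 1 = φ.encode.length := by rw [hf.reg 1 (by decide), h1]
    have hj' : j < ts.length := by
      by_contra hne
      have : j = ts.length := by omega
      subst this
      simp [Expr.eval, h12, hr1, henc] at he
    refine ⟨hj', .straight rfl (by decide) ?_⟩
    have hm1 : τ.mem 1 = σ.mem 1 := hf.mem 1 (by decide)
    obtain ⟨e12, e13, e7, eI⟩ := parseTok_run ts[j] hI h12 (by rw [hm1]; exact hpos j hj')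
    have htake : ts.take (j + 1) = ts.take j ++ [ts[j]] := (List.take_concat_get' ts j hj').symm
    refine ⟨hj', by rw [e13, h13], ?_, ?_, ?_⟩
    · rw [e12, htake, List.flatMap_append]
      simp
    · intro i hi
      rw [e7, h13]
      rcases Nat.lt_succ_iff_lt_or_eq.1 hi with hi | rfl
      · simpa [hi.ne] using h7 i hi
      · simp
    · rw [htake, Tok.varsOf_append]
      simpa [Tok.varsOf] using eI
  · have := Tok.length_le_length_flatMap ts
    rw [← henc] at this
    rw [FOFormula.length]
    simp only [Expr.cost]
    omega
  · rintro τ hf ⟨j, -, ⟨hj, h13, h12, h7, hI⟩, he⟩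
    have hr1 : τ.reg 1 = φ.encode.length := by rw [hf.reg 1 (by decide), h1]
    have hm1 : τ.mem 1 = σ.mem 1 := hf.mem 1 (by decide)
    obtain rfl : j = ts.length := by
      by_contra hne
      have hj' : j < ts.length := by omega
      have h3 : ts.flatMap Tok.encode =
          (ts.take j).flatMap Tok.encode ++ (ts.drop j).flatMap Tok.encode := by
        rw [← List.flatMap_append, List.take_append_drop]
      have h2 := Tok.length_le_length_flatMap (ts.drop j)
      rw [List.length_drop] at h2
      have : τ.reg 12 < τ.reg 1 := by
        rw [h12, hr1, henc, h3, List.length_append]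
        omega
      simp [Expr.eval, this] at he
    refine ⟨h13, fun i hi k hk => ?_, ?_⟩
    · rw [hm1, h7 i hi]
      exact hpos i hi k hk
    · rw [List.take_length] at hI
      rwa [φ.vars_eq_varsOf]

end RAM

/-! ## Codes of vertices and the reduced tree -/

theorem sum_mul_pow_lt {b : ℕ} (d : ℕ → ℕ) (hd : ∀ i, d i < b) (m : ℕ) :
    ∑ i ∈ Finset.range m, d i * b ^ i < b ^ m := by
  induction m with
  | zero => simp
  | succ m ih =>
    rw [Finset.sum_range_succ]
    calc _ < b ^ m + d m * b ^ m := by omega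
      _ = (d m + 1) * b ^ m := by ring
      _ ≤ b * b ^ m := Nat.mul_le_mul_right _ (hd m)
      _ = b ^ (m + 1) := by ring

/-- Uniqueness of the expansion in base `b`: the lower digits sum to less than `b ^ m`, so division
by `b ^ m` isolates the leading digit. -/
theorem eq_of_sum_mul_pow_eq {b : ℕ} {d e : ℕ → ℕ} (hd : ∀ i, d i < b) (he : ∀ i, e i < b) {m : ℕ}
    (h : ∑ i ∈ Finset.range m, d i * b ^ i = ∑ i ∈ Finset.range m, e i * b ^ i) :
    ∀ i < m, d i = e i := by
  induction m with
  | zero => simp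
  | succ m ih =>
    rw [Finset.sum_range_succ, Finset.sum_range_succ] at h
    have h1 := sum_mul_pow_lt d hd m
    have h2 := sum_mul_pow_lt e he m
    have hm : d m = e m := by
      have h3 := congrArg (· / b ^ m) h
      have hpos : 0 < b ^ m := by omega
      rwa [Nat.add_mul_div_right _ _ hpos, Nat.add_mul_div_right _ _ hpos,
        Nat.div_eq_of_lt h1, Nat.div_eq_of_lt h2, zero_add, zero_add] at h3
    rw [hm] at h
    intro i hi
    rcases Nat.lt_succ_iff_lt_or_eq.1 hi with hi | rfl
    · exact ih (by omega) i hi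
    · exact hm

section Codes

open Classical in
/-- The vertices in `S` with parent `p` and code `g`. -/
noncomputable def childrenOf {V : Type} (par : V → V) (cd : V → ℕ) (S : Finset V) (p : V)
    (g : ℕ) : Finset V :=
  S.filter fun u => par u = p ∧ cd u = g

open Classical in
/-- The state of the computation of codes, after the vertices in `S` have been considered. The
vertices that are kept are those in `K`, the code of `v` is `cd v` and `cnt g p` is the number of
children of `p` with code `g` that are kept. -/
structure CodeInv {V : Type} (r : V) (par : V → V) (b s : ℕ) (col : V → ℕ) (S K : Finset V)
    (cd : V → ℕ) (cnt : ℕ → V → ℕ) : Prop where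
  code : ∀ v, cd v = col v + ∑ u ∈ K with par u = v, b ^ (cd u + 1)
  card_kept : ∀ g p, (childrenOf par cd K p g).card = cnt g p
  min_card : ∀ g p, min (childrenOf par cd S p g).card s = cnt g p
  subset : K ⊆ S
  root : r ∉ S

variable {V : Type} {r : V} {dp : V → ℕ} {par : V → V} {b s : ℕ} {col : V → ℕ} {S K : Finset V}
  {cd : V → ℕ} {cnt : ℕ → V → ℕ}

theorem mem_childrenOf {S : Finset V} {p : V} {g : ℕ} {u : V} :
    u ∈ childrenOf par cd S p g ↔ u ∈ S ∧ par u = p ∧ cd u = g := by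
  simp [childrenOf]

theorem childrenOf_congr {cd' : V → ℕ} {S : Finset V} (h : ∀ u ∈ S, cd' u = cd u) (p : V) (g : ℕ) :
    childrenOf par cd' S p g = childrenOf par cd S p g := by
  ext u
  simp only [mem_childrenOf]
  exact and_congr_right fun hu => by rw [h u hu]

theorem childrenOf_insert [DecidableEq V] (S : Finset V) (v p : V) (g : ℕ) :
    childrenOf par cd (insert v S) p g =
      if par v = p ∧ cd v = g then insert v (childrenOf par cd S p g)
      else childrenOf par cd S p g := by
  split_ifs with h <;> ext u <;> simp only [mem_childrenOf, Finset.mem_insert] <;> aesop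

theorem CodeInv.init : CodeInv r par b s col ∅ ∅ col fun _ _ => 0 where
  code := by simp
  card_kept := by simp [childrenOf]
  min_card := by simp [childrenOf]
  subset := by simp
  root := by simp

open Classical in
/-- A vertex is considered that is not kept. -/
theorem CodeInv.skip (h : CodeInv r par b s col S K cd cnt) {v : V} (hv : v ∉ S) (hr : v ≠ r)
    (hs : s ≤ cnt (cd v) (par v)) : CodeInv r par b s col (insert v S) K cd cnt where
  code := h.code
  card_kept := h.card_kept
  min_card g p := by
    have := h.min_card g p
    rw [childrenOf_insert]
    split_ifs with hp
    · obtain ⟨rfl, rfl⟩ := hp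
      rw [Finset.card_insert_of_notMem fun hm => hv (mem_childrenOf.1 hm).1]
      omega
    · exact this
  subset := h.subset.trans (Finset.subset_insert _ _)
  root := by simp [hr.symm, h.root]

open Classical in
/-- A vertex is considered and kept. -/
theorem CodeInv.keep (h : CodeInv r par b s col S K cd cnt) {v : V} (hv : v ∉ S) (hr : v ≠ r)
    (hpv : par v ≠ v) (hpS : par v ∉ S) (hs : cnt (cd v) (par v) < s) {cd' : V → ℕ}
    {cnt' : ℕ → V → ℕ} (hcd : cd' = Function.update cd (par v) (cd (par v) + b ^ (cd v + 1)))
    (hcnt : ∀ g p, cnt' g p = if par v = p ∧ cd v = g then cnt g p + 1 else cnt g p) :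
    CodeInv r par b s col (insert v S) (insert v K) cd' cnt' := by
  subst hcd
  set cd' := Function.update cd (par v) (cd (par v) + b ^ (cd v + 1)) with hcd
  -- Only the code of `par v` changes, and `par v` has not been considered yet. Codes of considered
  -- vertices are therefore final, which is what the order by decreasing depth is for.
  have hne : ∀ u ∈ insert v S, cd' u = cd u := by
    intro u hu
    have : u ≠ par v := by
      rintro rfl
      rcases Finset.mem_insert.1 hu with hu | hu
      · exact hpv hu
      · exact hpS hu
    simp [hcd, this]
  have hvK : v ∉ K := fun hk => hv (h.subset hk)
  refine ⟨fun w => ?_, fun g p => ?_, fun g p => ?_, Finset.insert_subset_insert _ h.subset,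
    by simp [hr.symm, h.root]⟩
  · have hsum : ∀ w, ∑ u ∈ K with par u = w, b ^ (cd' u + 1) =
        ∑ u ∈ K with par u = w, b ^ (cd u + 1) := fun w => Finset.sum_congr rfl fun u hu => by
      rw [hne u (Finset.mem_insert_of_mem (h.subset (Finset.mem_filter.1 hu).1))]
    rw [Finset.filter_insert]
    by_cases hw : par v = w
    · subst hw
      rw [if_pos rfl, Finset.sum_insert (by simp [hvK]), hsum, hne v (Finset.mem_insert_self _ _)]
      have := h.code (par v)
      simp only [hcd, Function.update_self]
      omega
    · rw [if_neg hw, hsum, ← h.code]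
      simp [hcd, Ne.symm hw]
  · rw [childrenOf_congr fun u hu => hne u (Finset.insert_subset_insert _ h.subset hu),
      childrenOf_insert, hcnt]
    split_ifs with hp
    · rw [Finset.card_insert_of_notMem fun hm => hvK (mem_childrenOf.1 hm).1, h.card_kept]
    · rw [h.card_kept]
  · rw [childrenOf_congr hne, childrenOf_insert, hcnt]
    have := h.min_card g p
    split_ifs with hp
    · obtain ⟨rfl, rfl⟩ := hp
      rw [Finset.card_insert_of_notMem fun hm => hv (mem_childrenOf.1 hm).1]
      omega
    · exact this

/-- The digits of the code of `v`. -/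
def codeDigit (col : V → ℕ) (cnt : ℕ → V → ℕ) (v : V) : ℕ → ℕ
  | 0 => col v
  | g + 1 => cnt g v

theorem CodeInv.cnt_le (h : CodeInv r par b s col S K cd cnt) (g : ℕ) (p : V) : cnt g p ≤ s := by
  rw [← h.min_card]
  exact min_le_right _ _

theorem CodeInv.codeDigit_lt (h : CodeInv r par b s col S K cd cnt) (hs : s < b)
    (hcol : ∀ v, col v < b) (v : V) (i : ℕ) : codeDigit col cnt v i < b := by
  cases i with
  | zero => exact hcol v
  | succ g => exact (h.cnt_le g v).trans_lt hs

/-- Grouping the kept children by their codes turns a sum of powers of `b` into an expansion in base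
`b`, whose digits are the color and the numbers of kept children. -/
theorem CodeInv.code_eq_sum (h : CodeInv r par b s col S K cd cnt) {v : V} {B : ℕ}
    (hB : ∀ u ∈ K, par u = v → cd u < B) :
    cd v = ∑ i ∈ Finset.range (B + 1), codeDigit col cnt v i * b ^ i := by
  classical
  rw [h.code, Finset.sum_range_succ', add_comm]
  simp only [codeDigit, pow_zero, mul_one]
  congr 1
  rw [← Finset.sum_fiberwise_of_maps_to (t := Finset.range B) (g := cd)]
  · refine Finset.sum_congr rfl fun g _ => ?_
    rw [← h.card_kept, Finset.filter_filter, ← smul_eq_mul, ← Finset.sum_const, childrenOf]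
    refine Finset.sum_congr (by congr) fun u hu => ?_
    rw [(Finset.mem_filter.1 hu).2.2]
  · intro u hu
    rw [Finset.mem_filter] at hu
    exact Finset.mem_range.2 (hB u hu.1 hu.2)

/-- A bound on the codes of the vertices whose subtrees have height at most `h`. -/
def codeBound (b : ℕ) : ℕ → ℕ
  | 0 => b
  | h + 1 => b ^ (codeBound b h + 2)

/-- Induction on `k`, which bounds the height of the subtree below `v`. If the kept children have
codes below `B`, the code of `v` has `B + 1` digits and is smaller than `b ^ (B + 1)`. For `k = 0` a
kept child would be deeper than `D`, so the code is just the color. -/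
theorem CodeInv.code_lt (h : CodeInv r par b s col S K cd cnt) (hpar : IsParentMap r dp par)
    (hs : s < b) (hcol : ∀ v, col v < b) {D : ℕ} (hD : ∀ v, dp v ≤ D) (k : ℕ) (v : V)
    (hk : D ≤ dp v + k) : cd v < codeBound b k := by
  induction k generalizing v with
  | zero =>
    have h0 := h.code_eq_sum (v := v) (B := 0) fun u hu hp => by
      have h1 := hpar.dp_par u fun he => h.root (he ▸ h.subset hu)
      have h2 := hD u
      rw [hp] at h1
      omega
    simp only [zero_add, Finset.sum_range_one, codeDigit, pow_zero, mul_one] at h0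
    rw [h0]
    exact hcol v
  | succ k ih =>
    have h0 := h.code_eq_sum (v := v) (B := codeBound b k) fun u hu hp => by
      have h1 := hpar.dp_par u fun he => h.root (he ▸ h.subset hu)
      rw [hp] at h1
      exact ih u (by omega)
    rw [h0]
    refine (sum_mul_pow_lt _ (h.codeDigit_lt hs hcol v) _).trans_le ?_
    exact Nat.pow_le_pow_right (by omega) (by omega)

/-- Equal numbers have equal digits. `B` may be any strict bound on the finitely many codes: indices
from `B` on are not codes of any vertex, so the counts there are 0. -/
theorem CodeInv.digits_eq (h : CodeInv r par b s col S K cd cnt) [Finite V] (hs : s < b)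
    (hcol : ∀ v, col v < b) {p q : V} (hpq : cd p = cd q) :
    col p = col q ∧ ∀ g, cnt g p = cnt g q := by
  have := Fintype.ofFinite V
  obtain ⟨B, hB⟩ : ∃ B, ∀ u, cd u < B :=
    ⟨Finset.univ.sup cd + 1, fun u => Nat.lt_succ_of_le (Finset.le_sup (Finset.mem_univ u))⟩
  have h1 := h.code_eq_sum (v := p) (B := B) fun u _ _ => hB u
  have h2 := h.code_eq_sum (v := q) (B := B) fun u _ _ => hB u
  rw [h1, h2] at hpq
  have hd := eq_of_sum_mul_pow_eq (h.codeDigit_lt hs hcol p) (h.codeDigit_lt hs hcol q) hpq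
  refine ⟨hd 0 (by omega), fun g => ?_⟩
  by_cases hg : g < B
  · exact hd (g + 1) (by omega)
  · have h0 : ∀ p, childrenOf par cd K p g = ∅ := fun p => by
      refine Finset.eq_empty_of_forall_notMem fun u hu => ?_
      have := hB u
      have := (mem_childrenOf.1 hu).2.2
      omega
    rw [← h.card_kept, ← h.card_kept, h0, h0]

/-- The vertices that are kept together with all their ancestors. -/
def reducedTree (dp : V → ℕ) (par : V → V) (K : Finset V) : Set V :=
  {v | ∀ i < dp v, par^[i] v ∈ K}

variable [Fintype V]

open Classical in
theorem childrenOf_erase_root (p : V) (g : ℕ) :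
    childrenOf par cd (Finset.univ.erase r) p g = childrenIn r par cd Set.univ p g := by
  ext u
  simp [mem_childrenOf, mem_childrenIn]

-- Once all vertices but the root have been considered, the digits of a code are the truncated
-- numbers of all children, and equal codes have equal digits.
open Classical in
theorem CodeInv.codeCounts (h : CodeInv r par b s col (Finset.univ.erase r) K cd cnt) (hs : s < b)
    (hcol : ∀ v, col v < b) : CodeCounts r par cd s := by
  intro p q hpq g
  rw [← childrenOf_erase_root, ← childrenOf_erase_root, h.min_card, h.min_card]
  exact (h.digits_eq hs hcol hpq).2 g

-- A kept child of a vertex of the reduced tree belongs to the reduced tree, and the number of kept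
-- children with a given code is by construction the truncated number of all of them.
open Classical in
theorem CodeInv.countClosed (h : CodeInv r par b s col (Finset.univ.erase r) K cd cnt)
    (hpar : IsParentMap r dp par) : CountClosed r par cd s (reducedTree dp par K) where
  root_mem := by simp [reducedTree, hpar.dp_root]
  par_mem v hv i hi := by
    by_cases hr : v = r
    · rw [hr, hpar.par_root, hpar.dp_root] at hi
      omega
    · have := hpar.dp_par v hr
      rw [← Function.iterate_succ_apply]
      exact hv _ (by omega)
  min_card q hq g := by
    rw [← childrenOf_erase_root, h.min_card, ← h.card_kept]
    refine Finset.card_le_card fun u hu => ?_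
    obtain ⟨huK, hp, hc⟩ := mem_childrenOf.1 hu
    have hr : u ≠ r := fun he => h.root (he ▸ h.subset huK)
    refine mem_childrenIn.2 ⟨?_, hr, hp, hc⟩
    rintro (_ | i) hi
    · exact huK
    · rw [Function.iterate_succ_apply, hp]
      refine hq i ?_
      have := hpar.dp_par u hr
      rw [hp] at this
      omega

-- A vertex in layer `d + 1` is one of at most `s` kept children of a vertex in layer `d` with one
-- of at most `B` codes, so each layer is at most `s * B` times as large as the one above.
open Classical in
theorem CodeInv.card_layer_le (h : CodeInv r par b s col S K cd cnt)
    (hpar : IsParentMap r dp par) {B : ℕ} (hB : ∀ v, cd v < B) (d : ℕ) :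
    (Finset.univ.filter fun v => v ∈ reducedTree dp par K ∧ dp v = d).card ≤ (s * B) ^ d := by
  induction d with
  | zero =>
    rw [pow_zero, Finset.card_le_one]
    have : ∀ v, dp v = 0 → v = r := fun v hv => by
      by_contra hr
      have := hpar.dp_par v hr
      omega
    intro u hu v hv
    rw [Finset.mem_filter] at hu hv
    rw [this u hu.2.2, this v hv.2.2]
  | succ d ih =>
    set L := Finset.univ.filter fun v => v ∈ reducedTree dp par K ∧ dp v = d
    have hsub : (Finset.univ.filter fun v => v ∈ reducedTree dp par K ∧ dp v = d + 1) ⊆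
        (L ×ˢ Finset.range B).biUnion fun q => childrenOf par cd K q.1 q.2 := by
      intro v hv
      rw [Finset.mem_filter] at hv
      obtain ⟨-, hv, hd⟩ := hv
      have hr : v ≠ r := by
        rintro rfl
        rw [hpar.dp_root] at hd
        omega
      have := hpar.dp_par v hr
      rw [Finset.mem_biUnion]
      refine ⟨(par v, cd v), Finset.mem_product.2 ⟨?_, Finset.mem_range.2 (hB v)⟩,
        mem_childrenOf.2 ⟨hv 0 (by omega), rfl, rfl⟩⟩
      refine Finset.mem_filter.2 ⟨Finset.mem_univ _, fun i hi => ?_, show dp (par v) = d by omega⟩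
      have hi : i < dp (par v) := hi
      exact hv (i + 1) (by omega)
    refine (Finset.card_le_card hsub).trans ?_
    refine (Finset.card_biUnion_le_card_mul _ _ s fun q _ => ?_).trans ?_
    · rw [h.card_kept]
      exact h.cnt_le _ _
    · rw [Finset.card_product, Finset.card_range, pow_succ, mul_assoc, mul_comm B s]
      exact Nat.mul_le_mul_right _ ih

open Classical in
theorem CodeInv.card_reducedTree_le (h : CodeInv r par b s col S K cd cnt)
    (hpar : IsParentMap r dp par) {B : ℕ} (hB : ∀ v, cd v < B) {D : ℕ} (hD : ∀ v, dp v ≤ D) :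
    (Finset.univ.filter fun v => v ∈ reducedTree dp par K).card ≤ (D + 1) * (s * B + 1) ^ D := by
  have hsub : (Finset.univ.filter fun v => v ∈ reducedTree dp par K) ⊆
      (Finset.range (D + 1)).biUnion fun d =>
        Finset.univ.filter fun v => v ∈ reducedTree dp par K ∧ dp v = d := by
    intro v hv
    rw [Finset.mem_filter] at hv
    simp only [Finset.mem_biUnion, Finset.mem_range, Finset.mem_filter]
    exact ⟨dp v, Nat.lt_succ_of_le (hD v), Finset.mem_univ _, hv.2, rfl⟩
  refine (Finset.card_le_card hsub).trans ((Finset.card_biUnion_le_card_mul _ _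
    ((s * B + 1) ^ D) fun d hd => ?_).trans_eq (by rw [Finset.card_range]))
  -- The added 1 makes the base positive, so that the power is monotone in the exponent and one
  -- bound serves all layers.
  refine (h.card_layer_le hpar hB d).trans ((Nat.pow_le_pow_left (Nat.le_succ _) d).trans ?_)
  exact Nat.pow_le_pow_right (Nat.succ_pos _) (Nat.lt_succ_iff.1 (Finset.mem_range.1 hd))

end Codes

/-! ## Computing codes -/

namespace RAM

/-- Multiply register `x` by register `N`, with `i` and `y` as auxiliary registers. -/
def mulBy (i N x y : ℕ) : Prog :=
  .assign y (.const 0) ;; forLt i N (.assign y (.add (.reg y) (.reg x))) ;; .assign x (.reg y)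

theorem addLoop_runs {σ : State} {i N x y m : ℕ} (hm : σ.reg N = m) (hiN : N ≠ i) (hyN : N ≠ y)
    (hiy : i ≠ y) (hix : x ≠ i) (hxy : x ≠ y) :
    Runs (forLt i N (.assign y (.add (.reg y) (.reg x)))) σ (m * 12 + 6) fun τ =>
      τ.reg y = σ.reg y + m * σ.reg x := by
  refine (Runs.forLt (t := 4) (m := m) (fun j τ => τ.reg y = σ.reg y + j * σ.reg x) hm
    (by simp [forLt, Prog.regs, hiN, hyN]) (by simpa [Prog.regs] using hiy)
    (by simp [hiy.symm]) ?_).mono le_rfl fun _ _ h => h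
  intro j hj τ hf hr hI
  refine .straight rfl le_rfl ?_
  have hx : τ.reg x = σ.reg x := hf.reg x (by simp [forLt, Prog.regs, hix, hxy])
  simp [Prog.run, Expr.eval, hiy.symm, hI, hx]
  ring

/-- The machine has no multiplication, and repeated addition takes time linear in one factor. It is
applied only with that factor bounded in terms of the parameters, such as the base or the size of
the reduced tree. -/
theorem mulBy_runs {σ : State} {i N x y m : ℕ} (hm : σ.reg N = m) (hiN : N ≠ i) (hyN : N ≠ y)
    (hiy : i ≠ y) (hix : x ≠ i) (hxy : x ≠ y) :
    Runs (mulBy i N x y) σ (m * 12 + 10) fun τ => τ.reg x = σ.reg x * m := by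
  refine (Runs.seq (t := 2) (Q := fun τ => τ = σ.setReg y 0) (u := m * 12 + 6 + 2)
    (.straight rfl le_rfl (by simp [Prog.run, Expr.eval])) ?_).time_mono (by omega)
  rintro _ - rfl
  refine Runs.seq (addLoop_runs (m := m) (by simpa [hyN] using hm) hiN hyN hiy hix hxy) ?_
  intro τ hf h
  refine .straight rfl le_rfl ?_
  simp [Prog.run, Expr.eval, h, hxy, mul_comm]

/-- Compute, in register `17`, a number that is greater than the number of variables and all
colors. -/
def findBase : Prog :=
  .assign 17 (.add (.reg 14) (.const 1)) ;;
  forLt 18 2 (.ite (.lt (.idx 0 (.add (.reg 18) (.const 1))) (.reg 17)) .skip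
    (.assign 17 (.add (.idx 0 (.add (.reg 18) (.const 1))) (.const 1))))

/-- Initialize array `8`, of the codes, with the colors. -/
def initCodes : Prog := forLt 19 2 (.store 8 (.reg 19) (.idx 0 (.add (.reg 19) (.const 1))))

/-- Keep the vertex in register `21`: count it in cell `24` of array `10`, mark it in array `9` and
add to the code of its parent the power of the base that belongs to its own code, in
register `23`. -/
def keepVertex : Prog :=
  .store 10 (.reg 24) (.add (.idx 10 (.reg 24)) (.const 1)) ;;
  .store 9 (.reg 21) (.const 1) ;;
  .assign 26 (.const 1) ;;
  .assign 29 (.add (.reg 23) (.const 1)) ;;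
  forLt 28 29 (mulBy 30 17 26 27) ;;
  .store 8 (.idx 5 (.reg 21)) (.add (.idx 8 (.idx 5 (.reg 21))) (.reg 26))

/-- Consider the vertex in register `21`: keep it if fewer than `s` siblings with the same code are
kept. -/
def codeVertex : Prog :=
  .assign 23 (.idx 8 (.reg 21)) ;;
  .assign 24 (.idx 5 (.reg 21)) ;;
  forLt 25 23 (.assign 24 (.add (.reg 24) (.reg 2))) ;;
  .ite (.lt (.idx 10 (.reg 24)) (.reg 14)) keepVertex .skip

/-- Compute the codes of all vertices, by decreasing distance from the root. -/
def computeCodes : Prog :=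
  forLt 20 8 (.assign 22 (.sub (.add (.reg 8) (.const 1)) (.reg 20)) ;;
    forLt 21 2 (.ite (.eq (.idx 4 (.reg 21)) (.reg 22)) codeVertex .skip))

variable {n : ℕ} {σ : State}

/-- Only colors that occur are inspected, so the machine need not know `c`. The result is either `s
+ 1` or one more than some color. -/
theorem findBase_runs {s c : ℕ} {col : Fin n → Fin c} (h2 : σ.reg 2 = n) (h14 : σ.reg 14 = s)
    (h0 : ∀ v : Fin n, σ.mem 0 (v + 1) = col v) :
    Runs findBase σ (n * 30 + 20) fun τ =>
      s < τ.reg 17 ∧ (∀ v, (col v : ℕ) < τ.reg 17) ∧ τ.reg 17 ≤ s + c + 1 := by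
  refine (Runs.seq (t := 4) (Q := fun τ => τ = σ.setReg 17 (s + 1)) (u := n * (20 + 8) + 6)
    (.straight rfl le_rfl (by simp [Prog.run, Expr.eval, h14])) ?_).time_mono (by omega)
  rintro _ - rfl
  refine (Runs.forLt (t := 20) (m := n)
    (fun j τ => s < τ.reg 17 ∧ (∀ v : Fin n, v < j → (col v : ℕ) < τ.reg 17) ∧
      τ.reg 17 ≤ s + c + 1) (by simpa using h2) (by decide) (by decide) (by simp) ?_).mono le_rfl ?_
  · rintro j hj τ hf hr ⟨hs, hcol, hle⟩
    have hm : τ.mem 0 (j + 1) = col ⟨j, hj⟩ := by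
      rw [hf.mem 0 (by decide)]
      exact h0 ⟨j, hj⟩
    have hc := (col ⟨j, hj⟩).2
    refine .straight rfl (by decide) ?_
    have hcase : ∀ v : Fin n, v < j + 1 → v < j ∨ v = ⟨j, hj⟩ := fun v hv => by
      rcases Nat.lt_succ_iff_lt_or_eq.1 hv with h | h
      · exact .inl h
      · exact .inr (Fin.ext h)
    by_cases hlt : (col ⟨j, hj⟩ : ℕ) < τ.reg 17
    · simp only [Prog.run, Expr.eval, hr, hm, hlt, if_true, one_ne_zero, if_false,
        State.setReg_reg, Nat.reduceEqDiff]
      refine ⟨hs, fun v hv => ?_, hle⟩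
      rcases hcase v hv with h | rfl
      · exact hcol v h
      · exact hlt
    · simp only [Prog.run, Expr.eval, hr, hm, hlt, if_true, if_false,
        State.setReg_reg, Nat.reduceEqDiff]
      refine ⟨by omega, fun v hv => ?_, by omega⟩
      rcases hcase v hv with h | rfl
      · exact (hcol v h).trans (by omega)
      · omega
  · rintro τ - ⟨hs, hcol, hle⟩
    exact ⟨hs, fun v => hcol v v.2, hle⟩

theorem initCodes_runs {c : ℕ} {col : Fin n → Fin c} (h2 : σ.reg 2 = n)
    (h0 : ∀ v : Fin n, σ.mem 0 (v + 1) = col v) :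
    Runs initCodes σ (n * 30 + 20) fun τ => ∀ v : Fin n, τ.mem 8 v = col v := by
  refine (Runs.forLt (t := 20) (m := n) (fun j τ => ∀ v : Fin n, v < j → τ.mem 8 v = col v)
    h2 (by decide) (by decide) (by simp) ?_).mono (by omega) fun τ _ h v => h v v.2
  intro j hj τ hf hr hI
  refine .straight rfl (by decide) ?_
  have hm : τ.mem 0 (j + 1) = col ⟨j, hj⟩ := by
    rw [hf.mem 0 (by decide)]
    exact h0 ⟨j, hj⟩
  intro v hv
  rcases Nat.lt_succ_iff_lt_or_eq.1 hv with h | h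
  · simpa [Prog.run, Expr.eval, hr, h.ne] using hI v h
  · have : v = ⟨j, hj⟩ := Fin.ext h
    subst this
    simpa [Prog.run, Expr.eval, hr] using hm

/-- The memory holds the state of the computation of codes after the vertices in `S`. -/
def HoldsCodes (r : Fin n) (par : Fin n → Fin n) (b s : ℕ) (col : Fin n → ℕ) (S : Finset (Fin n))
    (τ : State) : Prop :=
  ∃ (K : Finset (Fin n)) (cd : Fin n → ℕ) (cnt : ℕ → Fin n → ℕ),
    CodeInv r par b s col S K cd cnt ∧ (∀ v : Fin n, τ.mem 8 v = cd v) ∧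
    (∀ (g : ℕ) (p : Fin n), τ.mem 10 (p + g * n) = cnt g p) ∧
    ∀ v : Fin n, τ.mem 9 v = if v ∈ K then 1 else 0

theorem HoldsCodes.of_eq {r : Fin n} {par : Fin n → Fin n} {b s : ℕ} {col : Fin n → ℕ}
    {S : Finset (Fin n)} {τ : State} (h : HoldsCodes r par b s col S σ) (h8 : τ.mem 8 = σ.mem 8)
    (h9 : τ.mem 9 = σ.mem 9) (h10 : τ.mem 10 = σ.mem 10) : HoldsCodes r par b s col S τ := by
  simpa only [HoldsCodes, h8, h9, h10] using h

/-- The remainder modulo `n` recovers `p`. This allows two-dimensional tables in one array, for the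
counters of children and for the tuples. -/
theorem add_mul_inj {p p' g g' : ℕ} (hp : p < n) (hp' : p' < n) :
    p + g * n = p' + g' * n ↔ p = p' ∧ g = g' := by
  refine ⟨fun h => ?_, by rintro ⟨rfl, rfl⟩; rfl⟩
  have h1 := congrArg (· % n) h
  simp only [Nat.add_mul_mod_self_right, Nat.mod_eq_of_lt hp, Nat.mod_eq_of_lt hp'] at h1
  subst h1
  exact ⟨rfl, Nat.eq_of_mul_eq_mul_right (by omega) (Nat.add_left_cancel h)⟩

theorem keepVertex_runs {b g p v : ℕ} (h17 : σ.reg 17 = b) (h21 : σ.reg 21 = v)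
    (h23 : σ.reg 23 = g) (h5 : σ.mem 5 v = p) :
    Runs keepVertex σ ((g + 1) * (b * 12 + 20) + 40) fun τ =>
      τ.mem 8 = Function.update (σ.mem 8) p (σ.mem 8 p + b ^ (g + 1)) ∧
      τ.mem 9 = Function.update (σ.mem 9) v 1 ∧
      τ.mem 10 = Function.update (σ.mem 10) (σ.reg 24) (σ.mem 10 (σ.reg 24) + 1) := by
  refine (Runs.seq (t := 6) (Q := fun τ => τ =
    σ.setMem 10 (σ.reg 24) (σ.mem 10 (σ.reg 24) + 1)) (u := (g + 1) * (b * 12 + 20) + 30)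
    (.straight rfl le_rfl (by simp [Prog.run, Expr.eval])) ?_).time_mono (by omega)
  rintro _ - rfl
  refine (Runs.seq (t := 4) (Q := fun τ => τ =
    (σ.setMem 10 (σ.reg 24) (σ.mem 10 (σ.reg 24) + 1)).setMem 9 v 1)
    (u := (g + 1) * (b * 12 + 20) + 24)
    (.straight rfl (by decide) (by simp [Prog.run, Expr.eval, h21])) ?_).time_mono (by omega)
  rintro _ - rfl
  refine (Runs.seq (t := 2) (Q := fun τ => τ =
    ((σ.setMem 10 (σ.reg 24) (σ.mem 10 (σ.reg 24) + 1)).setMem 9 v 1).setReg 26 1)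
    (u := (g + 1) * (b * 12 + 20) + 22)
    (.straight rfl (by decide) (by simp [Prog.run, Expr.eval])) ?_).time_mono (by omega)
  rintro _ - rfl
  refine (Runs.seq (t := 4) (Q := fun τ => τ =
    (((σ.setMem 10 (σ.reg 24) (σ.mem 10 (σ.reg 24) + 1)).setMem 9 v 1).setReg 26 1).setReg 29
      (g + 1))
    (u := (g + 1) * (b * 12 + 20) + 18)
    (.straight rfl (by decide) (by simp [Prog.run, Expr.eval, h23])) ?_).time_mono (by omega)
  rintro _ - rfl
  refine (Runs.seq (t := (g + 1) * (b * 12 + 10 + 8) + 6) (u := 12)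
    (Runs.forLt (t := b * 12 + 10) (m := g + 1) (fun j τ => τ.reg 26 = b ^ j) (by simp) (by decide)
    (by decide) (by simp) ?_) ?_).time_mono (by
      nlinarith)
  · intro j hj τ hf hr hI
    refine (mulBy_runs (m := b) ?_ (by decide) (by decide) (by decide) (by decide)
      (by decide)).mono le_rfl ?_
    · rw [hf.reg 17 (by decide)]
      simpa using h17
    · intro ρ _ h
      simp [h, hI, pow_succ]
  · intro τ hf h
    refine .straight rfl (by decide) ?_
    have h21' : τ.reg 21 = v := by
      rw [hf.reg 21 (by decide)]
      simpa using h21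
    have hm : ∀ a, τ.mem a = (((((σ.setMem 10 (σ.reg 24) (σ.mem 10 (σ.reg 24) + 1)).setMem 9 v
      1).setReg 26 1).setReg 29 (g + 1))).mem a := fun a => hf.mem a (by decide +revert)
    simp [Prog.run, Expr.eval, hm, h21', h5, h]

variable {r : Fin n} {dp : Fin n → ℕ} {par : Fin n → Fin n} {b s : ℕ} {col : Fin n → ℕ}
  {S : Finset (Fin n)}

/-- The part of the memory that the computation of codes reads only. -/
structure CodeCtx (dp : Fin n → ℕ) (par : Fin n → Fin n) (b s : ℕ) (σ : State) : Prop where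
  size : σ.reg 2 = n
  bound : σ.reg 14 = s
  base : σ.reg 17 = b
  depth : ∀ v : Fin n, σ.mem 4 v = dp v + 1
  parent : ∀ v : Fin n, σ.mem 5 v = par v

theorem CodeCtx.of_frame {p : Prog} {τ : State} (h : CodeCtx dp par b s σ) (hf : Frame p σ τ)
    (h2 : 2 ∉ p.regs) (h14 : 14 ∉ p.regs) (h17 : 17 ∉ p.regs) (h4 : 4 ∉ p.arrs)
    (h5 : 5 ∉ p.arrs) : CodeCtx dp par b s τ where
  size := (hf.reg 2 h2).trans h.size
  bound := (hf.reg 14 h14).trans h.bound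
  base := (hf.reg 17 h17).trans h.base
  depth v := by rw [hf.mem 4 h4]; exact h.depth v
  parent v := by rw [hf.mem 5 h5]; exact h.parent v

/-- The costly parts are finding the address of the counter, by as many additions as the code says,
and computing the power of the base, by one more multiplication than that. Both are controlled by
the bound `B` on the code. -/
theorem codeVertex_runs (hctx : CodeCtx dp par b s σ) (h : HoldsCodes r par b s col S σ)
    {v : Fin n} (hv : v ∉ S) (hr : v ≠ r) (hpv : par v ≠ v) (hpS : par v ∉ S)
    (h21 : σ.reg 21 = v) {B : ℕ} (hB : σ.mem 8 v < B) :
    Runs codeVertex σ (B * (b * 12 + 40) + 80) (HoldsCodes r par b s col (insert v S)) := by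
  obtain ⟨K, cd, cnt, hI, h8, h10, h9⟩ := h
  have hg := h8 v
  rw [hg] at hB
  have h5 := hctx.parent v
  refine (Runs.seq (t := 3) (Q := fun τ => τ = σ.setReg 23 (cd v)) (u := B * (b * 12 + 40) + 77)
    (.straight rfl (by decide) (by simp [Prog.run, Expr.eval, h21, hg])) ?_).time_mono (by omega)
  rintro _ - rfl
  refine (Runs.seq (t := 3) (Q := fun τ => τ = (σ.setReg 23 (cd v)).setReg 24 (par v))
    (u := B * (b * 12 + 40) + 74)
    (.straight rfl (by decide) (by simp [Prog.run, Expr.eval, h21, h5])) ?_).time_mono (by omega)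
  rintro _ - rfl
  refine (Runs.seq (t := cd v * 12 + 6) (u := (cd v + 1) * (b * 12 + 20) + 50)
    (addLoop_runs (m := cd v) (by simp) (by decide) (by decide) (by decide) (by decide)
    (by decide)) ?_).time_mono ?_
  · intro τ hf h24
    replace h24 : τ.reg 24 = par v + cd v * n := by simpa [hctx.size] using h24
    have hm : ∀ a, τ.mem a = σ.mem a := fun a => hf.mem a (by decide +revert)
    have h14 : τ.reg 14 = s := by rw [hf.reg 14 (by decide)]; simpa using hctx.bound
    refine (Runs.ite (t := (cd v + 1) * (b * 12 + 20) + 40) ?_ ?_).time_mono (by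
      simp only [Expr.cost]; omega)
    · intro hlt
      simp only [Expr.eval, h24, hm, h10, h14, ne_eq, ite_eq_right_iff, one_ne_zero, imp_false,
        not_not] at hlt
      refine (keepVertex_runs (b := b) (g := cd v) (p := par v) (v := v) ?_ ?_ ?_ ?_).mono
        le_rfl ?_
      · rw [hf.reg 17 (by decide)]; simpa using hctx.base
      · rw [hf.reg 21 (by decide)]; simpa using h21
      · rw [hf.reg 23 (by decide)]; simp
      · rw [hm, h5]
      rintro ρ - ⟨e8, e9, e10⟩
      refine ⟨insert v K, Function.update cd (par v) (cd (par v) + b ^ (cd v + 1)), fun g p => if par v = p ∧ cd v = g then cnt g p + 1 else cnt g p,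
        by convert hI.keep hv hr hpv hpS hlt rfl fun _ _ => rfl, ?_, ?_, ?_⟩
      · intro w
        rw [e8, Function.update_apply, Function.update_apply, hm, h8, h8]
        simp only [Fin.val_inj]
      · intro g p
        rw [e10, Function.update_apply, hm, h24, h10, h10]
        simp only [add_mul_inj p.2 (par v).2, Fin.val_inj]
        by_cases hc : par v = p ∧ cd v = g
        · rw [if_pos hc, if_pos ⟨hc.1.symm, hc.2.symm⟩, hc.1, hc.2]
        · rw [if_neg hc, if_neg fun h => hc ⟨h.1.symm, h.2.symm⟩]
      · intro w
        rw [e9, Function.update_apply, hm, h9]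
        simp only [Fin.val_inj, Finset.mem_insert]
        by_cases hw : w = v <;> simp [hw]
    · intro hge
      simp only [Expr.eval, h24, hm, h10, h14, ite_eq_right_iff, one_ne_zero, imp_false,
        not_lt] at hge
      refine .straight rfl (by simp only [Prog.size]; omega) ?_
      exact ⟨K, cd, cnt, by convert hI.skip hv hr hge, by simpa [Prog.run, hm] using h8,
        by simpa [Prog.run, hm] using h10, by simpa [Prog.run, hm] using h9⟩
  · have : (cd v + 1) * (b * 12 + 40) ≤ B * (b * 12 + 40) := Nat.mul_le_mul_right _ hB
    have e : (cd v + 1) * (b * 12 + 40) = (cd v + 1) * (b * 12 + 20) + (cd v + 1) * 20 := by ring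
    omega

/-- Round `k` treats the vertices at depth `D - k`; array 4 holds depths plus 1, whence the
comparison with `D + 1 - k`. When a vertex is considered its parent, one level higher, has not been.
The `D` rounds end with depth 1, so exactly the root is left out. -/
theorem computeCodes_runs {D B : ℕ} (hctx : CodeCtx dp par b s σ) (hpar : IsParentMap r dp par)
    (hs : s < b) (hcol : ∀ v, col v < b) (hD : ∀ v, dp v ≤ D) (h8 : σ.reg 8 = D)
    (hB : codeBound b D ≤ B) (h : HoldsCodes r par b s col ∅ σ) :
    Runs computeCodes σ (D * (n * (B * (b * 12 + 40) + 100) + 30) + 6)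
      (HoldsCodes r par b s col (Finset.univ.erase r)) := by
  let S : ℕ → ℕ → Finset (Fin n) := fun k j => Finset.univ.filter fun v =>
    v ≠ r ∧ (D < dp v + k ∨ dp v + k = D ∧ v < j)
  -- The bound on codes holds at every stage of the computation, not only at its end, and so bounds
  -- the cost of every single vertex.
  have hB' : ∀ (S : Finset (Fin n)) (τ : State), HoldsCodes r par b s col S τ →
      ∀ v : Fin n, τ.mem 8 v < B := by
    rintro S τ ⟨K, cd, cnt, hI, e8, -, -⟩ v
    rw [e8]
    exact (hI.code_lt hpar hs hcol hD D v (by omega)).trans_le hB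
  have hS : ∀ k j (τ : State), HoldsCodes r par b s col (S k j) τ →
      ∀ S', (∀ v, v ∈ S' ↔ v ≠ r ∧ (D < dp v + k ∨ dp v + k = D ∧ v < j)) →
      HoldsCodes r par b s col S' τ := by
    intro k j τ h S' hS'
    rwa [show S' = S k j by ext; simp [S, hS']]
  refine (Runs.forLt (t := n * (B * (b * 12 + 40) + 100) + 20) (m := D)
    (fun k τ => HoldsCodes r par b s col (S k 0) τ) h8 (by decide) (by decide) ?_ ?_).mono
    (by rw [show n * (B * (b * 12 + 40) + 100) + 20 + 8 = n * (B * (b * 12 + 40) + 100) + 28 by rfl]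
        gcongr; omega) ?_
  · have : S 0 0 = ∅ := by
      refine Finset.eq_empty_of_forall_notMem fun v hv => ?_
      have h1 := (Finset.mem_filter.1 hv).2.2
      have h2 := hD v
      omega
    rw [this]
    exact h.of_eq rfl rfl rfl
  · intro k hk τ hf h20 hI
    have hctx' := hctx.of_frame hf (by decide) (by decide) (by decide) (by decide) (by decide)
    have h8' : τ.reg 8 = D := (hf.reg 8 (by decide)).trans h8
    refine (Runs.seq (t := 6) (Q := fun ρ => ρ = τ.setReg 22 (D + 1 - k))
      (u := n * (B * (b * 12 + 40) + 85 + 8) + 6)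
      (.straight rfl (by decide) (by simp [Prog.run, Expr.eval, h8', h20])) ?_).time_mono (by
        nlinarith)
    rintro _ - rfl
    refine (Runs.forLt (σ := τ.setReg 22 (D + 1 - k)) (i := 21) (N := 2)
      (p := .ite (.eq (.idx 4 (.reg 21)) (.reg 22)) codeVertex .skip)
      (t := B * (b * 12 + 40) + 85) (m := n)
      (fun j τ => HoldsCodes r par b s col (S k j) τ) (by simpa using hctx'.size) (by decide)
      (by decide) (hI.of_eq rfl rfl rfl) ?_).mono le_rfl ?_
    · intro j hj ρ hf' h21 hI'
      have hctx'' : CodeCtx dp par b s ρ := by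
        have : CodeCtx dp par b s (τ.setReg 22 (D + 1 - k)) :=
          ⟨by simpa using hctx'.size, by simpa using hctx'.bound, by simpa using hctx'.base,
            hctx'.depth, hctx'.parent⟩
        exact this.of_frame hf' (by decide) (by decide) (by decide) (by decide) (by decide)
      have h22 : ρ.reg 22 = D + 1 - k := by rw [hf'.reg 22 (by decide)]; simp
      have hd := hctx''.depth ⟨j, hj⟩
      simp only at hd
      refine (Runs.ite (t := B * (b * 12 + 40) + 80) ?_ ?_).time_mono (by
        simp only [Expr.cost]; omega)
      · intro he
        simp only [Expr.eval, h21, hd, h22, ne_eq, ite_eq_right_iff, one_ne_zero, imp_false,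
          not_not] at he
        have hr : (⟨j, hj⟩ : Fin n) ≠ r := by
          intro hr
          rw [hr, hpar.dp_root] at he
          omega
        have hdp := hpar.dp_par _ hr
        refine (codeVertex_runs hctx'' hI' (v := ⟨j, hj⟩) ?_ hr ?_ ?_ h21
          (hB' _ _ hI' ⟨j, hj⟩)).mono le_rfl ?_
        · intro hm
          have := (Finset.mem_filter.1 hm).2.2
          simp only at this
          omega
        · intro hp
          rw [hp] at hdp
          omega
        · intro hm
          have := (Finset.mem_filter.1 hm).2.2
          omega
        · intro π _ hπ
          refine (?_ : HoldsCodes r par b s col (S k (j + 1)) π).of_eq rfl rfl rfl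
          refine (?_ : S k (j + 1) = insert ⟨j, hj⟩ (S k j)) ▸ hπ
          ext w
          simp only [S, Finset.mem_filter, Finset.mem_univ, true_and, Finset.mem_insert]
          by_cases hw : w = ⟨j, hj⟩
          · subst hw
            simp only [true_or, iff_true]
            exact ⟨hr, .inr ⟨by omega, by simp⟩⟩
          · have : (w : ℕ) ≠ j := fun h => hw (Fin.ext h)
            simp only [hw, false_or]
            refine and_congr_right fun _ => or_congr_right (and_congr_right fun _ => ?_)
            omega
      · intro he
        simp only [Expr.eval, h21, hd, h22, ite_eq_right_iff, one_ne_zero, imp_false] at he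
        refine .straight rfl (by simp only [Prog.size]; omega) ?_
        refine (hS k j _ hI' (S k (j + 1)) fun w => ?_).of_eq rfl rfl rfl
        simp only [S, Finset.mem_filter, Finset.mem_univ, true_and]
        refine and_congr_right fun _ => or_congr_right (and_congr_right fun hw => ?_)
        have : (w : ℕ) ≠ j := fun h => he (by
          have : w = ⟨j, hj⟩ := Fin.ext h
          rw [← this]
          omega)
        omega
    · intro ρ _ hρ
      refine (hS k n _ hρ (S (k + 1) 0) fun w => ?_).of_eq rfl rfl rfl
      simp only [S, Finset.mem_filter, Finset.mem_univ, true_and]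
      refine and_congr_right fun _ => ?_
      have := w.2
      omega
  · intro τ _ hτ
    refine hS D 0 _ hτ _ fun w => ?_
    simp only [Finset.mem_erase, Finset.mem_univ, and_true]
    refine (and_iff_left_of_imp fun hw => ?_).symm
    have := hpar.dp_par w hw
    omega

end RAM

/-! ## The reduced tree and its tuples -/

namespace RAM

/-- If the vertex in register `32` and all its ancestors are kept, append it to the list in
array `11`, whose length is in register `31`. -/
def collectVertex : Prog :=
  .assign 33 (.const 1) ;;
  .assign 34 (.reg 32) ;;
  .assign 36 (.sub (.idx 4 (.reg 32)) (.const 1)) ;;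
  forLt 35 36 (.ite (.idx 9 (.reg 34)) .skip (.assign 33 (.const 0)) ;;
    .assign 34 (.idx 5 (.reg 34))) ;;
  .ite (.reg 33) (.store 11 (.reg 31) (.reg 32) ;; .assign 31 (.add (.reg 31) (.const 1))) .skip

/-- List the vertices of the reduced tree. -/
def collect : Prog := forLt 32 2 collectVertex

/-- With `N` the length of the list and `s` the number of variables, write `N ^ i` into cell `i` of
array `12`, for `i < s`, and `N ^ s` into register `40`. -/
def computePowers : Prog :=
  .assign 40 (.const 1) ;;
  forLt 41 14 (.store 12 (.reg 41) (.reg 40) ;; mulBy 43 31 40 42)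

/-- Write an entry of the table of tuples and advance to the next one in the same column. -/
def tupleStep : Prog :=
  .store 13 (.reg 48) (.idx 11 (.reg 46)) ;;
  .assign 48 (.add (.reg 48) (.reg 14)) ;;
  .assign 47 (.add (.reg 47) (.const 1)) ;;
  .ite (.eq (.reg 47) (.reg 45))
    (.assign 47 (.const 0) ;;
      .assign 46 (.add (.reg 46) (.const 1)) ;;
      .ite (.eq (.reg 46) (.reg 31)) (.assign 46 (.const 0)) .skip)
    .skip

/-- Write all tuples of length `s` of vertices of the reduced tree into array `13`. -/
def computeTuples : Prog :=
  forLt 44 14 (.assign 45 (.idx 12 (.reg 44)) ;; .assign 46 (.const 0) ;; .assign 47 (.const 0) ;;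
    .assign 48 (.reg 44) ;; forLt 49 40 tupleStep)

variable {n : ℕ} {σ : State} {dp : Fin n → ℕ} {par : Fin n → Fin n} {K : Finset (Fin n)}

open Classical in
theorem collectVertex_runs {v : Fin n} {D : ℕ} (h4 : σ.mem 4 v = dp v + 1)
    (h5 : ∀ u : Fin n, σ.mem 5 u = par u) (h9 : ∀ u : Fin n, σ.mem 9 u = if u ∈ K then 1 else 0)
    (h32 : σ.reg 32 = v) (hD : dp v ≤ D) :
    Runs collectVertex σ (D * 20 + 40) fun τ =>
      if v ∈ reducedTree dp par K then
        τ.reg 31 = σ.reg 31 + 1 ∧ τ.mem 11 = Function.update (σ.mem 11) (σ.reg 31) v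
      else τ.reg 31 = σ.reg 31 ∧ τ.mem 11 = σ.mem 11 := by
  refine (Runs.seq (t := 2) (Q := fun τ => τ = σ.setReg 33 1) (u := D * 20 + 38)
    (.straight rfl (by decide) (by simp [Prog.run, Expr.eval])) ?_).time_mono (by omega)
  rintro _ - rfl
  refine (Runs.seq (t := 2) (Q := fun τ => τ = (σ.setReg 33 1).setReg 34 v) (u := D * 20 + 36)
    (.straight rfl (by decide) (by simp [Prog.run, Expr.eval, h32])) ?_).time_mono (by omega)
  rintro _ - rfl
  refine (Runs.seq (t := 5) (Q := fun τ => τ = ((σ.setReg 33 1).setReg 34 v).setReg 36 (dp v))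
    (u := D * 20 + 31)
    (.straight rfl (by decide) (by simp [Prog.run, Expr.eval, h32, h4])) ?_).time_mono (by omega)
  rintro _ - rfl
  refine (Runs.seq (t := dp v * (12 + 8) + 6) (u := 12)
    (Runs.forLt (t := 12) (m := dp v) (fun j τ => τ.reg 34 = par^[j] v ∧
      (τ.reg 33 ≠ 0 ↔ ∀ i < j, par^[i] v ∈ K))
    (by simp) (by decide) (by decide) (by simp) ?_) ?_).time_mono (by omega)
  · rintro j hj τ hf - ⟨h34, h33⟩
    refine .straight rfl (by decide) ?_
    have h9' := h9 (par^[j] v)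
    have h5' := h5 (par^[j] v)
    have hm : ∀ a, τ.mem a = σ.mem a := fun a => hf.mem a (by decide +revert)
    rw [← hm] at h9' h5'
    by_cases hK : par^[j] v ∈ K
    · rw [if_pos hK] at h9'
      simp only [Prog.run, Expr.eval, h34, h9', one_ne_zero, if_false, h5', State.setReg_reg,
        Nat.reduceEqDiff, if_true, h33, Function.iterate_succ_apply', true_and]
      refine ⟨fun h i hi => ?_, fun h i hi => h i (by omega)⟩
      rcases Nat.lt_succ_iff_lt_or_eq.1 hi with hi | rfl
      · exact h i hi
      · exact hK
    · rw [if_neg hK] at h9'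
      simp only [Prog.run, Expr.eval, h34, h9', if_true, h5', State.setReg_reg, State.setReg_mem,
        Nat.reduceEqDiff, if_false, Function.iterate_succ_apply', true_and, ne_eq, not_true_eq_false,
        false_iff]
      exact fun h => hK (h j (by omega))
  · rintro τ hf ⟨-, h33⟩
    have hm : ∀ a, τ.mem a = σ.mem a := fun a => hf.mem a (by decide +revert)
    have h31 : τ.reg 31 = σ.reg 31 := by rw [hf.reg 31 (by decide)]; simp
    have h32' : τ.reg 32 = v := by rw [hf.reg 32 (by decide)]; simpa using h32
    refine .straight rfl (by decide) ?_
    by_cases hv : v ∈ reducedTree dp par K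
    · have : τ.reg 33 ≠ 0 := h33.2 hv
      simp [Prog.run, Expr.eval, hv, this, h31, h32', hm]
    · have : τ.reg 33 = 0 := by
        by_contra h
        exact hv (h33.1 h)
      simp [Prog.run, Expr.eval, hv, this, h31, hm]

open Classical in
/-- The list in array `11` enumerates the set `A`. -/
structure HoldsList (A : Set (Fin n)) (τ : State) : Prop where
  mem : ∀ i < τ.reg 31, ∃ v ∈ A, τ.mem 11 i = v
  exists_index : ∀ v ∈ A, ∃ i < τ.reg 31, τ.mem 11 i = v
  card : τ.reg 31 = (Finset.univ.filter (· ∈ A)).card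

theorem HoldsList.of_eq {A : Set (Fin n)} (h : HoldsList A σ) {τ : State}
    (h31 : τ.reg 31 = σ.reg 31) (h11 : τ.mem 11 = σ.mem 11) : HoldsList A τ := by
  obtain ⟨a, b, c⟩ := h
  constructor <;> simpa only [h31, h11]

theorem HoldsList.insert {A : Set (Fin n)} (h : HoldsList A σ) {v : Fin n} (hv : v ∉ A) {τ : State}
    (h31 : τ.reg 31 = σ.reg 31 + 1) (h11 : τ.mem 11 = Function.update (σ.mem 11) (σ.reg 31) v) :
    HoldsList (insert v A) τ where
  mem i hi := by
    rw [h31] at hi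
    rw [h11]
    rcases Nat.lt_succ_iff_lt_or_eq.1 hi with hi | rfl
    · obtain ⟨w, hw, e⟩ := h.mem i hi
      exact ⟨w, .inr hw, by simpa [hi.ne] using e⟩
    · exact ⟨v, .inl rfl, by simp⟩
  exists_index w hw := by
    rw [h31, h11]
    rcases hw with rfl | hw
    · exact ⟨σ.reg 31, by omega, by simp⟩
    · obtain ⟨i, hi, e⟩ := h.exists_index w hw
      exact ⟨i, by omega, by simpa [hi.ne] using e⟩
  card := by
    classical
    rw [h31, h.card, ← Finset.card_insert_of_notMem (a := v) (by simpa using hv)]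
    congr 1
    ext
    simp

open Classical in
theorem collect_runs {D : ℕ} (h2 : σ.reg 2 = n) (h4 : ∀ v : Fin n, σ.mem 4 v = dp v + 1)
    (h5 : ∀ u : Fin n, σ.mem 5 u = par u) (h9 : ∀ u : Fin n, σ.mem 9 u = if u ∈ K then 1 else 0)
    (hD : ∀ v, dp v ≤ D) (h31 : σ.reg 31 = 0) :
    Runs collect σ (n * (D * 20 + 48) + 6) (HoldsList (reducedTree dp par K)) := by
  refine (Runs.forLt (t := D * 20 + 40) (m := n)
    (fun j τ => HoldsList {v | v ∈ reducedTree dp par K ∧ v < j} τ) h2 (by decide) (by decide)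
    ?_ ?_).mono le_rfl ?_
  · constructor <;> simp [h31]
  · intro j hj τ hf h32 hI
    refine (collectVertex_runs (v := ⟨j, hj⟩) (dp := dp) (par := par) (K := K) ?_ ?_ ?_ h32
      (hD _)).mono le_rfl ?_
    · rw [hf.mem 4 (by decide)]; exact h4 _
    · rw [hf.mem 5 (by decide)]; exact h5
    · rw [hf.mem 9 (by decide)]; exact h9
    intro ρ _ hρ
    have hset : {v : Fin n | v ∈ reducedTree dp par K ∧ (v : ℕ) < j + 1} =
        if ⟨j, hj⟩ ∈ reducedTree dp par K then
          insert ⟨j, hj⟩ {v : Fin n | v ∈ reducedTree dp par K ∧ (v : ℕ) < j}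
        else {v : Fin n | v ∈ reducedTree dp par K ∧ (v : ℕ) < j} := by
      split_ifs with hm <;> ext w <;> simp only [Set.mem_ofPred_eq, Set.mem_insert_iff]
      · by_cases hw : w = ⟨j, hj⟩
        · subst hw
          simpa using hm
        · have : (w : ℕ) ≠ j := fun h => hw (Fin.ext h)
          simp only [hw, false_or]
          refine and_congr_right fun _ => ?_
          omega
      · refine and_congr_right fun hw => ?_
        have : (w : ℕ) ≠ j := fun h => hm (by rwa [show w = ⟨j, hj⟩ from Fin.ext h] at hw)
        omega
    rw [hset]
    split_ifs at hρ ⊢ with hm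
    · exact hI.insert (by simp) (by simpa using hρ.1) (by simpa using hρ.2)
    · exact hI.of_eq (by simpa using hρ.1) (by simpa using hρ.2)
  · intro τ _ hτ
    simpa using hτ

theorem computePowers_runs {N s : ℕ} (h31 : σ.reg 31 = N) (h14 : σ.reg 14 = s) :
    Runs computePowers σ (s * (N * 12 + 25) + 10) fun τ =>
      τ.reg 40 = N ^ s ∧ ∀ i < s, τ.mem 12 i = N ^ i := by
  refine (Runs.seq (t := 2) (Q := fun τ => τ = σ.setReg 40 1)
    (u := s * (N * 12 + 17 + 8) + 6)
    (.straight rfl (by decide) (by simp [Prog.run, Expr.eval])) ?_).time_mono (by nlinarith)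
  rintro _ - rfl
  refine (Runs.forLt (t := N * 12 + 17) (m := s)
    (fun j τ => τ.reg 40 = N ^ j ∧ ∀ i < j, τ.mem 12 i = N ^ i) (by simpa using h14) (by decide)
    (by decide) (by simp) ?_).mono le_rfl fun _ _ h => h
  rintro j hj τ hf h41 ⟨h40, h12⟩
  refine (Runs.seq (t := 3) (Q := fun ρ => ρ = τ.setMem 12 j (N ^ j))
    (u := N * 12 + 10)
    (.straight rfl (by decide) (by simp [Prog.run, Expr.eval, h41, h40])) ?_).time_mono (by omega)
  rintro _ - rfl
  refine (mulBy_runs (m := N) ?_ (by decide) (by decide) (by decide) (by decide)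
    (by decide)).mono le_rfl ?_
  · rw [State.setMem_reg, hf.reg 31 (by decide)]; simpa using h31
  · intro ρ hf' h
    rw [State.setMem_reg, h40] at h
    refine ⟨by simp [h, pow_succ], fun i hi => ?_⟩
    rw [State.setReg_mem, hf'.mem 12 (by decide)]
    rcases Nat.lt_succ_iff_lt_or_eq.1 hi with hi | rfl
    · simpa [hi.ne] using h12 i hi
    · simp

/-- The rule of carrying. It lets the quotient and the remainder of a running index be maintained by
counters on a machine without division. -/
theorem succ_div_mod {k W : ℕ} (hW : 0 < W) :
    (k % W + 1 = W → (k + 1) / W = k / W + 1 ∧ (k + 1) % W = 0) ∧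
      (k % W + 1 ≠ W → (k + 1) / W = k / W ∧ (k + 1) % W = k % W + 1) := by
  have h1 := Nat.div_add_mod k W
  have h2 := Nat.mod_lt k hW
  constructor
  · intro h
    refine (Nat.div_mod_unique hW).2 ⟨?_, hW⟩
    rw [Nat.mul_add]
    omega
  · intro h
    exact (Nat.div_mod_unique hW).2 ⟨by omega, by omega⟩

theorem tupleStep_run_mem : (tupleStep.run σ).mem 13 =
    Function.update (σ.mem 13) (σ.reg 48) (σ.mem 11 (σ.reg 46)) := by
  by_cases h1 : σ.reg 47 + 1 = σ.reg 45 <;> by_cases h2 : σ.reg 46 + 1 = σ.reg 31 <;>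
    simp [tupleStep, Prog.run, Expr.eval, h1, h2]

theorem tupleStep_run_reg : (tupleStep.run σ).reg 48 = σ.reg 48 + σ.reg 14 := by
  by_cases h1 : σ.reg 47 + 1 = σ.reg 45 <;> by_cases h2 : σ.reg 46 + 1 = σ.reg 31 <;>
    simp [tupleStep, Prog.run, Expr.eval, h1, h2]

/-- Tuple number `k` has in position `i` the list entry whose index is digit `i` of `k` in base `N`.
Within one column this digit changes in a regular way, which is why the table is filled column by
column. -/
theorem computeTuples_runs {N s : ℕ} (hN : 0 < N) (h31 : σ.reg 31 = N) (h14 : σ.reg 14 = s)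
    (h40 : σ.reg 40 = N ^ s) (h12 : ∀ i < s, σ.mem 12 i = N ^ i) :
    Runs computeTuples σ (s * (N ^ s * 50 + 30) + 6) fun τ =>
      ∀ k < N ^ s, ∀ i < s, τ.mem 13 (i + k * s) = σ.mem 11 (k / N ^ i % N) := by
  refine (Runs.forLt (t := N ^ s * (30 + 8) + 16) (m := s)
    (fun j τ => ∀ k < N ^ s, ∀ i < j, τ.mem 13 (i + k * s) = σ.mem 11 (k / N ^ i % N)) h14
    (by decide) (by decide) (by simp) ?_).mono (by
      have := Nat.pow_pos (n := s) hN
      exact Nat.add_le_add_right (Nat.mul_le_mul_left s (by omega)) 6) fun _ _ h => h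
  intro j hj τ hf h44 hI
  have h12' : τ.mem 12 j = N ^ j := by rw [hf.mem 12 (by decide), h12 j hj]
  have h14' : τ.reg 14 = s := by rw [hf.reg 14 (by decide), h14]
  have h31' : τ.reg 31 = N := by rw [hf.reg 31 (by decide), h31]
  have h40' : τ.reg 40 = N ^ s := by rw [hf.reg 40 (by decide), h40]
  have h11' : τ.mem 11 = σ.mem 11 := hf.mem 11 (by decide)
  have hW : 0 < N ^ j := Nat.pow_pos hN
  refine (Runs.seq (t := 3) (Q := fun ρ => ρ = τ.setReg 45 (N ^ j)) (u := N ^ s * (30 + 8) + 12)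
    (.straight rfl (by decide) (by simp [Prog.run, Expr.eval, h44, h12'])) ?_).time_mono (by omega)
  rintro _ - rfl
  refine (Runs.seq (t := 2) (Q := fun ρ => ρ = (τ.setReg 45 (N ^ j)).setReg 46 0)
    (u := N ^ s * (30 + 8) + 10)
    (.straight rfl (by decide) (by simp [Prog.run, Expr.eval])) ?_).time_mono (by omega)
  rintro _ - rfl
  refine (Runs.seq (t := 2) (Q := fun ρ => ρ = ((τ.setReg 45 (N ^ j)).setReg 46 0).setReg 47 0)
    (u := N ^ s * (30 + 8) + 8)
    (.straight rfl (by decide) (by simp [Prog.run, Expr.eval])) ?_).time_mono (by omega)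
  rintro _ - rfl
  refine (Runs.seq (t := 2) (Q := fun ρ => ρ =
    (((τ.setReg 45 (N ^ j)).setReg 46 0).setReg 47 0).setReg 48 j)
    (u := N ^ s * (30 + 8) + 6)
    (.straight rfl (by decide) (by simp [Prog.run, Expr.eval, h44])) ?_).time_mono (by omega)
  rintro _ - rfl
  refine (Runs.forLt (σ := (((τ.setReg 45 (N ^ j)).setReg 46 0).setReg 47 0).setReg 48 j)
    (i := 49) (N := 40) (p := tupleStep) (t := 30) (m := N ^ s)
    (fun l ρ => ρ.reg 46 = l / N ^ j % N ∧ ρ.reg 47 = l % N ^ j ∧ ρ.reg 48 = j + l * s ∧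
      (∀ k < N ^ s, ∀ i < j, ρ.mem 13 (i + k * s) = σ.mem 11 (k / N ^ i % N)) ∧
      ∀ k < l, ρ.mem 13 (j + k * s) = σ.mem 11 (k / N ^ j % N)) (by simpa using h40')
    (by decide) (by decide) ⟨by simp, by simp, by simp, by simpa using hI, by simp⟩ ?_).mono
    le_rfl ?_
  · rintro l hl ρ hf' h49 ⟨e46, e47, e48, hold, hnew⟩
    have e45 : ρ.reg 45 = N ^ j := by rw [hf'.reg 45 (by decide)]; simp
    have e14 : ρ.reg 14 = s := by rw [hf'.reg 14 (by decide)]; simpa using h14'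
    have e31 : ρ.reg 31 = N := by rw [hf'.reg 31 (by decide)]; simpa using h31'
    have e11 : ρ.mem 11 = σ.mem 11 := by rw [hf'.mem 11 (by decide)]; simpa using h11'
    refine .straight rfl (by decide) ?_
    have hm : ((tupleStep.run ρ).setReg 49 (l + 1)).mem 13 =
        Function.update (ρ.mem 13) (j + l * s) (σ.mem 11 (l / N ^ j % N)) := by
      rw [State.setReg_mem, tupleStep_run_mem, e48, e46, e11]
    have hs := succ_div_mod (k := l) hW
    have hs' := succ_div_mod (k := l / N ^ j) hN
    refine ⟨?_, ?_, ?_, ?_, ?_⟩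
    · by_cases hc : l % N ^ j + 1 = N ^ j
      · rw [(hs.1 hc).1]
        by_cases hc' : l / N ^ j % N + 1 = N
        · simp [tupleStep, Prog.run, Expr.eval, e45, e46, e47, e31, hc, hc', (hs'.1 hc').2]
        · simp [tupleStep, Prog.run, Expr.eval, e45, e46, e47, e31, hc, hc', (hs'.2 hc').2]
      · rw [(hs.2 hc).1]
        simp [tupleStep, Prog.run, Expr.eval, e45, e46, e47, hc]
    · by_cases hc : l % N ^ j + 1 = N ^ j
      · rw [(hs.1 hc).2]
        by_cases hc' : l / N ^ j % N + 1 = N <;>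
          simp [tupleStep, Prog.run, Expr.eval, e45, e46, e47, e31, hc, hc']
      · rw [(hs.2 hc).2]
        simp [tupleStep, Prog.run, Expr.eval, e45, e47, hc]
    · have : ((tupleStep.run ρ).setReg 49 (l + 1)).reg 48 = j + l * s + s := by
        rw [State.setReg_reg, if_neg (by decide), tupleStep_run_reg, e48, e14]
      rw [this]
      ring
    · intro k hk i hi
      rw [hm, Function.update_of_ne, hold k hk i hi]
      rw [Ne, add_mul_inj (by omega) hj]
      omega
    · intro k hk
      rw [hm, Function.update_apply]
      simp only [add_mul_inj hj hj, true_and]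
      split_ifs with h
      · rw [h]
      · exact hnew k (by omega)
  · rintro ρ - ⟨-, -, -, hold, hnew⟩ k hk i hi
    rw [State.setReg_mem]
    rcases Nat.lt_succ_iff_lt_or_eq.1 hi with hi | rfl
    · exact hold k hk i hi
    · exact hnew k hk

end RAM

/-! ## Evaluating the formula on all tuples -/

open Classical in
/-- The number `1` for a true proposition and `0` for a false one. -/
noncomputable def truth (P : Prop) : ℕ := if P then 1 else 0

theorem truth_eq_one {P : Prop} : truth P = 1 ↔ P := by simp [truth]

theorem truth_eq_zero {P : Prop} : truth P = 0 ↔ ¬ P := by simp [truth]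

theorem eq_truth {m : ℕ} {P : Prop} (h1 : P → m = 1) (h0 : ¬ P → m = 0) : m = truth P := by
  by_cases h : P
  · rw [h1 h, truth, if_pos h]
  · rw [h0 h, truth, if_neg h]

/-! ### Prefix notation read from right to left, and tables of assignments -/

section Stack

variable {c : ℕ}

/-- Reading the operator `t` from right to left, with the formulas in `st` on the stack, forms the
formula `φ` and leaves the stack `st'` below it. -/
inductive Tok.Step : Tok c → List (FOFormula c) → FOFormula c → List (FOFormula c) → Prop
  | eq (x y st) : Step (.eq x y) st (.eq x y) st
  | adj (x y st) : Step (.adj x y) st (.adj x y) st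
  | color (i x st) : Step (.color i x) st (.color i x) st
  | not (φ st) : Step .not (φ :: st) φ.not st
  | and (φ ψ st) : Step .and (φ :: ψ :: st) (φ.and ψ) st
  | or (φ ψ st) : Step .or (φ :: ψ :: st) (φ.or ψ) st
  | imp (φ ψ st) : Step .imp (φ :: ψ :: st) (φ.imp ψ) st
  | iff (φ ψ st) : Step .iff (φ :: ψ :: st) (φ.iff ψ) st
  | ex (x φ st) : Step (.ex x) (φ :: st) (.ex x φ) st
  | all (x φ st) : Step (.all x) (φ :: st) (.all x φ) st

/-- Reading the operators in the list turns the stack `st` into `[θ]`. -/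
def Tok.Finishes (θ : FOFormula c) : List (Tok c) → List (FOFormula c) → Prop
  | [], st => st = [θ]
  | t :: ts, st => ∃ φ st', t.Step st φ st' ∧ Finishes θ ts (φ :: st')

/-- Read backwards, prefix notation is postfix: when an operator is met, its operands are on the
stack, the first one on top. The induction needs arbitrary remaining operators `ts` and an arbitrary
stack `st` below. -/
theorem FOFormula.finishes_append (θ φ : FOFormula c) (ts : List (Tok c))
    (st : List (FOFormula c)) (h : Tok.Finishes θ ts (φ :: st)) :
    Tok.Finishes θ (φ.toks.reverse ++ ts) st := by
  induction φ generalizing ts st with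
  | eq x y => exact ⟨_, _, .eq x y st, h⟩
  | adj x y => exact ⟨_, _, .adj x y st, h⟩
  | color i x => exact ⟨_, _, .color i x st, h⟩
  | not φ ih => simpa [toks] using ih (.not :: ts) st ⟨_, _, .not φ st, h⟩
  | and φ ψ ih ih' =>
    simpa [toks] using ih' (φ.toks.reverse ++ .and :: ts) st (ih (.and :: ts) (ψ :: st)
      ⟨_, _, .and φ ψ st, h⟩)
  | or φ ψ ih ih' =>
    simpa [toks] using ih' (φ.toks.reverse ++ .or :: ts) st (ih (.or :: ts) (ψ :: st)
      ⟨_, _, .or φ ψ st, h⟩)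
  | imp φ ψ ih ih' =>
    simpa [toks] using ih' (φ.toks.reverse ++ .imp :: ts) st (ih (.imp :: ts) (ψ :: st)
      ⟨_, _, .imp φ ψ st, h⟩)
  | iff φ ψ ih ih' =>
    simpa [toks] using ih' (φ.toks.reverse ++ .iff :: ts) st (ih (.iff :: ts) (ψ :: st)
      ⟨_, _, .iff φ ψ st, h⟩)
  | ex x φ ih => simpa [toks] using ih (.ex x :: ts) st ⟨_, _, .ex x φ st, h⟩
  | all x φ ih => simpa [toks] using ih (.all x :: ts) st ⟨_, _, .all x φ st, h⟩

theorem FOFormula.finishes (θ : FOFormula c) : Tok.Finishes θ θ.toks.reverse [] := by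
  simpa using θ.finishes_append θ [] [] rfl

/-- The array `m` contains the truth tables, of `M` entries each, of the formulas on the stack, for
the assignments `asg k` with `k < M`. -/
def StackHolds {V : Type} (G : SimpleGraph V) (col : V → Fin c) (A : Set V) (M : ℕ)
    (asg : ℕ → ℕ → V) : List (FOFormula c) → (ℕ → ℕ) → Prop
  | [], _ => True
  | φ :: st, m => (∀ k < M, m (k + st.length * M) = truth (φ.SatOn G col A (asg k))) ∧
      StackHolds G col A M asg st m

theorem StackHolds.of_eq {V : Type} {G : SimpleGraph V} {col : V → Fin c} {A : Set V} {M : ℕ}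
    {asg : ℕ → ℕ → V} {st : List (FOFormula c)} {m m' : ℕ → ℕ} (h : StackHolds G col A M asg st m)
    (hm : ∀ i < st.length * M, m' i = m i) : StackHolds G col A M asg st m' := by
  induction st with
  | nil => trivial
  | cons φ st ih =>
    have e : (φ :: st).length * M = st.length * M + M := by rw [List.length_cons, Nat.succ_mul]
    exact ⟨fun k hk => by rw [hm _ (by omega)]; exact h.1 k hk, ih h.2 fun i hi => hm i (by omega)⟩

/-- The array `tab` contains in rows of length `s` the values of the assignments `asg k`, for
`k < M`, at the variables in `X`; these are all assignments into `A`. -/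
structure IsTable {V : Type} (X : Finset ℕ) (A : Set V) (M s : ℕ) (num : ℕ → ℕ)
    (asg : ℕ → ℕ → V) (code : V → ℕ) (tab : ℕ → ℕ) : Prop where
  tab_eq : ∀ k < M, ∀ x ∈ X, tab (num x + k * s) = code (asg k x)
  asg_mem : ∀ k x, asg k x ∈ A
  agree : ∀ k < M, ∀ l < M, ∀ x ∈ X, (∀ i < s, i ≠ num x → tab (i + k * s) = tab (i + l * s)) →
    asg l = Function.update (asg k) x (asg l x)
  exists_agree : ∀ k < M, ∀ x ∈ X, ∀ a ∈ A, ∃ l < M,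
    (∀ i < s, i ≠ num x → tab (i + k * s) = tab (i + l * s)) ∧ asg l = Function.update (asg k) x a
  exhaustive : ∀ v : ℕ → V, (∀ x, v x ∈ A) → ∃ k < M, ∀ x ∈ X, v x = asg k x

/-- A quantifier over `x` becomes a search through the rows that agree with row `k` outside the
column of `x`. All tables are indexed by the same assignments, so scopes and requantified names play
no role. -/
theorem IsTable.exists_iff {V : Type} {X : Finset ℕ} {A : Set V} {M s : ℕ} {num : ℕ → ℕ}
    {asg : ℕ → ℕ → V} {code : V → ℕ} {tab : ℕ → ℕ} (h : IsTable X A M s num asg code tab) {k : ℕ}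
    (hk : k < M) {x : ℕ} (hx : x ∈ X) (P : (ℕ → V) → Prop) :
    (∃ l < M, (∀ i < s, i ≠ num x → tab (i + k * s) = tab (i + l * s)) ∧ P (asg l)) ↔
      ∃ a ∈ A, P (Function.update (asg k) x a) := by
  constructor
  · rintro ⟨l, hl, hag, hP⟩
    refine ⟨asg l x, h.asg_mem l x, ?_⟩
    rwa [← h.agree k hk l hl x hx hag]
  · rintro ⟨a, ha, hP⟩
    obtain ⟨l, hl, hag, e⟩ := h.exists_agree k hk x hx a ha
    exact ⟨l, hl, hag, e ▸ hP⟩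

end Stack

/-! ### Single entries of truth tables -/

namespace RAM

/-- The truth value of an atomic formula at the tuple that starts in cell `58` of array `13`. The
operator is in register `52`, the numbers of its variables are in the registers `53` and `54`, and
the color is in register `55`. -/
def evalAtom : Prog :=
  .ite (.eq (.reg 52) (.const 0))
    (.assign 60 (.eq (.idx 13 (.add (.reg 53) (.reg 58))) (.idx 13 (.add (.reg 54) (.reg 58)))))
    (.ite (.eq (.reg 52) (.const 1))
      (.ite (.eq (.idx 13 (.add (.reg 53) (.reg 58))) (.idx 13 (.add (.reg 54) (.reg 58))))
        (.assign 60 (.const 0))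
        (.assign 60 (.lt (.const 0) (.add
          (.eq (.idx 5 (.idx 13 (.add (.reg 53) (.reg 58)))) (.idx 13 (.add (.reg 54) (.reg 58))))
          (.eq (.idx 5 (.idx 13 (.add (.reg 54) (.reg 58))))
            (.idx 13 (.add (.reg 53) (.reg 58))))))))
      (.assign 60 (.eq (.idx 0 (.add (.idx 13 (.add (.reg 54) (.reg 58))) (.const 1)))
        (.reg 55))))

/-- The entry number `59` of the truth table of a boolean combination of the formulas whose truth
tables start in the cells `66` and `67` of array `14`. -/
def evalConnective : Prog :=
  .ite (.eq (.reg 52) (.const 3))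
    (.assign 60 (.eq (.idx 14 (.add (.reg 59) (.reg 66))) (.const 0)))
    (.ite (.eq (.reg 52) (.const 4))
      (.assign 60 (.lt (.const 1) (.add (.idx 14 (.add (.reg 59) (.reg 66)))
        (.idx 14 (.add (.reg 59) (.reg 67))))))
      (.ite (.eq (.reg 52) (.const 5))
        (.assign 60 (.lt (.const 0) (.add (.idx 14 (.add (.reg 59) (.reg 66)))
          (.idx 14 (.add (.reg 59) (.reg 67))))))
        (.ite (.eq (.reg 52) (.const 6))
          (.assign 60 (.lt (.idx 14 (.add (.reg 59) (.reg 66)))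
            (.add (.idx 14 (.add (.reg 59) (.reg 67))) (.const 1))))
          (.assign 60 (.eq (.idx 14 (.add (.reg 59) (.reg 66)))
            (.idx 14 (.add (.reg 59) (.reg 67))))))))

/-- Set register `63` to `1` if the tuples that start in the cells `58` and `62` of array `13` agree
everywhere except possibly at the position in register `53`, and to `0` otherwise. -/
def compareTuples : Prog :=
  .assign 63 (.const 1) ;;
  forLt 64 14 (.ite (.eq (.reg 64) (.reg 53)) .skip
    (.ite (.eq (.idx 13 (.add (.reg 64) (.reg 58))) (.idx 13 (.add (.reg 64) (.reg 62)))) .skip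
      (.assign 63 (.const 0))))

/-- The truth value of a quantified formula at the tuple that starts in cell `58` of array `13`: the
value in register `65`, which is `1` for an existential and `0` for a universal quantifier, if the
formula in its scope has this value at some tuple that agrees with the given one except possibly at
the position in register `53`. -/
def evalQuantifier : Prog :=
  .assign 65 (.sub (.const 9) (.reg 52)) ;;
  .assign 60 (.sub (.const 1) (.reg 65)) ;;
  .assign 62 (.const 0) ;;
  forLt 61 40 (compareTuples ;;
    .ite (.reg 63) (.ite (.eq (.idx 14 (.add (.reg 61) (.reg 66))) (.reg 65))
      (.assign 60 (.reg 65)) .skip) .skip ;;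
    .assign 62 (.add (.reg 62) (.reg 14)))

/-- The entry number `59` of the truth table of the formula formed by the operator in
register `52`. -/
def evalEntry : Prog :=
  .ite (.lt (.reg 52) (.const 3)) evalAtom
    (.ite (.lt (.reg 52) (.const 8)) evalConnective evalQuantifier)

variable {n : ℕ} {σ : State}

theorem compareTuples_runs {s k l x : ℕ} (h14 : σ.reg 14 = s) (h58 : σ.reg 58 = k * s)
    (h62 : σ.reg 62 = l * s) (h53 : σ.reg 53 = x) :
    Runs compareTuples σ (s * 30 + 10) fun τ => τ.reg 63 = truth (∀ i < s, i ≠ x →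
      σ.mem 13 (i + k * s) = σ.mem 13 (i + l * s)) := by
  refine (Runs.seq (t := 2) (Q := fun τ => τ = σ.setReg 63 1) (u := s * (22 + 8) + 6)
    (.straight rfl (by decide) (by simp [Prog.run, Expr.eval])) ?_).time_mono (by omega)
  rintro _ - rfl
  refine (Runs.forLt (σ := σ.setReg 63 1) (t := 22) (m := s)
    (fun j τ => τ.reg 63 = truth (∀ i < j, i ≠ x →
      σ.mem 13 (i + k * s) = σ.mem 13 (i + l * s))) (by simpa using h14)
    (by decide) (by decide) (by simp [truth]) ?_).mono le_rfl fun _ _ h => h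
  intro j hj τ hf hr hI
  have e58 : τ.reg 58 = k * s := by rw [hf.reg 58 (by decide)]; simpa using h58
  have e62 : τ.reg 62 = l * s := by rw [hf.reg 62 (by decide)]; simpa using h62
  have e53 : τ.reg 53 = x := by rw [hf.reg 53 (by decide)]; simpa using h53
  have e13 : τ.mem 13 = σ.mem 13 := hf.mem 13 (by decide)
  refine .straight rfl (by decide) ?_
  have hsucc : (∀ i < j + 1, i ≠ x → σ.mem 13 (i + k * s) = σ.mem 13 (i + l * s)) ↔
      (∀ i < j, i ≠ x → σ.mem 13 (i + k * s) = σ.mem 13 (i + l * s)) ∧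
        (j ≠ x → σ.mem 13 (j + k * s) = σ.mem 13 (j + l * s)) := by
    constructor
    · exact fun h => ⟨fun i hi => h i (by omega), h j (by omega)⟩
    · rintro ⟨h1, h2⟩ i hi
      rcases Nat.lt_succ_iff_lt_or_eq.1 hi with hi | rfl
      · exact h1 i hi
      · exact h2
  by_cases hx : j = x
  · rw [hsucc]
    simp [Prog.run, Expr.eval, hr, e53, hx, hI]
  · by_cases he : σ.mem 13 (j + k * s) = σ.mem 13 (j + l * s)
    · simp only [Prog.run, Expr.eval, hr, e53, hx, if_false, if_true, e13, e58, e62, he,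
        one_ne_zero, State.setReg_reg, Nat.reduceEqDiff, hI]
      congr 1
      rw [eq_iff_iff, hsucc]
      simp [he]
    · simp only [Prog.run, Expr.eval, hr, e53, hx, if_false, if_true, e13, e58, e62, he,
        State.setReg_reg, Nat.reduceEqDiff]
      rw [eq_comm, truth_eq_zero, hsucc]
      simp [he, hx]

theorem evalQuantifier_runs {s M k x e : ℕ} (h14 : σ.reg 14 = s) (h40 : σ.reg 40 = M)
    (h58 : σ.reg 58 = k * s) (h53 : σ.reg 53 = x) (h52 : 9 - σ.reg 52 = e) :
    Runs evalQuantifier σ (M * (s * 30 + 60) + 30) fun τ =>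
      (τ.reg 60 = e ∧ ∃ l < M, (∀ i < s, i ≠ x → σ.mem 13 (i + k * s) = σ.mem 13 (i + l * s)) ∧
        σ.mem 14 (l + σ.reg 66) = e) ∨
      (τ.reg 60 = 1 - e ∧ ¬ ∃ l < M,
        (∀ i < s, i ≠ x → σ.mem 13 (i + k * s) = σ.mem 13 (i + l * s)) ∧
        σ.mem 14 (l + σ.reg 66) = e) := by
  refine (Runs.seq (t := 4) (Q := fun τ => τ = σ.setReg 65 e) (u := M * (s * 30 + 60) + 20)
    (.straight rfl (by decide) (by simp [Prog.run, Expr.eval, h52])) ?_).time_mono (by omega)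
  rintro _ - rfl
  refine (Runs.seq (t := 4) (Q := fun τ => τ = (σ.setReg 65 e).setReg 60 (1 - e))
    (u := M * (s * 30 + 60) + 16)
    (.straight rfl (by decide) (by simp [Prog.run, Expr.eval])) ?_).time_mono (by omega)
  rintro _ - rfl
  refine (Runs.seq (t := 2) (Q := fun τ => τ = ((σ.setReg 65 e).setReg 60 (1 - e)).setReg 62 0)
    (u := M * (s * 30 + 40 + 8) + 6)
    (.straight rfl (by decide) (by simp [Prog.run, Expr.eval])) ?_).time_mono (by nlinarith)
  rintro _ - rfl
  set σ' := ((σ.setReg 65 e).setReg 60 (1 - e)).setReg 62 0 with hσ'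
  let P : ℕ → Prop := fun l =>
    (∀ i < s, i ≠ x → σ.mem 13 (i + k * s) = σ.mem 13 (i + l * s)) ∧ σ.mem 14 (l + σ.reg 66) = e
  refine (Runs.forLt (σ := σ') (t := s * 30 + 40) (m := M)
    (fun j τ => τ.reg 62 = j * s ∧ ((τ.reg 60 = e ∧ ∃ l < j, P l) ∨
      (τ.reg 60 = 1 - e ∧ ¬ ∃ l < j, P l))) (by simpa [σ'] using h40)
    (by decide) (by decide) (by simp [σ']) ?_).mono le_rfl fun _ _ h => h.2
  rintro j hj τ hf hr ⟨h62, hI⟩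
  have e58 : τ.reg 58 = k * s := by rw [hf.reg 58 (by decide)]; simpa [σ'] using h58
  have e53 : τ.reg 53 = x := by rw [hf.reg 53 (by decide)]; simpa [σ'] using h53
  have e14 : τ.reg 14 = s := by rw [hf.reg 14 (by decide)]; simpa [σ'] using h14
  have e65 : τ.reg 65 = e := by rw [hf.reg 65 (by decide)]; simp [σ']
  have e66 : τ.reg 66 = σ.reg 66 := by rw [hf.reg 66 (by decide)]; simp [σ']
  have em : ∀ a, τ.mem a = σ.mem a := fun a => hf.mem a (by decide +revert)
  refine (Runs.seq (u := 30) (compareTuples_runs e14 e58 h62 e53) ?_).time_mono (by omega)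
  intro ρ hf' h63
  rw [em] at h63
  have e61' : ρ.reg 61 = j := by rw [hf'.reg 61 (by decide), hr]
  have e62' : ρ.reg 62 = j * s := by rw [hf'.reg 62 (by decide), h62]
  have e14' : ρ.reg 14 = s := by rw [hf'.reg 14 (by decide), e14]
  have e65' : ρ.reg 65 = e := by rw [hf'.reg 65 (by decide), e65]
  have e66' : ρ.reg 66 = σ.reg 66 := by rw [hf'.reg 66 (by decide), e66]
  have e60' : ρ.reg 60 = τ.reg 60 := hf'.reg 60 (by decide)
  have em' : ∀ a, ρ.mem a = σ.mem a := fun a => (hf'.mem a (by decide +revert)).trans (em a)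
  have hsucc : (∃ l < j + 1, P l) ↔ (∃ l < j, P l) ∨ P j := by
    constructor
    · rintro ⟨l, hl, h⟩
      rcases Nat.lt_succ_iff_lt_or_eq.1 hl with hl | rfl
      · exact .inl ⟨l, hl, h⟩
      · exact .inr h
    · rintro (⟨l, hl, h⟩ | h)
      · exact ⟨l, by omega, h⟩
      · exact ⟨j, by omega, h⟩
  refine .straight rfl (by decide) ?_
  rw [hsucc]
  by_cases hP : P j
  · rw [truth, if_pos hP.1] at h63
    have h14 : σ.mem 14 (j + σ.reg 66) = e := hP.2
    simp [Prog.run, Expr.eval, h63, em', e61', e66', e65', e62', e14', hP, h14]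
    ring
  · have hrun : ∀ ρ' : State, ρ'.reg 60 = τ.reg 60 → ((ρ'.reg 60 = e ∧ ((∃ l < j, P l) ∨ P j)) ∨
        (ρ'.reg 60 = 1 - e ∧ ¬ ((∃ l < j, P l) ∨ P j))) := by
      intro ρ' h
      rw [h]
      simpa [hP] using hI
    by_cases hag : ∀ i < s, i ≠ x → σ.mem 13 (i + k * s) = σ.mem 13 (i + j * s)
    · have h14 : ¬ σ.mem 14 (j + σ.reg 66) = e := fun h => hP ⟨hag, h⟩
      rw [truth, if_pos hag] at h63
      refine ⟨?_, hrun _ ?_⟩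
      · simp [Prog.run, Expr.eval, h63, em', e61', e66', e65', e62', e14', h14]
        ring
      · simp [Prog.run, Expr.eval, h63, em', e61', e66', e65', e60', h14]
    · rw [truth, if_neg hag] at h63
      refine ⟨?_, hrun _ ?_⟩
      · simp [Prog.run, Expr.eval, h63, e62', e14']
        ring
      · simp [Prog.run, Expr.eval, h63, e60']

end RAM

namespace RAM

variable {n c : ℕ} {σ : State} {G : SimpleGraph (Fin n)} {col : Fin n → Fin c}
  {par : Fin n → Fin n} {A : Set (Fin n)} {M s : ℕ} {asg : ℕ → ℕ → Fin n} {X : Finset ℕ}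

/-- The part of the memory that the evaluation reads only. -/
structure EvalCtx (col : Fin n → Fin c) (par : Fin n → Fin n) (A : Set (Fin n)) (M s : ℕ)
    (asg : ℕ → ℕ → Fin n) (X : Finset ℕ) (σ : State) : Prop where
  width : σ.reg 14 = s
  size : σ.reg 40 = M
  parent : ∀ v : Fin n, σ.mem 5 v = par v
  color : ∀ v : Fin n, σ.mem 0 (v + 1) = col v
  table : IsTable X A M s (fun x => σ.mem 6 x - 1) asg (fun v => (v : ℕ)) (σ.mem 13)

theorem EvalCtx.of_frame (h : EvalCtx col par A M s asg X σ) {p : Prog} {τ : State}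
    (hf : Frame p σ τ) (h14 : 14 ∉ p.regs) (h40 : 40 ∉ p.regs) (h0 : 0 ∉ p.arrs)
    (h5 : 5 ∉ p.arrs) (h6 : 6 ∉ p.arrs) (h13 : 13 ∉ p.arrs) : EvalCtx col par A M s asg X τ where
  width := (hf.reg 14 h14).trans h.width
  size := (hf.reg 40 h40).trans h.size
  parent := by rw [hf.mem 5 h5]; exact h.parent
  color := by rw [hf.mem 0 h0]; exact h.color
  table := by rw [hf.mem 6 h6, hf.mem 13 h13]; exact h.table

/-- The registers contain the operator, the numbers of its variables and its color. -/
def Loaded (t : Tok c) (σ : State) : Prop :=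
  match t with
  | .eq x y => σ.reg 52 = 0 ∧ σ.reg 53 = σ.mem 6 x - 1 ∧ σ.reg 54 = σ.mem 6 y - 1
  | .adj x y => σ.reg 52 = 1 ∧ σ.reg 53 = σ.mem 6 x - 1 ∧ σ.reg 54 = σ.mem 6 y - 1
  | .color i x => σ.reg 52 = 2 ∧ σ.reg 54 = σ.mem 6 x - 1 ∧ σ.reg 55 = i
  | .not => σ.reg 52 = 3
  | .and => σ.reg 52 = 4
  | .or => σ.reg 52 = 5
  | .imp => σ.reg 52 = 6
  | .iff => σ.reg 52 = 7
  | .ex x => σ.reg 52 = 8 ∧ σ.reg 53 = σ.mem 6 x - 1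
  | .all x => σ.reg 52 = 9 ∧ σ.reg 53 = σ.mem 6 x - 1

theorem Loaded.of_frame {t : Tok c} (h : Loaded t σ) {p : Prog} {τ : State} (hf : Frame p σ τ)
    (h52 : 52 ∉ p.regs) (h53 : 53 ∉ p.regs) (h54 : 54 ∉ p.regs) (h55 : 55 ∉ p.regs)
    (h6 : 6 ∉ p.arrs) : Loaded t τ := by
  cases t <;> simpa only [Loaded, hf.reg 52 h52, hf.reg 53 h53, hf.reg 54 h54, hf.reg 55 h55,
    hf.mem 6 h6] using h

theorem evalConnective_runs {k a b : ℕ} (P Q : Prop)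
    (ha : σ.reg 59 + σ.reg 66 = a) (hb : σ.reg 59 + σ.reg 67 = b) (hP : σ.mem 14 a = truth P)
    (hQ : σ.reg 52 ≠ 3 → σ.mem 14 b = truth Q) (hk : σ.reg 52 = k) :
    Runs evalConnective σ 50 fun τ => τ.reg 60 = truth
      (if k = 3 then ¬ P else if k = 4 then P ∧ Q else if k = 5 then P ∨ Q else
        if k = 6 then P → Q else (P ↔ Q)) := by
  refine .straight rfl (by decide) ?_
  by_cases h3 : k = 3
  · by_cases hp : P <;> simp [evalConnective, Prog.run, Expr.eval, hk, h3, ha, hP, hp, truth]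
  · have hQ := hQ (hk ▸ h3)
    by_cases h4 : k = 4
    · by_cases hp : P <;> by_cases hq : Q <;>
        simp [evalConnective, Prog.run, Expr.eval, hk, h4, ha, hb, hP, hQ, hp, hq, truth]
    by_cases h5 : k = 5
    · by_cases hp : P <;> by_cases hq : Q <;>
        simp [evalConnective, Prog.run, Expr.eval, hk, h5, ha, hb, hP, hQ, hp, hq, truth]
    by_cases h6 : k = 6
    · by_cases hp : P <;> by_cases hq : Q <;>
        simp [evalConnective, Prog.run, Expr.eval, hk, h6, ha, hb, hP, hQ, hp, hq, truth]
    · by_cases hp : P <;> by_cases hq : Q <;>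
        simp [evalConnective, Prog.run, Expr.eval, hk, h3, h4, h5, h6, ha, hb, hP, hQ, hp, hq,
          truth]

/-- The time is that of a quantifier, which visits all `M` tuples and compares `s` entries of each;
atoms and connectives take constant time. -/
theorem evalEntry_runs (hG : ∀ u v, G.Adj u v ↔ u ≠ v ∧ (par u = v ∨ par v = u))
    (hctx : EvalCtx col par A M s asg X σ) {t : Tok c} {φ : FOFormula c}
    {st st' : List (FOFormula c)} (ht : t.Step st φ st') (hX : t.vars ⊆ X) (hl : Loaded t σ)
    (hst : StackHolds G col A M asg st (σ.mem 14)) {k : ℕ} (hk : k < M) (h58 : σ.reg 58 = k * s)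
    (h59 : σ.reg 59 = k) (h66 : σ.reg 66 = st.length * M - M)
    (h67 : σ.reg 67 = st.length * M - M - M) :
    Runs evalEntry σ (M * (s * 30 + 60) + 70)
      fun τ => τ.reg 60 = truth (φ.SatOn G col A (asg k)) := by
  have htab := hctx.table.tab_eq k hk
  have atom : ∀ Q : State → Prop, σ.reg 52 < 3 → Q (evalAtom.run σ) →
      Runs evalEntry σ (M * (s * 30 + 60) + 70) Q := by
    intro Q h52 h
    refine (Runs.ite (t := 60) (fun _ => .straight rfl (by decide) h) fun he => ?_).time_mono (by
      simp only [Expr.cost]; omega)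
    simp [Expr.eval, h52] at he
  have conn : ∀ Q : State → Prop, 3 ≤ σ.reg 52 → σ.reg 52 < 8 → Runs evalConnective σ 50 Q →
      Runs evalEntry σ (M * (s * 30 + 60) + 70) Q := by
    intro Q h52 h52' h
    refine (Runs.ite (t := M * (s * 30 + 60) + 66) (fun he => ?_) fun _ => ?_).time_mono (by
      simp only [Expr.cost]; omega)
    · simp [Expr.eval, show ¬ σ.reg 52 < 3 by omega] at he
    · refine (Runs.ite (t := 50) (fun _ => h) fun he => ?_).time_mono (by
        simp only [Expr.cost]; omega)
      simp [Expr.eval, h52'] at he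
  have quant : ∀ Q : State → Prop, 8 ≤ σ.reg 52 →
      Runs evalQuantifier σ (M * (s * 30 + 60) + 30) Q →
      Runs evalEntry σ (M * (s * 30 + 60) + 70) Q := by
    intro Q h52 h
    refine (Runs.ite (t := M * (s * 30 + 60) + 66) (fun he => ?_) fun _ => ?_).time_mono (by
      simp only [Expr.cost]; omega)
    · simp [Expr.eval, show ¬ σ.reg 52 < 3 by omega] at he
    · refine (Runs.ite (t := M * (s * 30 + 60) + 30) (fun he => ?_) fun _ => h).time_mono (by
        simp only [Expr.cost]; omega)
      simp [Expr.eval, show ¬ σ.reg 52 < 8 by omega] at he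
  have one : ∀ (φ : FOFormula c) (st : List (FOFormula c)),
      (φ :: st).length * M - M = st.length * M := by
    intro φ st
    rw [List.length_cons, Nat.succ_mul, Nat.add_sub_cancel]
  have unary : ∀ k' (φ : FOFormula c) (st : List (FOFormula c)),
      σ.reg 66 = (φ :: st).length * M - M → StackHolds G col A M asg (φ :: st) (σ.mem 14) →
      k' < M → σ.mem 14 (k' + σ.reg 66) = truth (φ.SatOn G col A (asg k')) := by
    intro k' φ st h66 hst hk
    rw [h66, one]
    exact hst.1 k' hk
  have binary : ∀ (φ ψ : FOFormula c) (st : List (FOFormula c)), 4 ≤ σ.reg 52 → σ.reg 52 < 8 →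
      σ.reg 66 = (φ :: ψ :: st).length * M - M → σ.reg 67 = (φ :: ψ :: st).length * M - M - M →
      StackHolds G col A M asg (φ :: ψ :: st) (σ.mem 14) →
      Runs evalEntry σ (M * (s * 30 + 60) + 70) fun τ => τ.reg 60 = truth
        (if σ.reg 52 = 3 then ¬ φ.SatOn G col A (asg k) else
          if σ.reg 52 = 4 then φ.SatOn G col A (asg k) ∧ ψ.SatOn G col A (asg k) else
          if σ.reg 52 = 5 then φ.SatOn G col A (asg k) ∨ ψ.SatOn G col A (asg k) else
          if σ.reg 52 = 6 then φ.SatOn G col A (asg k) → ψ.SatOn G col A (asg k) else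
          (φ.SatOn G col A (asg k) ↔ ψ.SatOn G col A (asg k))) := by
    intro φ ψ st h4 h8 h66 h67 hst
    refine conn _ (by omega) h8 (evalConnective_runs (a := k + σ.reg 66) (b := k + σ.reg 67) _ _
      (by rw [h59]) (by rw [h59]) (unary k φ _ h66 hst hk) (fun _ => ?_) rfl)
    rw [h67, one, one]
    exact hst.2.1 k hk
  cases ht with
  | eq x y =>
    obtain ⟨h52, h53, h54⟩ := hl
    have hx := htab x (hX (by simp [Tok.vars]))
    have hy := htab y (hX (by simp [Tok.vars]))
    refine atom _ (by omega) ?_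
    simp only [evalAtom, Prog.run, Expr.eval, h52, h53, h54, h58, hx, hy, if_true, one_ne_zero,
      if_false, State.setReg_reg]
    exact eq_truth (fun h => if_pos (congrArg Fin.val h)) fun h => if_neg fun h' => h (Fin.ext h')
  | adj x y =>
    obtain ⟨h52, h53, h54⟩ := hl
    have hx := htab x (hX (by simp [Tok.vars]))
    have hy := htab y (hX (by simp [Tok.vars]))
    refine atom _ (by omega) ?_
    simp only [FOFormula.SatOn, hG]
    by_cases he : asg k x = asg k y
    · simp [evalAtom, Prog.run, Expr.eval, h52, h53, h54, h58, hx, hy, he, truth]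
    · have he' : (asg k x : ℕ) ≠ asg k y := fun h => he (Fin.ext h)
      simp only [evalAtom, Prog.run, Expr.eval, h52, h53, h54, h58, hx, hy, if_true, one_ne_zero,
        if_false, State.setReg_reg, he', hctx.parent, Fin.val_inj]
      by_cases h1 : par (asg k x) = asg k y <;> by_cases h2 : par (asg k y) = asg k x <;>
        simp [h1, h2, he, truth]
  | color i x =>
    obtain ⟨h52, h54, h55⟩ := hl
    have hx := htab x (hX (by simp [Tok.vars]))
    refine atom _ (by omega) ?_
    simp only [evalAtom, Prog.run, Expr.eval, h52, h54, h55, h58, hx, hctx.color, if_true,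
      OfNat.ofNat_ne_zero, OfNat.ofNat_ne_one, if_false, State.setReg_reg]
    exact eq_truth (fun h => if_pos (congrArg Fin.val h)) fun h => if_neg fun h' => h (Fin.ext h')
  | not φ st =>
    have h52 : σ.reg 52 = 3 := hl
    -- A negation has no second operand; `True` fills its place, and the condition on it is void for
    -- operator 3.
    refine (conn _ h52.ge (by omega) (evalConnective_runs (a := k + σ.reg 66) _ True (by rw [h59])
      rfl (unary k φ _ h66 hst hk) (fun h => absurd h52 h) h52)).mono le_rfl fun τ _ h => ?_
    simpa [FOFormula.SatOn] using h
  | and φ ψ st =>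
    have h52 : σ.reg 52 = 4 := hl
    refine (binary φ ψ _ h52.ge (by omega) h66 h67 hst).mono le_rfl fun τ _ h => ?_
    simpa [h52, FOFormula.SatOn] using h
  | or φ ψ st =>
    have h52 : σ.reg 52 = 5 := hl
    refine (binary φ ψ _ (by omega) (by omega) h66 h67 hst).mono le_rfl fun τ _ h => ?_
    simpa [h52, FOFormula.SatOn] using h
  | imp φ ψ st =>
    have h52 : σ.reg 52 = 6 := hl
    refine (binary φ ψ _ (by omega) (by omega) h66 h67 hst).mono le_rfl fun τ _ h => ?_
    simpa [h52, FOFormula.SatOn] using h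
  | iff φ ψ st =>
    have h52 : σ.reg 52 = 7 := hl
    refine (binary φ ψ _ (by omega) (by omega) h66 h67 hst).mono le_rfl fun τ _ h => ?_
    simpa [h52, FOFormula.SatOn] using h
  | ex x φ st =>
    obtain ⟨h52, h53⟩ := hl
    have hx : x ∈ X := hX (by simp [Tok.vars])
    refine (quant _ h52.ge (evalQuantifier_runs (e := 1) hctx.width hctx.size h58 h53
      (by rw [h52]))).mono le_rfl fun τ _ h => ?_
    have hiff := hctx.table.exists_iff hk hx (φ.SatOn G col A)
    have hun : ∀ l, l < M → (σ.mem 14 (l + σ.reg 66) = 1 ↔ φ.SatOn G col A (asg l)) :=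
      fun l hl => by rw [unary l φ _ h66 hst hl, truth_eq_one]
    have hiff' : (∃ l < M, (∀ i < s, i ≠ σ.mem 6 x - 1 →
        σ.mem 13 (i + k * s) = σ.mem 13 (i + l * s)) ∧ σ.mem 14 (l + σ.reg 66) = 1) ↔
        (FOFormula.ex x φ).SatOn G col A (asg k) := by
      rw [FOFormula.SatOn, ← hiff]
      exact exists_congr fun l => and_congr_right fun hl => and_congr_right fun _ => hun l hl
    rw [hiff'] at h
    rcases h with ⟨h1, h2⟩ | ⟨h1, h2⟩
    · exact eq_truth (fun _ => h1) fun h => absurd h2 h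
    · exact eq_truth (fun h => absurd h h2) fun _ => h1
  | all x φ st =>
    obtain ⟨h52, h53⟩ := hl
    have hx : x ∈ X := hX (by simp [Tok.vars])
    refine (quant _ (by omega) (evalQuantifier_runs (e := 0) hctx.width hctx.size h58 h53
      (by rw [h52]))).mono le_rfl fun τ _ h => ?_
    have hiff := hctx.table.exists_iff hk hx fun v => ¬ φ.SatOn G col A v
    have hun : ∀ l, l < M → (σ.mem 14 (l + σ.reg 66) = 0 ↔ ¬ φ.SatOn G col A (asg l)) :=
      fun l hl => by rw [unary l φ _ h66 hst hl, truth_eq_zero]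
    have hiff' : (∃ l < M, (∀ i < s, i ≠ σ.mem 6 x - 1 →
        σ.mem 13 (i + k * s) = σ.mem 13 (i + l * s)) ∧ σ.mem 14 (l + σ.reg 66) = 0) ↔
        ¬ (FOFormula.all x φ).SatOn G col A (asg k) := by
      rw [FOFormula.SatOn]
      push Not
      rw [← hiff]
      exact exists_congr fun l => and_congr_right fun hl => and_congr_right fun _ => hun l hl
    rw [hiff'] at h
    rcases h with ⟨h1, h2⟩ | ⟨h1, h2⟩
    · exact eq_truth (fun h => absurd h h2) fun _ => h1
    · exact eq_truth (fun _ => h1) fun h => absurd h h2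

/-- Load the operator number `50`, counted from the end, and find the places in array `14` of its
operands and, in register `57`, of its result. The array is used as a stack, the top of which is in
register `56`. -/
def loadTok : Prog :=
  .assign 51 (.idx 7 (.sub (.sub (.reg 13) (.const 1)) (.reg 50))) ;;
  .assign 52 (.idx 1 (.reg 51)) ;;
  .assign 53 (.sub (.idx 6 (.idx 1 (.add (.reg 51) (.const 1)))) (.const 1)) ;;
  .assign 54 (.sub (.idx 6 (.idx 1 (.add (.reg 51) (.const 2)))) (.const 1)) ;;
  .assign 55 (.idx 1 (.add (.reg 51) (.const 1))) ;;
  .assign 66 (.sub (.reg 56) (.reg 40)) ;;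
  .assign 67 (.sub (.sub (.reg 56) (.reg 40)) (.reg 40)) ;;
  .ite (.lt (.reg 52) (.const 3)) (.assign 57 (.reg 56))
    (.ite (.lt (.const 3) (.reg 52))
      (.ite (.lt (.reg 52) (.const 8)) (.assign 57 (.reg 67)) (.assign 57 (.reg 66)))
      (.assign 57 (.reg 66))) ;;
  .assign 58 (.const 0)

/-- Compute in array `15` the truth table of the formula formed by the loaded operator. -/
def buildTable : Prog :=
  forLt 59 40 (evalEntry ;; .store 15 (.reg 59) (.reg 60) ;;
    .assign 58 (.add (.reg 58) (.reg 14)))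

/-- Copy the table in array `15` to its place on the stack. -/
def pushTable : Prog :=
  forLt 68 40 (.store 14 (.add (.reg 68) (.reg 57)) (.idx 15 (.reg 68))) ;;
  .assign 56 (.add (.reg 57) (.reg 40))

/-- Compute the truth table of the formula formed by the operator number `50`, counted from the
end, and put it onto the stack in place of those of its operands. -/
def evalTok : Prog := loadTok ;; buildTable ;; pushTable

/-- Compute the truth table of the formula. -/
def evalFormula : Prog := forLt 50 13 evalTok

/-- Set register `0` to `1` if all entries of the truth table are `1`, and to `0` otherwise. -/
def answer : Prog :=
  .assign 0 (.const 1) ;;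
  forLt 69 40 (.ite (.idx 14 (.reg 69)) .skip (.assign 0 (.const 0)))

end RAM

/-! ### Truth tables of all subformulas -/

namespace RAM

variable {n c : ℕ} {σ : State} {G : SimpleGraph (Fin n)} {col : Fin n → Fin c}
  {par : Fin n → Fin n} {A : Set (Fin n)} {M s : ℕ} {asg : ℕ → ℕ → Fin n} {X : Finset ℕ}

theorem Tok.Step.stackHolds {t : Tok c} {φ : FOFormula c} {st st' : List (FOFormula c)}
    (h : t.Step st φ st') {m : ℕ → ℕ} (hst : StackHolds G col A M asg st m) :
    StackHolds G col A M asg st' m := by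
  cases h with
  | eq | adj | color => exact hst
  | not | ex | all => exact hst.2
  | and | or | imp | iff => exact hst.2.2

/-- A table with `l` tables below it starts in cell `l * M`, so the top two start `M` and `2 * M`
below the end of the stack, and the result starts where the lowest operand did. Registers that the
operator does not use are loaded as well, with values about which `Loaded` says nothing. -/
theorem loadTok_run {t : Tok c} {φ : FOFormula c} {st st' : List (FOFormula c)}
    (ht : t.Step st φ st') {p : ℕ} (hp : σ.mem 7 (σ.reg 13 - 1 - σ.reg 50) = p)
    (hm : ∀ k < t.encode.length, σ.mem 1 (p + k) = t.encode.getD k 0)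
    (h56 : σ.reg 56 = st.length * M) (h40 : σ.reg 40 = M) :
    Loaded t (loadTok.run σ) ∧ (loadTok.run σ).reg 57 = st'.length * M ∧
      (loadTok.run σ).reg 58 = 0 ∧ (loadTok.run σ).reg 66 = st.length * M - M ∧
      (loadTok.run σ).reg 67 = st.length * M - M - M := by
  have h0 := hm 0 t.length_encode_pos
  have one : ∀ (l : ℕ), (l + 1) * M - M = l * M := by
    intro l
    rw [Nat.succ_mul, Nat.add_sub_cancel]
  have two : ∀ (l : ℕ), (l + 1 + 1) * M - M - M = l * M := by
    intro l
    rw [one, one]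
  cases ht with
  | eq x y =>
    have h1 := hm 1 (by simp [Tok.encode])
    have h2 := hm 2 (by simp [Tok.encode])
    simp [Tok.encode] at h0 h1 h2
    simp [loadTok, Prog.run, Expr.eval, Loaded, hp, h0, h1, h2, h56, h40]
  | adj x y =>
    have h1 := hm 1 (by simp [Tok.encode])
    have h2 := hm 2 (by simp [Tok.encode])
    simp [Tok.encode] at h0 h1 h2
    simp [loadTok, Prog.run, Expr.eval, Loaded, hp, h0, h1, h2, h56, h40]
  | color i x =>
    have h1 := hm 1 (by simp [Tok.encode])
    have h2 := hm 2 (by simp [Tok.encode])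
    simp [Tok.encode] at h0 h1 h2
    simp [loadTok, Prog.run, Expr.eval, Loaded, hp, h0, h1, h2, h56, h40]
  | ex x φ =>
    have h1 := hm 1 (by simp [Tok.encode])
    simp [Tok.encode] at h0 h1
    simp [loadTok, Prog.run, Expr.eval, Loaded, hp, h0, h1, h56, h40, one]
  | all x φ =>
    have h1 := hm 1 (by simp [Tok.encode])
    simp [Tok.encode] at h0 h1
    simp [loadTok, Prog.run, Expr.eval, Loaded, hp, h0, h1, h56, h40, one]
  | not φ =>
    simp [Tok.encode] at h0
    simp [loadTok, Prog.run, Expr.eval, Loaded, hp, h0, h56, h40, one]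
  | _ =>
    simp [Tok.encode] at h0
    simp [loadTok, Prog.run, Expr.eval, Loaded, hp, h0, h56, h40, two]

/-- The table is built outside the stack because it is to replace those of its operands, while a
quantifier consults its whole operand for each entry. -/
theorem buildTable_runs (hG : ∀ u v, G.Adj u v ↔ u ≠ v ∧ (par u = v ∨ par v = u))
    (hctx : EvalCtx col par A M s asg X σ) {t : Tok c} {φ : FOFormula c}
    {st st' : List (FOFormula c)} (ht : t.Step st φ st') (hX : t.vars ⊆ X) (hl : Loaded t σ)
    (hst : StackHolds G col A M asg st (σ.mem 14)) (h58 : σ.reg 58 = 0)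
    (h66 : σ.reg 66 = st.length * M - M) (h67 : σ.reg 67 = st.length * M - M - M) :
    Runs buildTable σ (M * (M * (s * 30 + 60) + 70 + 10 + 8) + 6) fun τ =>
      ∀ k < M, τ.mem 15 k = truth (φ.SatOn G col A (asg k)) := by
  refine (Runs.forLt (σ := σ) (i := 59) (N := 40) (t := M * (s * 30 + 60) + 70 + 10) (m := M)
    (fun j τ => τ.reg 58 = j * s ∧ ∀ k < j, τ.mem 15 k = truth (φ.SatOn G col A (asg k)))
    hctx.size (by decide) (by decide) ?_ ?_).mono (le_of_eq (by ring))
    fun _ _ h => h.2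
  · exact ⟨by simpa using h58, by simp⟩
  rintro j hj τ hf h59 ⟨e58, e15⟩
  have hctx' := hctx.of_frame hf (by decide) (by decide) (by decide) (by decide) (by decide)
    (by decide)
  refine Runs.seq (evalEntry_runs hG hctx' ht hX
    (hl.of_frame hf (by decide) (by decide) (by decide) (by decide) (by decide))
    ((hf.mem 14 (by decide)).symm ▸ hst) hj e58 h59
    ((hf.reg 66 (by decide)).trans h66) ((hf.reg 67 (by decide)).trans h67)) ?_
  intro ρ hf' h60
  have e59 : ρ.reg 59 = j := by rw [hf'.reg 59 (by decide), h59]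
  have e58' : ρ.reg 58 = j * s := by rw [hf'.reg 58 (by decide), e58]
  have e14 : ρ.reg 14 = s := by rw [hf'.reg 14 (by decide), hctx'.width]
  have em : ρ.mem 15 = τ.mem 15 := hf'.mem 15 (by decide)
  refine .straight rfl (by decide) ?_
  simp only [Prog.run, Expr.eval, State.setReg_reg, State.setReg_mem, State.setMem_reg,
    State.setMem_mem, e59, e58', e14, h60, em, if_true, if_false, Nat.reduceEqDiff]
  refine ⟨by ring, fun k hk => ?_⟩
  rcases Nat.lt_succ_iff_lt_or_eq.1 hk with hk | rfl
  · rw [Function.update_of_ne hk.ne]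
    exact e15 k hk
  · rw [Function.update_self]

theorem pushTable_runs {l : ℕ} {P : ℕ → Prop} (h57 : σ.reg 57 = l * M) (h40 : σ.reg 40 = M)
    (h15 : ∀ k < M, σ.mem 15 k = truth (P k)) :
    Runs pushTable σ (M * (10 + 8) + 6 + 4) fun τ => τ.reg 56 = (l + 1) * M ∧
      (∀ k < M, τ.mem 14 (k + l * M) = truth (P k)) ∧
      ∀ i < l * M, τ.mem 14 i = σ.mem 14 i := by
  refine Runs.seq (Runs.forLt (σ := σ) (i := 68) (N := 40) (t := 10) (m := M)
    (fun j ρ => (∀ k < j, ρ.mem 14 (k + l * M) = truth (P k)) ∧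
      ∀ i < l * M, ρ.mem 14 i = σ.mem 14 i)
    h40 (by decide) (by decide) ⟨by simp, by simp⟩ ?_) ?_
  · rintro j hj ρ hf' h68 ⟨i1, i2⟩
    have e57' : ρ.reg 57 = l * M := by rw [hf'.reg 57 (by decide), h57]
    have e15 : ρ.mem 15 = σ.mem 15 := hf'.mem 15 (by decide)
    refine .straight rfl (by decide) ?_
    simp only [Prog.run, Expr.eval, State.setReg_mem, State.setMem_mem, h68, e57', e15, if_true]
    refine ⟨fun k hk => ?_, fun i hi => ?_⟩
    · rcases Nat.lt_succ_iff_lt_or_eq.1 hk with hk | rfl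
      · rw [Function.update_of_ne (by omega)]
        exact i1 k hk
      · rw [Function.update_self]
        exact h15 k hj
    · rw [Function.update_of_ne (by omega)]
      exact i2 i hi
  · rintro ρ hf' ⟨i1, i2⟩
    have e57' : ρ.reg 57 = l * M := by rw [hf'.reg 57 (by decide), h57]
    have e40' : ρ.reg 40 = M := by rw [hf'.reg 40 (by decide), h40]
    refine .straight rfl (by decide) ?_
    simp only [Prog.run, Expr.eval, State.setReg_mem, State.setReg_reg, if_true, e57', e40']
    exact ⟨by rw [Nat.succ_mul], i1, i2⟩

theorem loadTok_runs : Runs loadTok σ 80 fun τ => τ = loadTok.run σ :=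
  .straight rfl (by decide) rfl

theorem evalTok_runs (hG : ∀ u v, G.Adj u v ↔ u ≠ v ∧ (par u = v ∨ par v = u))
    (hctx : EvalCtx col par A M s asg X σ) {t : Tok c} {φ : FOFormula c}
    {st st' : List (FOFormula c)} (ht : t.Step st φ st') (hX : t.vars ⊆ X) {p : ℕ}
    (hp : σ.mem 7 (σ.reg 13 - 1 - σ.reg 50) = p)
    (hm : ∀ k < t.encode.length, σ.mem 1 (p + k) = t.encode.getD k 0)
    (h56 : σ.reg 56 = st.length * M) (hst : StackHolds G col A M asg st (σ.mem 14)) :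
    Runs evalTok σ (M * (M * (s * 30 + 60) + 110) + 120) fun τ =>
      τ.reg 56 = (φ :: st').length * M ∧ StackHolds G col A M asg (φ :: st') (τ.mem 14) := by
  have hl := loadTok_run ht hp hm h56 hctx.size
  refine (Runs.seq loadTok_runs (u := M * (M * (s * 30 + 60) + 70 + 10 + 8) + 6 +
    (M * (10 + 8) + 6 + 4)) ?_).time_mono (by ring_nf; omega)
  intro τ hf hτ
  rw [← hτ] at hl
  obtain ⟨hl, h57, h58, h66, h67⟩ := hl
  have h14 : τ.mem 14 = σ.mem 14 := hf.mem 14 (by decide)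
  have hctx' := hctx.of_frame hf (by decide) (by decide) (by decide) (by decide) (by decide)
    (by decide)
  rw [← h14] at hst
  refine Runs.seq (buildTable_runs hG hctx' ht hX hl hst h58 h66 h67) ?_
  intro ρ hf' h15
  have h14' : ρ.mem 14 = τ.mem 14 := hf'.mem 14 (by decide)
  refine (pushTable_runs (by rw [hf'.reg 57 (by decide), h57])
    (by rw [hf'.reg 40 (by decide), hctx'.size]) h15).mono le_rfl ?_
  rintro π - ⟨h56', i1, i2⟩
  rw [h14'] at i2
  exact ⟨h56', i1, (Tok.Step.stackHolds ht hst).of_eq i2⟩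

/-- The invariant looks ahead: the operators still to come turn the present stack into `[θ]`. When
none are left, the stack is `[θ]` and its only table is the one sought. -/
theorem evalFormula_runs (hG : ∀ u v, G.Adj u v ↔ u ≠ v ∧ (par u = v ∨ par v = u))
    {θ : FOFormula c} (hctx : EvalCtx col par A M s asg θ.vars σ) (hθ : HoldsFormula θ σ)
    (h56 : σ.reg 56 = 0) :
    Runs evalFormula σ (θ.length * (M * (M * (s * 30 + 60) + 110) + 128) + 6) fun τ =>
      ∀ k < M, τ.mem 14 k = truth (θ.SatOn G col A (asg k)) := by
  have hlen := Tok.length_le_length_flatMap θ.toks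
  rw [← θ.encode_eq_flatMap] at hlen
  refine (Runs.forLt (t := M * (M * (s * 30 + 60) + 110) + 120) (m := θ.toks.length)
    (fun j τ => ∃ st, Tok.Finishes θ (θ.toks.reverse.drop j) st ∧ τ.reg 56 = st.length * M ∧
      StackHolds G col A M asg st (τ.mem 14)) hθ.size (by decide) (by decide)
    ⟨[], θ.finishes, by simp [h56], trivial⟩ ?_).mono ?_ ?_
  · rintro j hj τ hf h50 ⟨st, hfin, e56, hst⟩
    have hctx' := hctx.of_frame hf (by decide) (by decide) (by decide) (by decide) (by decide)
      (by decide)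
    have hj' : j < θ.toks.reverse.length := by simpa using hj
    rw [List.drop_eq_getElem_cons hj'] at hfin
    obtain ⟨φ, st', hstep, hfin⟩ := hfin
    have hi : θ.toks.length - 1 - j < θ.toks.length := by omega
    have htok : θ.toks.reverse[j] = θ.toks[θ.toks.length - 1 - j] := by
      rw [List.getElem_reverse]
    rw [htok] at hstep
    refine (evalTok_runs hG hctx' hstep ?_ rfl ?_ e56 hst).mono le_rfl ?_
    · rw [θ.vars_eq_varsOf]
      exact Tok.vars_subset_varsOf (List.getElem_mem hi)
    · intro k hk
      rw [hf.mem 7 (by decide), hf.mem 1 (by decide), hf.reg 13 (by decide), h50, hθ.size]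
      exact hθ.tok _ hi k hk
    · rintro ρ _ ⟨h1, h2⟩
      exact ⟨φ :: st', hfin, by simpa using h1, by simpa using h2⟩
  · rw [FOFormula.length]
    gcongr ?_ + 6
    exact Nat.mul_le_mul hlen (by omega)
  · rintro τ _ ⟨st, hfin, -, hst⟩ k hk
    rw [List.drop_of_length_le (by simp)] at hfin
    obtain rfl : st = [θ] := hfin
    simpa using hst.1 k hk

theorem answer_runs {P : ℕ → Prop} (h40 : σ.reg 40 = M) (hP : ∀ k < M, σ.mem 14 k = truth (P k)) :
    Runs answer σ (M * 20 + 10) fun τ => τ.reg 0 = truth (∀ k < M, P k) := by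
  refine (Runs.seq (t := 2) (Q := fun τ => τ = σ.setReg 0 1) (u := M * (8 + 8) + 6)
    (.straight rfl (by decide) (by simp [Prog.run, Expr.eval])) ?_).time_mono (by omega)
  rintro _ - rfl
  refine (Runs.forLt (σ := σ.setReg 0 1) (t := 8) (m := M)
    (fun j τ => τ.reg 0 = truth (∀ k < j, P k)) (by simpa using h40) (by decide) (by decide)
    (by simp [truth]) ?_).mono le_rfl fun _ _ h => h
  intro j hj τ hf hr hI
  have hm : τ.mem 14 j = truth (P j) := by
    rw [hf.mem 14 (by decide)]
    exact hP j hj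
  refine .straight rfl (by decide) ?_
  have hsucc : (∀ k < j + 1, P k) ↔ (∀ k < j, P k) ∧ P j := Nat.forall_lt_succ_right
  rw [hsucc]
  by_cases h : P j
  · rw [truth_eq_one.2 h] at hm
    simp [Prog.run, Expr.eval, hr, hm, h, hI]
  · rw [truth_eq_zero.2 h] at hm
    simp [Prog.run, Expr.eval, hr, hm, h, truth]

end RAM

/-! ## Trees with a parent map, the bound on the running time, and assignments -/

/-- The edges from the vertices other than `r` to their parents are distinct, since two vertices
cannot be parents of each other by the distances. As a tree has one edge fewer than vertices, these
are all its edges. -/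
theorem SimpleGraph.IsTree.adj_iff_of_parent {V : Type} [Fintype V] {G : SimpleGraph V}
    (hG : G.IsTree) {r : V} {par : V → V} (hr : par r = r) (hadj : ∀ v, v ≠ r → G.Adj v (par v))
    (hd : ∀ v, v ≠ r → G.dist r (par v) + 1 = G.dist r v) (u v : V) :
    G.Adj u v ↔ u ≠ v ∧ (par u = v ∨ par v = u) := by
  classical
  have hinj : Set.InjOn (fun v => s(v, par v)) (Finset.univ.erase r : Finset V) := by
    intro u hu v hv h
    simp only [Finset.coe_erase, Finset.coe_univ, Set.mem_sdiff, Set.mem_univ, true_and,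
      Set.mem_singleton_iff] at hu hv
    rcases Sym2.eq_iff.1 h with h | ⟨h1, h2⟩
    · exact h.1
    · have h3 := hd u hu
      have h4 := hd v hv
      rw [h2] at h3
      rw [← h1] at h4
      omega
  have hsub : (Finset.univ.erase r).image (fun v => s(v, par v)) ⊆ G.edgeFinset := by
    intro e he
    obtain ⟨v, hv, rfl⟩ := Finset.mem_image.1 he
    rw [SimpleGraph.mem_edgeFinset, SimpleGraph.mem_edgeSet]
    exact hadj v (Finset.ne_of_mem_erase hv)
  have heq := Finset.eq_of_subset_of_card_le hsub (by
    rw [Finset.card_image_of_injOn hinj, Finset.card_erase_of_mem (Finset.mem_univ r),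
      Finset.card_univ, ← hG.card_edgeFinset, Nat.add_sub_cancel])
  constructor
  · intro h
    have hm : s(u, v) ∈ G.edgeFinset := by simpa using h
    rw [← heq] at hm
    obtain ⟨w, -, hw⟩ := Finset.mem_image.1 hm
    rcases Sym2.eq_iff.1 hw with ⟨rfl, h2⟩ | ⟨rfl, h2⟩
    · exact ⟨h.ne, Or.inl h2⟩
    · exact ⟨h.ne, Or.inr h2⟩
  · rintro ⟨hne, rfl | rfl⟩
    · exact hadj u fun h => hne (by rw [h, hr])
    · exact (hadj v fun h => hne (by rw [h, hr])).symm

/-- By the triangle inequality through the center. No root is marked in the input, so an arbitrary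
vertex serves, at the price of a factor 2. -/
theorem HasDepthAtMost.dist_le {V : Type} {G : SimpleGraph V} (hG : G.Connected) {k : ℕ}
    (h : HasDepthAtMost G k) (u v : V) : G.dist u v ≤ 2 * k := by
  obtain ⟨r, hr⟩ := h
  have h1 := hG.dist_triangle (u := u) (v := r) (w := v)
  have h2 := hr u
  have h3 := hr v
  rw [SimpleGraph.dist_comm] at h2
  omega

/-! ### The parameter-dependent factor of the running time -/

theorem codeBound_mono {b b' h h' : ℕ} (hb : 0 < b) (hbb : b ≤ b') (hh : h ≤ h') :
    codeBound b h ≤ codeBound b' h' := by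
  have h1 : codeBound b h ≤ codeBound b' h := by
    clear hh
    induction h with
    | zero => exact hbb
    | succ h ih => exact (Nat.pow_le_pow_left hbb _).trans (Nat.pow_le_pow_right (by omega) (by omega))
  refine h1.trans (monotone_nat_of_le_succ (f := codeBound b') (fun m => ?_) hh)
  rcases Nat.lt_or_ge 1 b' with h2 | h2
  · exact (Nat.lt_pow_self h2).le.trans (Nat.pow_le_pow_right (by omega) (by omega))
  -- Powers of 1 do not grow, but then the bound is constantly 1.
  · obtain rfl : b' = 1 := by omega
    have : ∀ m, codeBound 1 m = 1 := by
      intro m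
      cases m <;> simp [codeBound]
    rw [this, this]

theorem Primrec.nat_pow : Primrec₂ ((· ^ ·) : ℕ → ℕ → ℕ) :=
  Primrec₂.unpaired'.1 Nat.Primrec.pow

theorem primrec_codeBound : Primrec₂ codeBound := by
  refine (Primrec.nat_rec (α := ℕ) (f := fun b => b) (g := fun b p => b ^ (p.2 + 2)) .id
    (Primrec.nat_pow.comp .fst (Primrec.nat_add.comp (Primrec.snd.comp .snd) (.const 2)))).of_eq ?_
  intro b h
  induction h with
  | zero => rfl
  | succ h ih => simp only [codeBound, ← ih]

/-- A bound on the codes of the vertices of a tree of depth `k` with `c` colors. -/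
def codeCap (s k c : ℕ) : ℕ := codeBound (s + c + 1) (2 * k + 1)

/-- A bound on the number of vertices of a reduced tree. -/
def treeCap (s k c : ℕ) : ℕ := (2 * k + 2) * (s * codeCap s k c + 1) ^ (2 * k + 1)

/-- A bound on the number of assignments into a reduced tree. -/
def tableCap (s k c : ℕ) : ℕ := treeCap s k c ^ s

/-- The time, relative to the size of the input, for reading the input. -/
def readTime (k : ℕ) : ℕ := (2 * k + 2) * 400 + 330

/-- The time, relative to the size of the input, for computing the reduced tree. -/
def reduceTime (D b B : ℕ) : ℕ := D * (B * (b * 12 + 40) + 130) + D * 20 + 160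

/-- The time, relative to the length of the formula, for its evaluation. -/
def evalTime (s N M : ℕ) : ℕ :=
  s * (N * 12 + 25) + s * (M * 50 + 30) + M * (M * (s * 30 + 60) + 110) + M * 20 + 160

/-- The running time relative to the size of the input. -/
def timeFactor (s k c : ℕ) : ℕ :=
  readTime k + reduceTime (2 * k + 1) (s + c + 1) (codeCap s k c) +
    evalTime s (treeCap s k c) (tableCap s k c)

/-- The factor is composed of sums, products, powers and the recursion of `codeBound`, and so is
primitive recursive. -/
theorem computable_timeFactor :
    Computable fun q : ℕ × ℕ × ℕ => timeFactor q.1 q.2.1 q.2.2 := by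
  have add : ∀ {f g : ℕ × ℕ × ℕ → ℕ}, Primrec f → Primrec g → Primrec fun q => f q + g q :=
    fun hf hg => Primrec.nat_add.comp hf hg
  have mul : ∀ {f g : ℕ × ℕ × ℕ → ℕ}, Primrec f → Primrec g → Primrec fun q => f q * g q :=
    fun hf hg => Primrec.nat_mul.comp hf hg
  have pow : ∀ {f g : ℕ × ℕ × ℕ → ℕ}, Primrec f → Primrec g → Primrec fun q => f q ^ g q :=
    fun hf hg => Primrec.nat_pow.comp hf hg
  have const : ∀ m : ℕ, Primrec fun _ : ℕ × ℕ × ℕ => m := Primrec.const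
  have hs : Primrec fun q : ℕ × ℕ × ℕ => q.1 := .fst
  have hk : Primrec fun q : ℕ × ℕ × ℕ => q.2.1 := Primrec.fst.comp .snd
  have hc : Primrec fun q : ℕ × ℕ × ℕ => q.2.2 := Primrec.snd.comp .snd
  have hD := add (mul (const 2) hk) (const 1)
  have hb := add (add hs hc) (const 1)
  have hB : Primrec fun q : ℕ × ℕ × ℕ => codeCap q.1 q.2.1 q.2.2 :=
    primrec_codeBound.comp hb hD
  have hN : Primrec fun q : ℕ × ℕ × ℕ => treeCap q.1 q.2.1 q.2.2 :=
    mul (add (mul (const 2) hk) (const 2)) (pow (add (mul hs hB) (const 1)) hD)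
  have hM : Primrec fun q : ℕ × ℕ × ℕ => tableCap q.1 q.2.1 q.2.2 := pow hN hs
  have h1 : Primrec fun q : ℕ × ℕ × ℕ => readTime q.2.1 :=
    add (mul (add (mul (const 2) hk) (const 2)) (const 400)) (const 330)
  have h2 : Primrec fun q : ℕ × ℕ × ℕ =>
      reduceTime (2 * q.2.1 + 1) (q.1 + q.2.2 + 1) (codeCap q.1 q.2.1 q.2.2) :=
    add (add (mul hD (add (mul hB (add (mul hb (const 12)) (const 40))) (const 130)))
      (mul hD (const 20))) (const 160)
  have h3 : Primrec fun q : ℕ × ℕ × ℕ =>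
      evalTime q.1 (treeCap q.1 q.2.1 q.2.2) (tableCap q.1 q.2.1 q.2.2) :=
    add (add (add (add (mul hs (add (mul hN (const 12)) (const 25)))
      (mul hs (add (mul hM (const 50)) (const 30))))
      (mul hM (add (mul hM (add (mul hs (const 30)) (const 60))) (const 110))))
      (mul hM (const 20))) (const 160)
  exact (add (add h1 h2) h3).to_comp

/-! ### Assignments as digit sequences -/

theorem exists_digits {N s : ℕ} (d : ℕ → ℕ) (hd : ∀ i, d i < N) :
    ∃ k < N ^ s, ∀ i < s, k / N ^ i % N = d i := by
  have hN : 0 < N := (Nat.zero_le _).trans_lt (hd 0)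
  induction s generalizing d with
  | zero => exact ⟨0, by simp, by simp⟩
  | succ s ih =>
    obtain ⟨k, hk, h⟩ := ih (fun i => d (i + 1)) fun i => hd (i + 1)
    have h0 := hd 0
    refine ⟨d 0 + N * k, ?_, fun i hi => ?_⟩
    · calc d 0 + N * k < N * (k + 1) := by rw [Nat.mul_succ]; omega
        _ ≤ N * N ^ s := Nat.mul_le_mul_left N hk
        _ = N ^ (s + 1) := by ring
    · cases i with
      | zero => rw [pow_zero, Nat.div_one, Nat.add_mul_mod_self_left, Nat.mod_eq_of_lt h0]
      | succ i =>
        rw [pow_succ', ← Nat.div_div_eq_div_mul, Nat.add_mul_div_left _ _ hN,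
          Nat.div_eq_of_lt h0, zero_add]
        exact h i (by omega)

/-- Row `k` stands for the assignment that sends `x` to the list entry given by digit `num x` of
`k`. Outside `X` all assignments have the same constant value, so that rows agreeing outside one
column give functions that differ at most at one variable. -/
theorem exists_isTable {V : Type} {X : Finset ℕ} {A : Set V} {N s : ℕ} {num tab : ℕ → ℕ}
    {code : V → ℕ} {lst : ℕ → V} (hcode : Function.Injective code) (hnum : ∀ x ∈ X, num x < s)
    (hinj : ∀ x ∈ X, ∀ y ∈ X, num x = num y → x = y) (hA : ∀ i, lst i ∈ A)
    (hlst : ∀ a ∈ A, ∃ i < N, lst i = a) (hN : 0 < N)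
    (htab : ∀ k < N ^ s, ∀ i < s, tab (i + k * s) = code (lst (k / N ^ i % N))) :
    ∃ asg, IsTable X A (N ^ s) s num asg code tab := by
  classical
  set asg : ℕ → ℕ → V := fun k x => if x ∈ X then lst (k / N ^ num x % N) else lst 0 with hasg
  have hin : ∀ k x, x ∈ X → asg k x = lst (k / N ^ num x % N) := fun k x hx => if_pos hx
  have hout : ∀ k x, x ∉ X → asg k x = lst 0 := fun k x hx => if_neg hx
  have hdig : ∀ d : ℕ → ℕ, (∀ x, d x < N) →
      ∃ k < N ^ s, ∀ i < s, k / N ^ i % N = d i := fun d hd => exists_digits d hd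
  have hagree : ∀ k < N ^ s, ∀ l < N ^ s, ∀ x ∈ X,
      (∀ i < s, i ≠ num x → tab (i + k * s) = tab (i + l * s)) →
      asg l = Function.update (asg k) x (asg l x) := by
    intro k hk l hl x hx h
    funext y
    by_cases hxy : y = x
    · rw [hxy, Function.update_self]
    · rw [Function.update_of_ne hxy]
      by_cases hy : y ∈ X
      · have h1 := h (num y) (hnum y hy) fun he => hxy (hinj y hy x hx he)
        rw [htab k hk _ (hnum y hy), htab l hl _ (hnum y hy)] at h1
        rw [hin _ _ hy, hin _ _ hy, hcode h1]
      · rw [hout _ _ hy, hout _ _ hy]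
  refine ⟨asg, fun k hk x hx => ?_, fun k x => ?_, hagree, fun k hk x hx a ha => ?_,
    fun v hv => ?_⟩
  · rw [htab k hk _ (hnum x hx), hin k x hx]
  · by_cases hx : x ∈ X
    · rw [hin k x hx]
      exact hA _
    · rw [hout k x hx]
      exact hA _
  · obtain ⟨j, hj, rfl⟩ := hlst a ha
    obtain ⟨l, hl, h⟩ := hdig (fun i => if i = num x then j else k / N ^ i % N) fun i => by
      split_ifs
      exacts [hj, Nat.mod_lt _ hN]
    have h1 : ∀ i < s, i ≠ num x → tab (i + k * s) = tab (i + l * s) := by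
      intro i hi hne
      rw [htab k hk i hi, htab l hl i hi, h i hi, if_neg hne]
    refine ⟨l, hl, h1, ?_⟩
    rw [hagree k hk l hl x hx h1, hin l x hx, h _ (hnum x hx), if_pos rfl]
  · choose idx hidx hidx' using fun x => hlst (v x) (hv x)
    -- Digit `i` is an index of the value of the variable with number `i`; a column that belongs to
    -- no variable gets 0.
    obtain ⟨k, hk, h⟩ := hdig (fun i => if hi : ∃ x ∈ X, num x = i then idx hi.choose else 0)
      fun i => by
        split_ifs
        exacts [hidx _, hN]
    refine ⟨k, hk, fun x hx => ?_⟩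
    have hex : ∃ y ∈ X, num y = num x := ⟨x, hx, rfl⟩
    rw [hin k x hx, h _ (hnum x hx), dif_pos hex,
      hinj _ hex.choose_spec.1 x hx hex.choose_spec.2, hidx']

/-! ## The algorithm -/

theorem FOFormula.length_pos {c : ℕ} (φ : FOFormula c) : 0 < φ.length := by
  rw [FOFormula.length]
  cases φ <;> simp [FOFormula.encode]

namespace RAM

variable {n c : ℕ} {σ : State} {G : SimpleGraph (Fin n)} {col : Fin n → Fin c}
  {nb : Fin n → List (Fin n)} {φ : FOFormula c} {par : Fin n → Fin n} {r : Fin n} {s D : ℕ}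

/-- Parse the input and find parents and distances from vertex `0`. -/
def readInput : Prog := parseGraph ;; bfs ;; parseFormula

/-- The tree, rooted at `r`, and the formula in the memory. -/
structure HoldsInput (G : SimpleGraph (Fin n)) (col : Fin n → Fin c) (φ : FOFormula c)
    (r : Fin n) (par : Fin n → Fin n) (D : ℕ) (σ : State) : Prop where
  size : σ.reg 2 = n
  height : σ.reg 8 = D
  color : ∀ v : Fin n, σ.mem 0 (v + 1) = col v
  depth : ∀ v : Fin n, σ.mem 4 v = G.dist r v + 1
  parent : ∀ v : Fin n, σ.mem 5 v = par v
  formula : HoldsFormula φ σ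
  isParentMap : IsParentMap r (G.dist r) par
  adj_iff : ∀ u v, G.Adj u v ↔ u ≠ v ∧ (par u = v ∨ par v = u)
  dist_le : ∀ v, G.dist r v ≤ D

theorem mem_initial_color (w : List ℕ) (v : Fin n) :
    (initial (encodeColoredGraph col nb) w).mem 0 (v + 1) = col v := by
  have hL : encodeColoredGraph col nb = n :: ((List.ofFn fun v => (col v : ℕ)) ++
      (List.finRange n).flatMap fun v => (nb v).length :: (nb v).map fun w : Fin n => (w : ℕ)) := by
    rw [encodeColoredGraph]
    simp only [List.map_id']
    simp only [List.map_eq_flatMap, List.bind_eq_flatMap, List.pure_def]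
  simp only [initial, if_true, hL, List.getD_cons_succ]
  rw [List.getD_append _ _ _ _ (by simp), List.getD_eq_getElem _ _ (by simp)]
  simp

/-- Vertex 0 becomes the root. As `D` serves the number of rounds of the search, which the machine
knows; it bounds all distances and is at most `2 * k + 1`. -/
theorem readInput_runs {k : ℕ} (hG : G.IsTree) (hk : HasDepthAtMost G k)
    (hnb : IsAdjacencyList G nb) :
    Runs readInput (initial (encodeColoredGraph col nb) φ.encode)
      (readTime k * (n + φ.length)) fun τ =>
      ∃ r par D, D ≤ 2 * k + 1 ∧ HoldsInput G col φ r par D τ := by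
  have hpos : 0 < n := by
    obtain ⟨v⟩ := hG.connected.nonempty
    exact v.pos
  set r : Fin n := ⟨0, hpos⟩ with hr
  have hD : ∀ v, G.dist r v ≤ 2 * k := hk.dist_le hG.connected r
  refine ((parseGraph_runs_of_isTree hG hnb rfl).seq (u := (2 * k + 2) * (200 * (n + 1)) +
    (φ.length * 100 + 10)) fun τ hf hg => ?_).mono ?_ ?_ (Q := fun τ => τ.reg 2 = n ∧
      τ.reg 8 ≤ 2 * k + 1 ∧ (∀ v, G.dist r v ≤ τ.reg 8) ∧ BfsInv G r (τ.reg 8) 0 τ ∧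
      HoldsFormula φ τ)
  · refine (bfs_runs hG.connected hg rfl hD (fun i => ?_) (fun i => ?_) ?_ ?_).seq
      fun ρ hf' h => ?_
    · rw [hf.mem 4 (by decide)]; rfl
    · rw [hf.mem 5 (by decide)]; rfl
    · rw [hf.reg 8 (by decide)]; rfl
    · rw [hf.reg 9 (by decide)]; rfl
    refine (parseFormula_runs φ ?_ (fun i => ?_) ?_ ?_ ?_ fun i => ?_).mono le_rfl ?_
    · rw [hf'.reg 1 (by decide), hf.reg 1 (by decide)]; rfl
    · rw [hf'.mem 1 (by decide), hf.mem 1 (by decide)]; rfl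
    · rw [hf'.reg 12 (by decide), hf.reg 12 (by decide)]; rfl
    · rw [hf'.reg 13 (by decide), hf.reg 13 (by decide)]; rfl
    · rw [hf'.reg 14 (by decide), hf.reg 14 (by decide)]; rfl
    · rw [hf'.mem 6 (by decide), hf.mem 6 (by decide)]; rfl
    intro π hf'' hφ
    have e8 : π.reg 8 = ρ.reg 8 := hf''.reg 8 (by decide)
    refine ⟨?_, e8 ▸ h.1, e8 ▸ h.2.1, ?_, hφ⟩
    · rw [hf''.reg 2 (by decide), hf'.reg 2 (by decide), hg.size]
    · rw [e8]
      exact h.2.2.of_eq (hf''.mem 2 (by decide)) (hf''.mem 3 (by decide)) (hf''.mem 4 (by decide))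
        (hf''.mem 5 (by decide))
  · rw [readTime]
    have := φ.length_pos
    nlinarith [Nat.zero_le (k * φ.length), Nat.mul_le_mul_left k hpos]
  · rintro τ hf ⟨h2, h8, hle, hbfs, hφ⟩
    have hpar : ∀ v : Fin n, ∃ u : Fin n, τ.mem 5 v = u ∧ (v = r → u = r) ∧
        (v ≠ r → G.Adj v u ∧ G.dist r u + 1 = G.dist r v) := by
      intro v
      by_cases hv : v = r
      · exact ⟨r, hv ▸ hbfs.root, fun _ => rfl, fun h => absurd hv h⟩
      · obtain ⟨u, h1, h2⟩ := hbfs.parent v hv (by rw [hbfs.near v (hle v)]; omega)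
        exact ⟨u, h1, fun h => absurd h hv, fun _ => h2⟩
    choose par h5 hroot hadj using hpar
    refine ⟨r, par, τ.reg 8, h8, ?_⟩
    exact {
      size := h2
      height := rfl
      color := by
        rw [hf.mem 0 (by decide)]
        exact mem_initial_color _
      depth := fun v => hbfs.near v (hle v)
      parent := h5
      formula := hφ
      isParentMap := ⟨hroot r rfl, SimpleGraph.dist_self, fun v hv => (hadj v hv).2⟩
      adj_iff := hG.adj_iff_of_parent (hroot r rfl) (fun v hv => (hadj v hv).1)
        fun v hv => (hadj v hv).2
      dist_le := hle }

theorem HoldsInput.of_frame {p : Prog} {τ : State} (h : HoldsInput G col φ r par D σ)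
    (hf : Frame p σ τ) (h2 : 2 ∉ p.regs) (h8 : 8 ∉ p.regs) (h13 : 13 ∉ p.regs) (h14 : 14 ∉ p.regs)
    (m0 : 0 ∉ p.arrs) (m1 : 1 ∉ p.arrs) (m4 : 4 ∉ p.arrs) (m5 : 5 ∉ p.arrs) (m6 : 6 ∉ p.arrs)
    (m7 : 7 ∉ p.arrs) : HoldsInput G col φ r par D τ where
  size := (hf.reg 2 h2).trans h.size
  height := (hf.reg 8 h8).trans h.height
  color := by rw [hf.mem 0 m0]; exact h.color
  depth := by rw [hf.mem 4 m4]; exact h.depth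
  parent := by rw [hf.mem 5 m5]; exact h.parent
  formula :=
    { size := (hf.reg 13 h13).trans h.formula.size
      tok := by rw [hf.mem 1 m1, hf.mem 7 m7]; exact h.formula.tok
      interned := h.formula.interned.of_eq (hf.reg 14 h14) (hf.mem 6 m6) }
  isParentMap := h.isParentMap
  adj_iff := h.adj_iff
  dist_le := h.dist_le

/-- Compute the reduced tree. -/
def reduceTree : Prog := findBase ;; initCodes ;; computeCodes ;; collect

/-- Counts are truncated at the actual number of variables, which the machine knows, and not at `s`.
The bounds in terms of `s` and `c` follow by monotonicity. -/
theorem reduceTree_runs (h : HoldsInput G col φ r par D σ) (hs : φ.vars.card ≤ s)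
    {B : ℕ} (hB : codeBound (s + c + 1) D ≤ B) (hn : 0 < n) (h9 : ∀ i, σ.mem 9 i = 0)
    (h10 : ∀ i, σ.mem 10 i = 0) (h31 : σ.reg 31 = 0) :
    Runs reduceTree σ (reduceTime D (s + c + 1) B * n) fun τ =>
      ∃ (A : Set (Fin n)) (code : Fin n → ℕ), (∀ p q, code p = code q → col p = col q) ∧
        CodeCounts r par code φ.vars.card ∧ CountClosed r par code φ.vars.card A ∧
        HoldsList A τ ∧ τ.reg 31 ≤ (D + 1) * (s * B + 1) ^ D := by
  classical
  have h14 := h.formula.interned.card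
  refine ((findBase_runs h.size h14 h.color).seq (u := n * 30 + 20 +
    (D * (n * (B * ((s + c + 1) * 12 + 40) + 100) + 30) + 6 + (n * (D * 20 + 48) + 6)))
    fun τ hf ⟨hsb, hcb, hb⟩ => ?_).time_mono ?_
  swap
  · rw [reduceTime]
    nlinarith [Nat.mul_le_mul_left D hn]
  have hbs : τ.reg 17 ≤ s + c + 1 := by omega
  have hB' : codeBound (τ.reg 17) D ≤ B := (codeBound_mono (by omega) hbs le_rfl).trans hB
  replace h := h.of_frame hf (by decide) (by decide) (by decide) (by decide) (by decide)
    (by decide) (by decide) (by decide) (by decide) (by decide)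
  refine (initCodes_runs h.size h.color).seq fun ρ hf' h8 => ?_
  have e17 : ρ.reg 17 = τ.reg 17 := hf'.reg 17 (by decide)
  replace h := h.of_frame hf' (by decide) (by decide) (by decide) (by decide) (by decide)
    (by decide) (by decide) (by decide) (by decide) (by decide)
  have hctx : CodeCtx (G.dist r) par (τ.reg 17) φ.vars.card ρ :=
    ⟨h.size, h.formula.interned.card, e17, h.depth, h.parent⟩
  have hinit : HoldsCodes r par (τ.reg 17) φ.vars.card (fun v => (col v : ℕ)) ∅ ρ := by
    refine ⟨∅, _, _, .init, h8, fun g p => ?_, fun v => ?_⟩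
    · rw [hf'.mem 10 (by decide), hf.mem 10 (by decide), h10]
    · rw [hf'.mem 9 (by decide), hf.mem 9 (by decide), h9]
      simp
  refine ((computeCodes_runs hctx h.isParentMap hsb hcb h.dist_le h.height hB' hinit).time_mono
    (by gcongr)).seq fun π hf'' hcodes => ?_
  replace h := h.of_frame hf'' (by decide) (by decide) (by decide) (by decide) (by decide)
    (by decide) (by decide) (by decide) (by decide) (by decide)
  obtain ⟨K, cd, cnt, hI, -, -, e9⟩ := hcodes
  refine (collect_runs h.size h.depth h.parent e9 h.dist_le ?_).mono le_rfl ?_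
  · rw [hf''.reg 31 (by decide), hf'.reg 31 (by decide), hf.reg 31 (by decide), h31]
  intro π' hf''' hlist
  refine ⟨_, cd, fun p q hpq => Fin.ext (hI.digits_eq hsb hcb hpq).1,
    by convert CodeInv.codeCounts (by convert hI) hsb hcb,
    by convert CodeInv.countClosed (s := φ.vars.card) (by convert hI) h.isParentMap, hlist, ?_⟩
  rw [hlist.card]
  have hlt := hI.code_lt h.isParentMap hsb hcb h.dist_le D
  refine (hI.card_reducedTree_le h.isParentMap (B := B)
    (fun v => (hlt v (by omega)).trans_le hB') h.dist_le).trans ?_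
  gcongr

/-- Evaluate the formula in the reduced tree. -/
def evalInput : Prog := computePowers ;; computeTuples ;; evalFormula ;; answer

theorem evalInput_runs (h : HoldsInput G col φ r par D σ) (hs : φ.vars.card ≤ s)
    {A : Set (Fin n)} {code : Fin n → ℕ} (hcol : ∀ p q, code p = code q → col p = col q)
    (hcode : CodeCounts r par code φ.vars.card) (hA : CountClosed r par code φ.vars.card A)
    (hlist : HoldsList A σ) {N : ℕ} (hN : σ.reg 31 ≤ N) (h56 : σ.reg 56 = 0) :
    Runs evalInput σ (evalTime s N (N ^ s) * φ.length) fun τ =>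
      τ.reg 0 = truth (φ.Models G col) := by
  obtain ⟨i₀, hi₀, -⟩ := hlist.exists_index r hA.root_mem
  have hpos : 0 < σ.reg 31 := by omega
  have hM : σ.reg 31 ^ φ.vars.card ≤ N ^ s :=
    (Nat.pow_le_pow_left hN _).trans (Nat.pow_le_pow_right (hpos.trans_le hN) hs)
  set M := N ^ s
  -- The terms for powers, tuples and answer do not depend on the formula and are absorbed because
  -- its length is at least 1.
  have htime : s * (N * 12 + 25) + 10 + (s * (M * 50 + 30) + 6 +
      (φ.length * (M * (M * (s * 30 + 60) + 110) + 128) + 6 + (M * 20 + 10))) ≤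
      evalTime s N M * φ.length := by
    have := φ.length_pos
    rw [evalTime]
    generalize s * (N * 12 + 25) = a, s * (M * 50 + 30) = b, M * 20 = d,
      M * (M * (s * 30 + 60) + 110) = e
    nlinarith [Nat.le_mul_of_pos_right a this, Nat.le_mul_of_pos_right b this,
      Nat.le_mul_of_pos_right d this]
  refine Runs.time_mono ?_ htime
  refine ((computePowers_runs rfl h.formula.interned.card).time_mono (by gcongr)).seq
    fun τ hf ⟨h40, h12⟩ => ?_
  have e31 : τ.reg 31 = σ.reg 31 := hf.reg 31 (by decide)
  have e11 : τ.mem 11 = σ.mem 11 := hf.mem 11 (by decide)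
  replace h := h.of_frame hf (by decide) (by decide) (by decide) (by decide) (by decide)
    (by decide) (by decide) (by decide) (by decide) (by decide)
  refine ((computeTuples_runs hpos e31 h.formula.interned.card h40 h12).time_mono
    (by gcongr)).seq fun ρ hf' h13 => ?_
  replace h := h.of_frame hf' (by decide) (by decide) (by decide) (by decide) (by decide)
    (by decide) (by decide) (by decide) (by decide) (by decide)
  have hint := h.formula.interned
  -- The list is continued by the root beyond its end, to make it a total function into `A`.
  have hlst : ∀ i, ∃ v ∈ A, i < σ.reg 31 → σ.mem 11 i = v := by
    intro i
    by_cases hi : i < σ.reg 31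
    · obtain ⟨v, hv, e⟩ := hlist.mem i hi
      exact ⟨v, hv, fun _ => e⟩
    · exact ⟨r, hA.root_mem, fun h => absurd h hi⟩
  choose lst hlstA hlst using hlst
  have hone : ∀ x ∈ φ.vars, 0 < ρ.mem 6 x := fun x hx =>
    Nat.pos_of_ne_zero fun h0 => (hint.eq_zero x).1 h0 hx
  obtain ⟨asg, htab⟩ := exists_isTable (X := φ.vars) (A := A) (N := σ.reg 31)
    (s := φ.vars.card) (num := fun x => ρ.mem 6 x - 1) (tab := ρ.mem 13) (lst := lst)
    Fin.val_injective
    (fun x hx => by have := hone x hx; have := hint.le x; omega)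
    (fun x hx y hy he => hint.inj x hx y hy (by
      have := hone x hx; have := hone y hy; omega))
    hlstA (fun a ha => by
      obtain ⟨i, hi, e⟩ := hlist.exists_index a ha
      exact ⟨i, hi, Fin.ext ((hlst i hi).symm.trans e)⟩) hpos (fun k hk i hi => by
      rw [h13 k hk i hi, e11, hlst _ (Nat.mod_lt _ hpos)])
  have hctx : EvalCtx col par A (σ.reg 31 ^ φ.vars.card) φ.vars.card asg φ.vars ρ :=
    ⟨hint.card, by rw [hf'.reg 40 (by decide), h40], h.parent, h.color, htab⟩
  refine ((evalFormula_runs h.adj_iff hctx h.formula ?_).time_mono (by gcongr)).seq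
    fun π hf'' h14 => ?_
  · rw [hf'.reg 56 (by decide), hf.reg 56 (by decide), h56]
  refine (answer_runs (M := σ.reg 31 ^ φ.vars.card) ?_ h14).mono (by gcongr) fun _ _ h0 => ?_
  · rw [hf''.reg 40 (by decide), hctx.size]
  -- The rows of the table are the exhaustive family of assignments; demanding truth in all of them
  -- is what treats free variables as universally quantified.
  rw [h0, models_iff_satOn h.isParentMap h.adj_iff hcol hcode hA φ le_rfl
    {v | ∃ k < σ.reg 31 ^ φ.vars.card, asg k = v}]
  · congr 1
    simp
  · rintro _ ⟨k, -, rfl⟩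
    exact htab.asg_mem k
  · intro v hv
    obtain ⟨k, hk, e⟩ := htab.exhaustive v hv
    exact ⟨_, ⟨k, hk, rfl⟩, e⟩

/-- Decide whether a formula holds in a tree. -/
def modelCheck : Prog := readInput ;; reduceTree ;; evalInput

/-- Reduction is linear in `n` alone and evaluation in `φ.length` alone. The height found by the
machine enters all bounds monotonically, so `2 * k + 1` may replace it. -/
theorem modelCheck_runs {k : ℕ} (hs : φ.vars.card ≤ s) (hG : G.IsTree) (hk : HasDepthAtMost G k)
    (hnb : IsAdjacencyList G nb) :
    Runs modelCheck (initial (encodeColoredGraph col nb) φ.encode)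
      (timeFactor s k c * (n + φ.length)) fun τ => τ.reg 0 = truth (φ.Models G col) := by
  have hpos : 0 < n := by
    obtain ⟨v⟩ := hG.connected.nonempty
    exact v.pos
  refine ((readInput_runs hG hk hnb).seq (u := reduceTime (2 * k + 1) (s + c + 1)
    (codeCap s k c) * (n + φ.length) + evalTime s (treeCap s k c) (tableCap s k c) *
    (n + φ.length)) fun τ hf ⟨r, par, D, hD, h⟩ => ?_).time_mono (by rw [timeFactor]; linarith)
  have hB : codeBound (s + c + 1) D ≤ codeCap s k c := codeBound_mono (by omega) le_rfl hD
  refine ((reduceTree_runs h hs hB hpos (fun i => ?_) (fun i => ?_) ?_).time_mono ?_).seq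
    fun ρ hf' ⟨A, code, hcol, hcode, hA, hlist, hN⟩ => ?_
  · rw [hf.mem 9 (by decide)]; rfl
  · rw [hf.mem 10 (by decide)]; rfl
  · rw [hf.reg 31 (by decide)]; rfl
  · rw [reduceTime, reduceTime]
    gcongr
    omega
  refine (evalInput_runs (N := treeCap s k c) (h.of_frame hf' (by decide) (by decide) (by decide)
    (by decide) (by decide) (by decide) (by decide) (by decide) (by decide) (by decide)) hs hcol
    hcode hA hlist (hN.trans ?_) ?_).time_mono (Nat.mul_le_mul_left _ (by omega))
  · rw [treeCap]
    exact Nat.mul_le_mul (by omega) (Nat.pow_le_pow_right (by omega) hD)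
  · rw [hf'.reg 56 (by decide), hf.reg 56 (by decide)]; rfl

end RAM

theorem mainTheorem8 :
    ∃ f : ℕ → ℕ → ℕ → ℕ,
      Computable (fun q : ℕ × ℕ × ℕ => f q.1 q.2.1 q.2.2) ∧
      ∃ (P : RAM.Prog) (C : ℕ),
        ∀ (s k c n : ℕ) (φ : FOFormula c) (G : SimpleGraph (Fin n)) (col : Fin n → Fin c)
          (nb : Fin n → List (Fin n)),
          φ.vars.card ≤ s → G.IsTree → HasDepthAtMost G k → IsAdjacencyList G nb →
          RAM.DecidesWithin P (encodeColoredGraph col nb) φ.encode (φ.Models G col)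
            (C * (f s k c * (n + φ.length))) := by
  refine ⟨timeFactor, computable_timeFactor, RAM.modelCheck, 1, ?_⟩
  intro s k c n φ G col nb hs hG hk hnb
  obtain ⟨t, τ, he, ht, h⟩ := RAM.modelCheck_runs (col := col) hs hG hk hnb
  exact ⟨t, τ, he, by rwa [one_mul], fun hm => h.trans (truth_eq_one.2 hm),
    fun hm => h.trans (truth_eq_zero.2 hm)⟩
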